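/- Let $L>0$, $\mathbb T=\mathbb R/L\mathbb Z$, and for $n\in\mathbb Z$ put $k_n=2\pi n/L$ (so $k_n=n$ if $L=2\pi$). Let $\alpha,\beta,\gamma\in\mathbb R$ with $\alpha\ne0$, $\beta\neq 0$, $\gamma\neq0$, $|\gamma|\neq1$, and let $s\ge 1/2$. Consider the Cauchy problem for the periodic Schrödinger–Benjamin–Ono system $$ iu_t+u_{xx}=\alpha vu,\qquad v_t+\gamma D v_x=\beta(|u|^2)_x,\qquad u(0)=u_0,\ v(0)=v_0, $$ where $u$ is complex valued, $v$ is real valued, $x\in\mathbb T$, and $D$ is the Fourier multiplier with symbol $|k_n|$. Let $\|f\|_{H^s}^2=L\sum_n(1+n^2)^s|\widehat f(n)|^2$ and, with $\langle x\rangle=1+|x|$, $$\|u\|_{X^{s,b}_{per}}^2=\sum_{n}\int_{\mathbb R}\langle\tau+k_n^2\rangle^{2b}\langle n\rangle^{2s}|\widehat u(\tau,n)|^2d\tau,\qquad \|v\|_{Y^{s,b}_{\gamma,per}}^2=\sum_{n}\int_{\mathbb R}\langle\tau+\gamma|k_n|k_n\rangle^{2b}\langle n\rangle^{2s}|\widehat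 v(\tau,n)|^2d\tau .$$ Fix a smooth $\psi:\mathbb R\to\mathbb R$ supported in $[-2,2]$ with $\psi=1$ on $[-1,1]$, and put $\psi_T(t)=\psi(t/T)$. Then there is $b_0>1/2$ such that for every $b\in(1/2,b_0)$ the problem is locally well-posed in $H^s(\mathbb T)\times H^{s-1/2}(\mathbb T)$ in the following sense. For every $R>0$ there is $T>0$ such that, for all complex-valued $u_0\in H^s(\mathbb T)$ and real-valued $v_0\in H^{s-1/2}(\mathbb T)$ with $\|u_0\|_{H^s}<R$ and $\|v_0\|_{H^{s-1/2}}<R$: 1. there is a solution on $[0,T]$ of the form $(\psi_Tu,\psi_Tv)$ with $u\in X^{s,b}_{per}$ and $v\in Y^{s-1/2,b}_{\gamma,per}$ ($v$ real valued); 2. any two solutions on $[0,T]$ of this form with the same data coincide on $[0,T]$; 3. the solution belongs to $C([0,T];H^s(\mathbb T))\times C([0,T];H^{s-1/2}(\mathbb T))$. Moreover, $(u,v)$ in 1. can be chosen so that the solution map $S:(u_0,v_0)\mapsto(u,v)$ is $C^\infty$ (over $\mathbb R$) from $\{\|u_0\|_{H^s}<R,\ \|v_0\|_{H^{s-1/2}}<R\}$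 to $X^{s,b}_{per}\times Y^{s-1/2,b}_{\gamma,per}$, and the map from the data to the solution on $[0,T]$ is $C^\infty$ from the same set to $C([0,T];H^s(\mathbb T))\times C([0,T];H^{s-1/2}(\mathbb T))$. Here a solution on $[0,T]$ is a pair which is continuous on $[0,T]$ with values in $L^2(\mathbb T)$, takes the initial values at $t=0$, and satisfies both equations at each $t\in[0,T]$ in the sense of periodic distributions on $\mathbb T$ (for every Fourier coefficient). -/

import Mathlib

open MeasureTheory Set
open scoped FourierTransform ContDiff

noncomputable section

namespace SBO

/-! ### Square-integrable functions on the circle `𝕋 = ℝ / Lℤ` -/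

/-- `L²(𝕋)`, complex valued, with respect to the normalized measure `dx / L`. -/
abbrev L2T (L : ℝ) [Fact (0 < L)] : Type :=
  Lp ℂ 2 (AddCircle.haarAddCircle : Measure (AddCircle L))

/-- The wave number `k = 2πn/L` of the `n`-th Fourier mode `exp (i k x)`; so `∂ₓ` has the symbol
`i k`, and `D = 𝓗 ∂ₓ` has the symbol `|k|`. -/
def waveNumber (L : ℝ) (n : ℤ) : ℝ := 2 * Real.pi * n / L

/-- The bracket `⟨x⟩ = 1 + |x|`. -/
def bracket (x : ℝ) : ℝ := 1 + |x|

/-- Real-valued elements of `L²(𝕋)`. -/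
def IsRealValued {L : ℝ} [Fact (0 < L)] (f : L2T L) : Prop :=
  ∀ᵐ x ∂(AddCircle.haarAddCircle : Measure (AddCircle L)), (f x).im = 0

/-- The `n`-th Fourier coefficient as a continuous linear functional on `L²(𝕋)`. -/
def coeffL (L : ℝ) [Fact (0 < L)] (n : ℤ) : L2T L →L[ℂ] ℂ :=
  innerSL ℂ (fourierLp (T := L) 2 n)

theorem coeffL_apply {L : ℝ} [Fact (0 < L)] (n : ℤ) (f : L2T L) :
    coeffL L n f = fourierCoeff f n := by
  rw [← fourierBasis_repr, HilbertBasis.repr_apply_apply, coe_fourierBasis]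
  rfl

theorem eq_zero_of_coeffL {L : ℝ} [Fact (0 < L)] {f : L2T L} (h : ∀ n, coeffL L n f = 0) :
    f = 0 := by
  apply (fourierBasis (T := L)).repr.injective
  ext n
  rw [fourierBasis_repr, ← coeffL_apply, h n, map_zero]
  rfl

theorem isRealValued_zero {L : ℝ} [Fact (0 < L)] : IsRealValued (0 : L2T L) := by
  unfold IsRealValued
  filter_upwards [Lp.coeFn_zero ℂ 2 (AddCircle.haarAddCircle : Measure (AddCircle L))] with x hx
  rw [hx]
  rfl

theorem IsRealValued.add {L : ℝ} [Fact (0 < L)] {f g : L2T L} (hf : IsRealValued f)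
    (hg : IsRealValued g) : IsRealValued (f + g) := by
  unfold IsRealValued at *
  filter_upwards [hf, hg, Lp.coeFn_add f g] with x h1 h2 h3
  rw [h3, Pi.add_apply, Complex.add_im, h1, h2, add_zero]

theorem IsRealValued.smul {L : ℝ} [Fact (0 < L)] {f : L2T L} (c : ℝ) (hf : IsRealValued f) :
    IsRealValued (c • f) := by
  unfold IsRealValued at *
  filter_upwards [hf, Lp.coeFn_smul c f] with x h1 h3
  rw [h3, Pi.smul_apply, Complex.smul_im, h1, smul_zero]

/-! ### Sobolev spaces `H^s(𝕋)`

Only `s ≥ 0` is used; then `H^s(𝕋)` consists of square-integrable functions. -/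

/-- The sequence `√L (1 + n²)^{s/2} f̂(n)`; its `ℓ²` norm is the `H^s` norm of `f`. -/
def sobolevSeq (L : ℝ) [Fact (0 < L)] (s : ℝ) (f : L2T L) (n : ℤ) : ℂ :=
  ((Real.sqrt L * (1 + (n : ℝ) ^ 2) ^ (s / 2) : ℝ) : ℂ) * fourierCoeff f n

theorem sobolevSeq_add {L : ℝ} [Fact (0 < L)] (s : ℝ) (f g : L2T L) :
    sobolevSeq L s (f + g) = sobolevSeq L s f + sobolevSeq L s g := by
  funext n
  simp only [sobolevSeq, ← coeffL_apply, map_add, Pi.add_apply, mul_add]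

theorem sobolevSeq_smul {L : ℝ} [Fact (0 < L)] (s : ℝ) (c : ℂ) (f : L2T L) :
    sobolevSeq L s (c • f) = c • sobolevSeq L s f := by
  funext n
  simp only [sobolevSeq, ← coeffL_apply, map_smul, Pi.smul_apply, smul_eq_mul]
  ring

/-- The `f` in `L²(𝕋)` with `L ∑ₙ (1 + n²)^s |f̂(n)|² < ∞`. -/
def sobolevSubmodule (L : ℝ) [Fact (0 < L)] (s : ℝ) : Submodule ℂ (L2T L) where
  carrier := {f | Memℓp (sobolevSeq L s f) 2}
  zero_mem' := by
    have h : sobolevSeq L s (0 : L2T L) = 0 := by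
      funext n
      rw [sobolevSeq, ← coeffL_apply, map_zero, mul_zero]
      rfl
    simpa only [mem_ofPred_eq, h] using zero_memℓp
  add_mem' {f g} hf hg := by
    simp only [mem_ofPred_eq, sobolevSeq_add] at *
    exact hf.add hg
  smul_mem' c f hf := by
    simp only [mem_ofPred_eq, sobolevSeq_smul] at *
    exact hf.const_smul c

/-- The Sobolev space `H^s(𝕋)`, with the norm `(L ∑ₙ (1 + n²)^s |f̂(n)|²)^{1/2}`. -/
def Hs (L : ℝ) [Fact (0 < L)] (s : ℝ) : Type := ↥(sobolevSubmodule L s)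

instance (L : ℝ) [Fact (0 < L)] (s : ℝ) : AddCommGroup (Hs L s) :=
  inferInstanceAs (AddCommGroup ↥(sobolevSubmodule L s))

instance (L : ℝ) [Fact (0 < L)] (s : ℝ) : Module ℂ (Hs L s) :=
  inferInstanceAs (Module ℂ ↥(sobolevSubmodule L s))

/-- The inclusion of `H^s(𝕋)` in `L²(𝕋)`. -/
def Hs.toL2 {L : ℝ} [Fact (0 < L)] {s : ℝ} : Hs L s →ₗ[ℂ] L2T L :=
  (sobolevSubmodule L s).subtype

/-- `f ↦ (√L (1 + n²)^{s/2} f̂(n))ₙ`, as a linear map from `H^s(𝕋)` to `ℓ²`. -/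
def Hs.toSeq {L : ℝ} [Fact (0 < L)] {s : ℝ} : Hs L s →ₗ[ℂ] lp (fun _ : ℤ => ℂ) 2 where
  toFun f := ⟨sobolevSeq L s f.toL2, f.2⟩
  map_add' f g := Subtype.ext (by simpa using! sobolevSeq_add s f.toL2 g.toL2)
  map_smul' c f := Subtype.ext (by simpa using! sobolevSeq_smul s c f.toL2)

theorem Hs.toSeq_injective {L : ℝ} [Fact (0 < L)] {s : ℝ} :
    Function.Injective (Hs.toSeq : Hs L s →ₗ[ℂ] lp (fun _ : ℤ => ℂ) 2) := by
  rw [← LinearMap.ker_eq_bot, LinearMap.ker_eq_bot']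
  intro f hf
  apply Subtype.ext
  apply eq_zero_of_coeffL
  intro n
  have h : sobolevSeq L s f.toL2 n = 0 := congrArg (fun g : lp (fun _ : ℤ => ℂ) 2 => g n) hf
  have hL : 0 < L := Fact.out
  have hw : Real.sqrt L * (1 + (n : ℝ) ^ 2) ^ (s / 2) ≠ 0 := by positivity
  rw [coeffL_apply]
  exact (mul_eq_zero.mp h).resolve_left (by exact_mod_cast hw)

instance (L : ℝ) [Fact (0 < L)] (s : ℝ) : NormedAddCommGroup (Hs L s) :=
  NormedAddCommGroup.induced (Hs L s) (lp (fun _ : ℤ => ℂ) 2) Hs.toSeq Hs.toSeq_injective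

instance (L : ℝ) [Fact (0 < L)] (s : ℝ) : NormedSpace ℂ (Hs L s) :=
  NormedSpace.induced ℂ (Hs L s) (lp (fun _ : ℤ => ℂ) 2) Hs.toSeq

theorem Hs.norm_sq {L : ℝ} [Fact (0 < L)] {s : ℝ} (f : Hs L s) :
    ‖f‖ ^ 2 = L * ∑' n : ℤ, (1 + (n : ℝ) ^ 2) ^ s * ‖fourierCoeff f.toL2 n‖ ^ 2 := by
  have hL : 0 < L := Fact.out
  have h := lp.norm_rpow_eq_tsum (p := 2) (by norm_num) (Hs.toSeq f)
  have h2 : ‖f‖ = ‖Hs.toSeq f‖ := rfl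
  norm_num at h
  rw [h2, h, ← tsum_mul_left]
  congr 1
  funext n
  have h3 : (Hs.toSeq f) n = sobolevSeq L s f.toL2 n := rfl
  have h4 : (0 : ℝ) ≤ 1 + (n : ℝ) ^ 2 := by positivity
  rw [h3, sobolevSeq, norm_mul, Complex.norm_real, mul_pow, Real.norm_eq_abs, sq_abs, mul_pow,
    Real.sq_sqrt hL.le, ← Real.rpow_natCast, ← Real.rpow_mul h4]
  norm_num
  ring

/-- Real-valued functions in `H^s(𝕋)`, a real normed space. -/
def HsReal (L : ℝ) [Fact (0 < L)] (s : ℝ) : Submodule ℝ (Hs L s) where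
  carrier := {f | IsRealValued f.toL2}
  zero_mem' := by
    simpa using isRealValued_zero
  add_mem' {f g} hf hg := by
    simp only [mem_ofPred_eq, map_add] at *
    exact hf.add hg
  smul_mem' c f hf := by
    simp only [mem_ofPred_eq, LinearMap.map_smul_of_tower] at *
    exact hf.smul c

/-! ### Bourgain spaces

A function `u(t, x)` on `ℝ × 𝕋` is viewed as `t ↦ u(t, ·)`, an element of `L²(ℝ; L²(𝕋))`. The
spaces with `s, b ≥ 0`, the only ones used, are contained in it. -/

/-- `L²(ℝ; L²(𝕋)) = L²(ℝ × 𝕋)`. -/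
abbrev L2RT (L : ℝ) [Fact (0 < L)] : Type := Lp (L2T L) 2 (volume : Measure ℝ)

/-- The space-time Fourier transform: the Fourier transform in `L²(ℝ)` of the `n`-th Fourier
coefficient `t ↦ û(t, n)`. Here `𝓕 f (ξ) = ∫ f(t) exp (-2πi t ξ) dt`, so that
`û(τ, n) = (2π)^{-1/2} 𝓕 (û(·, n)) (τ / 2π)` in the normalization with `exp (-i t τ)`. -/
def spaceTimeFourier {L : ℝ} [Fact (0 < L)] (u : L2RT L) (n : ℤ) : Lp ℂ 2 (volume : Measure ℝ) :=
  𝓕 ((coeffL L n).compLp u)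

/-- `⟨τ + φ(n)⟩^b ⟨n⟩^s` times the space-time Fourier transform at `(τ, n)`, with `τ = 2πξ`. As
`dτ = 2π dξ`, its norm in `L²(ℤ × ℝ, dn dξ)` is
`(∑ₙ ∫ ⟨τ + φ(n)⟩^{2b} ⟨n⟩^{2s} |û(τ, n)|² dτ)^{1/2}`. -/
def bourgainFun {L : ℝ} [Fact (0 < L)] (φ : ℤ → ℝ) (s b : ℝ) (u : L2RT L) (p : ℤ × ℝ) : ℂ :=
  ((bracket (2 * Real.pi * p.2 + φ p.1) ^ b * bracket (p.1 : ℝ) ^ s : ℝ) : ℂ) *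
    spaceTimeFourier u p.1 p.2

/-- Counting measure times Lebesgue measure on `ℤ × ℝ`. -/
abbrev freqMeasure : Measure (ℤ × ℝ) := (Measure.count : Measure ℤ).prod (volume : Measure ℝ)

theorem spaceTimeFourier_add {L : ℝ} [Fact (0 < L)] (u v : L2RT L) (n : ℤ) :
    spaceTimeFourier (u + v) n = spaceTimeFourier u n + spaceTimeFourier v n := by
  have h := ((coeffL L n).compLpₗ 2 (volume : Measure ℝ)).map_add u v
  simp only [ContinuousLinearMap.compLpₗ_apply] at h
  rw [spaceTimeFourier, h, FourierTransform.fourier_add]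
  rfl

theorem spaceTimeFourier_smul {L : ℝ} [Fact (0 < L)] (c : ℂ) (u : L2RT L) (n : ℤ) :
    spaceTimeFourier (c • u) n = c • spaceTimeFourier u n := by
  have h := ((coeffL L n).compLpₗ 2 (volume : Measure ℝ)).map_smul c u
  simp only [ContinuousLinearMap.compLpₗ_apply] at h
  rw [spaceTimeFourier, h, FourierTransform.fourier_smul]
  rfl

theorem measurable_spaceTimeFourier {L : ℝ} [Fact (0 < L)] (u : L2RT L) :
    Measurable fun p : ℤ × ℝ => spaceTimeFourier u p.1 p.2 :=
  measurable_from_prod_countable_right fun n =>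
    (Lp.stronglyMeasurable (spaceTimeFourier u n)).measurable

theorem bourgainFun_add {L : ℝ} [Fact (0 < L)] (φ : ℤ → ℝ) (s b : ℝ) (u v : L2RT L) :
    bourgainFun φ s b (u + v) =ᵐ[freqMeasure] bourgainFun φ s b u + bourgainFun φ s b v := by
  have h : ∀ᵐ p ∂freqMeasure, spaceTimeFourier (u + v) p.1 p.2 =
      spaceTimeFourier u p.1 p.2 + spaceTimeFourier v p.1 p.2 := by
    refine (Measure.ae_prod_iff_ae_ae (measurableSet_eq_fun (measurable_spaceTimeFourier _)
      ((measurable_spaceTimeFourier u).add (measurable_spaceTimeFourier v)))).mpr ?_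
    refine Filter.Eventually.of_forall fun n => ?_
    simp only [spaceTimeFourier_add]
    exact Lp.coeFn_add _ _
  filter_upwards [h] with p hp
  simp only [bourgainFun, Pi.add_apply, hp, mul_add]

theorem bourgainFun_smul {L : ℝ} [Fact (0 < L)] (φ : ℤ → ℝ) (s b : ℝ) (c : ℂ) (u : L2RT L) :
    bourgainFun φ s b (c • u) =ᵐ[freqMeasure] c • bourgainFun φ s b u := by
  have h : ∀ᵐ p ∂freqMeasure, spaceTimeFourier (c • u) p.1 p.2 =
      c * spaceTimeFourier u p.1 p.2 := by
    rw [Measure.ae_prod_iff_ae_ae (measurableSet_eq_fun (measurable_spaceTimeFourier _)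
      ((measurable_spaceTimeFourier u).const_mul c))]
    refine Filter.Eventually.of_forall fun n => ?_
    simp only [spaceTimeFourier_smul]
    exact Lp.coeFn_smul _ _
  filter_upwards [h] with p hp
  simp only [bourgainFun, Pi.smul_apply, hp, smul_eq_mul]
  ring

theorem spaceTimeFourier_zero {L : ℝ} [Fact (0 < L)] (n : ℤ) :
    spaceTimeFourier (0 : L2RT L) n = 0 := by
  simpa using spaceTimeFourier_smul 0 (0 : L2RT L) n

theorem bourgainFun_zero {L : ℝ} [Fact (0 < L)] (φ : ℤ → ℝ) (s b : ℝ) :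
    bourgainFun φ s b (0 : L2RT L) =ᵐ[freqMeasure] 0 := by
  simpa using bourgainFun_smul φ s b 0 (0 : L2RT L)

/-- The `u` in `L²(ℝ × 𝕋)` with `∑ₙ ∫ ⟨τ + φ(n)⟩^{2b} ⟨n⟩^{2s} |û(τ, n)|² dτ < ∞`. -/
def bourgainSubmodule (L : ℝ) [Fact (0 < L)] (φ : ℤ → ℝ) (s b : ℝ) : Submodule ℂ (L2RT L) where
  carrier := {u | MemLp (bourgainFun φ s b u) 2 freqMeasure}
  zero_mem' := (memLp_congr_ae (bourgainFun_zero φ s b)).mpr MemLp.zero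
  add_mem' {u v} hu hv := (memLp_congr_ae (bourgainFun_add φ s b u v)).mpr (hu.add hv)
  smul_mem' c u hu := (memLp_congr_ae (bourgainFun_smul φ s b c u)).mpr (hu.const_smul c)

/-- The Bourgain space attached to the dispersion relation `τ = -φ(n)`, with the norm
`(∑ₙ ∫ ⟨τ + φ(n)⟩^{2b} ⟨n⟩^{2s} |û(τ, n)|² dτ)^{1/2}`. -/
def Bourgain (L : ℝ) [Fact (0 < L)] (φ : ℤ → ℝ) (s b : ℝ) : Type := ↥(bourgainSubmodule L φ s b)

instance (L : ℝ) [Fact (0 < L)] (φ : ℤ → ℝ) (s b : ℝ) : AddCommGroup (Bourgain L φ s b) :=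
  inferInstanceAs (AddCommGroup ↥(bourgainSubmodule L φ s b))

instance (L : ℝ) [Fact (0 < L)] (φ : ℤ → ℝ) (s b : ℝ) : Module ℂ (Bourgain L φ s b) :=
  inferInstanceAs (Module ℂ ↥(bourgainSubmodule L φ s b))

/-- The inclusion of the Bourgain space in `L²(ℝ; L²(𝕋))`. -/
def Bourgain.toL2 {L : ℝ} [Fact (0 < L)] {φ : ℤ → ℝ} {s b : ℝ} :
    Bourgain L φ s b →ₗ[ℂ] L2RT L :=
  (bourgainSubmodule L φ s b).subtype

theorem Bourgain.memLp {L : ℝ} [Fact (0 < L)] {φ : ℤ → ℝ} {s b : ℝ} (u : Bourgain L φ s b) :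
    MemLp (bourgainFun φ s b u.toL2) 2 freqMeasure := u.2

/-- `u ↦ ⟨τ + φ(n)⟩^b ⟨n⟩^s û(τ, n)`, as a linear map to `L²(ℤ × ℝ)`. -/
def Bourgain.toFreq {L : ℝ} [Fact (0 < L)] {φ : ℤ → ℝ} {s b : ℝ} :
    Bourgain L φ s b →ₗ[ℂ] Lp ℂ 2 freqMeasure where
  toFun u := u.memLp.toLp _
  map_add' u v := by
    rw [← MemLp.toLp_add]
    exact MemLp.toLp_congr _ _ (by simpa using bourgainFun_add φ s b u.toL2 v.toL2)
  map_smul' c u := by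
    rw [RingHom.id_apply, ← MemLp.toLp_const_smul]
    exact MemLp.toLp_congr _ _ (by simpa using bourgainFun_smul φ s b c u.toL2)

theorem Bourgain.toFreq_injective {L : ℝ} [Fact (0 < L)] {φ : ℤ → ℝ} {s b : ℝ} :
    Function.Injective (Bourgain.toFreq : Bourgain L φ s b →ₗ[ℂ] Lp ℂ 2 freqMeasure) := by
  rw [← LinearMap.ker_eq_bot, LinearMap.ker_eq_bot']
  intro u hu
  have h0 : bourgainFun φ s b u.toL2 =ᵐ[freqMeasure] 0 := by
    have h1 : u.memLp.toLp _ = 0 := hu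
    exact (MemLp.coeFn_toLp u.memLp).symm.trans (by rw [h1]; exact Lp.coeFn_zero _ _ _)
  have h2 : ∀ᵐ p ∂freqMeasure, spaceTimeFourier u.toL2 p.1 p.2 = 0 := by
    filter_upwards [h0] with p hp
    have hw : bracket (2 * Real.pi * p.2 + φ p.1) ^ b * bracket (p.1 : ℝ) ^ s ≠ 0 := by
      unfold bracket
      positivity
    exact (mul_eq_zero.mp hp).resolve_left (by exact_mod_cast hw)
  rw [Measure.ae_prod_iff_ae_ae (measurableSet_eq_fun (measurable_spaceTimeFourier _)
    measurable_const), Measure.ae_count_iff] at h2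
  have h3 : ∀ n, (coeffL L n).compLp u.toL2 = 0 := by
    intro n
    have h4 : spaceTimeFourier u.toL2 n = 0 := by
      ext1
      filter_upwards [h2 n, Lp.coeFn_zero ℂ 2 (volume : Measure ℝ)] with ξ h5 h6
      rw [h6]
      exact h5
    exact (Lp.fourierTransformₗᵢ ℝ ℂ).map_eq_zero_iff.mp h4
  apply Subtype.ext
  change u.toL2 = 0
  ext1
  have h5 : ∀ n, ∀ᵐ t, coeffL L n (u.toL2 t) = 0 := by
    intro n
    have h6 := (coeffL L n).coeFn_compLp u.toL2
    rw [h3 n] at h6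
    filter_upwards [h6, Lp.coeFn_zero ℂ 2 (volume : Measure ℝ)] with t h7 h8
    rw [← h7, h8]
    rfl
  filter_upwards [ae_all_iff.mpr h5, Lp.coeFn_zero (L2T L) 2 (volume : Measure ℝ)] with t h6 h7
  rw [h7]
  exact eq_zero_of_coeffL h6

instance (L : ℝ) [Fact (0 < L)] (φ : ℤ → ℝ) (s b : ℝ) : NormedAddCommGroup (Bourgain L φ s b) :=
  NormedAddCommGroup.induced (Bourgain L φ s b) (Lp ℂ 2 freqMeasure) Bourgain.toFreq
    Bourgain.toFreq_injective

instance (L : ℝ) [Fact (0 < L)] (φ : ℤ → ℝ) (s b : ℝ) : NormedSpace ℂ (Bourgain L φ s b) :=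
  NormedSpace.induced ℂ (Bourgain L φ s b) (Lp ℂ 2 freqMeasure) Bourgain.toFreq

theorem Bourgain.norm_eq {L : ℝ} [Fact (0 < L)] {φ : ℤ → ℝ} {s b : ℝ} (u : Bourgain L φ s b) :
    ‖u‖ = (eLpNorm (bourgainFun φ s b u.toL2) 2 freqMeasure).toReal :=
  Lp.norm_toLp _ u.memLp

/-- `X^{s,b}_per`, with modulation weight `⟨τ + k²⟩`. -/
abbrev XPer (L : ℝ) [Fact (0 < L)] (s b : ℝ) : Type :=
  Bourgain L (fun n => waveNumber L n ^ 2) s b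

/-- The real-valued functions in `Y^{s,b}_{γ,per}`, with modulation weight `⟨τ + γ|k|k⟩`. -/
def YPer (L : ℝ) [Fact (0 < L)] (γ s b : ℝ) :
    Submodule ℝ (Bourgain L (fun n => γ * |waveNumber L n| * waveNumber L n) s b) where
  carrier := {v | ∀ᵐ t, IsRealValued (v.toL2 t)}
  zero_mem' := by
    simp only [mem_ofPred_eq, map_zero]
    filter_upwards [Lp.coeFn_zero (L2T L) 2 (volume : Measure ℝ)] with t ht
    rw [ht]
    exact isRealValued_zero
  add_mem' {u v} hu hv := by
    simp only [mem_ofPred_eq, map_add] at *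
    filter_upwards [hu, hv, Lp.coeFn_add u.toL2 v.toL2] with t h1 h2 h3
    rw [h3]
    exact h1.add h2
  smul_mem' c u hu := by
    simp only [mem_ofPred_eq, LinearMap.map_smul_of_tower] at *
    filter_upwards [hu, Lp.coeFn_smul c u.toL2] with t h1 h3
    rw [h3]
    exact h1.smul c

/-! ### The Cauchy problem -/

/-- `ψ` is smooth, supported in `[-2, 2]` and equal to `1` on `[-1, 1]`. -/
structure IsCutoff (ψ : ℝ → ℝ) : Prop where
  smooth : ContDiff ℝ ∞ ψ
  support : tsupport ψ ⊆ Icc (-2) 2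
  eq_one : ∀ x ∈ Icc (-1 : ℝ) 1, ψ x = 1

/-- `(u, v)` solves, on the time interval `[0, T]`,
`i u_t + u_xx = α v u`, `v_t + γ D v_x = β (|u|²)_x`, `u(0) = u₀`, `v(0) = v₀`,
with `v` real valued. Both components are continuous with values in `L²(𝕋)`, and at each time the
two equations hold between periodic distributions, that is, between all Fourier coefficients. -/
structure IsSolution {L : ℝ} [Fact (0 < L)] (α β γ T : ℝ) (u₀ v₀ : L2T L) (u v : ℝ → L2T L) :
    Prop where
  continuousOn_u : ContinuousOn u (Icc 0 T)
  continuousOn_v : ContinuousOn v (Icc 0 T)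
  real_v : ∀ t ∈ Icc 0 T, IsRealValued (v t)
  init_u : u 0 = u₀
  init_v : v 0 = v₀
  eq_u : ∀ t ∈ Icc 0 T, ∀ n : ℤ, ∃ d : ℂ,
    HasDerivWithinAt (fun t' => fourierCoeff (u t') n) d (Icc 0 T) t ∧
    Complex.I * d + (Complex.I * waveNumber L n) ^ 2 * fourierCoeff (u t) n =
      α * fourierCoeff (fun x => v t x * u t x) n
  eq_v : ∀ t ∈ Icc 0 T, ∀ n : ℤ, ∃ d : ℂ,
    HasDerivWithinAt (fun t' => fourierCoeff (v t') n) d (Icc 0 T) t ∧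
    d + γ * (|waveNumber L n| * (Complex.I * waveNumber L n) * fourierCoeff (v t) n) =
      β * (Complex.I * waveNumber L n * fourierCoeff (fun x => ((‖u t x‖ ^ 2 : ℝ) : ℂ)) n)

/-- The curve `w : [0, T] → L²(𝕋)` coincides on `[0, T]` with `ψ_T u`, where
`ψ_T(t) = ψ(t / T)`. -/
def Represents {L : ℝ} [Fact (0 < L)] (ψ : ℝ → ℝ) (T : ℝ) (w : ℝ → L2T L) (u : L2RT L) : Prop :=
  ∀ᵐ t ∂(volume.restrict (Icc 0 T)), w t = ψ (t / T) • u t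

end SBO

end

noncomputable section

namespace SBO

open scoped ENNReal NNReal

/-! ### Cauchy–Schwarz, duality and trilinear forms for `ℝ≥0∞`-valued functions -/

/-! The system is rewritten on the Fourier side as a pair of Duhamel integral equations, cut off in
time at scale T = 1/Λ, for functions of (n, ξ) with τ = 2πξ. Everything rests on two bilinear
estimates: vu maps Y^{s-1/2,b} × X^{s,b} to X^{s,-3/8}, and (u w̄)ₓ maps X^{s,b} × X^{s,b} to
Y^{s-1/2,-3/8} (`nsq_conv_le`, `nsq_dx_conv_cnj_le`).

By duality both are bounds for one trilinear form ∫∫ f₀(p - q) f₁(p) f₂(q). With n = n₁ - n₂ and κ =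
2π/L, the alternating sum of the three modulations is κ² n (γ|n| - (n₁ + n₂)). Since |γ| ≠ 1, there
are two cases (`resonance_dichotomy`). Either this quantity is at least a multiple of n², and the
fourth root of a modulation pays for the half derivative ⟨n⟩^{1/2}; or n₁ and n₂ are both comparable
to n, and s ≥ 1/2 pays for it (`weight_bounds`). What is left after one modulation weight has been
spent is an L² bound (`trilinear_estimate`). Cauchy–Schwarz reduces it to sums of ⟨Q(n)⟩^{-3/4} over
quadratic polynomials Q with leading coefficient 2κ² or κ²(1 ± γ). None of these vanishes, and
⟨Q(n)⟩^{-3/4} decays like |n|^{-3/2}, so the sums are uniformly bounded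
(`exists_tsum_quadratic_le`).

The dual exponent 3/8 is less than 1/2, which leaves room in the time localization. With the weight
(Λ + |σ|)^b in place of ⟨σ⟩^b, the localized Duhamel operator has norm O(Λ^{b-5/8})
(`exists_nsq_duhamel_le`) and the localized free evolution has norm O(Λ^{b-1/2})
(`exists_nsq_free_le`). The quadratic equation x = l(d) + Q(x, x) is therefore solvable for data of
size R as soon as R Λ^{2b-9/8} is small, which is possible for b < 9/16. The map x ↦ x - Q(x, x) is
inverted on a ball with a smooth inverse (`exists_contDiffOn_fixedPoint`). Bounded linear maps carry
the fixed point to the Bourgain spaces and to C([0,T]; H^s), so the solution maps are smooth.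

For uniqueness, the difference of two solutions satisfies a linear localized equation with zero
data. Iterating it on a short interval does not change the values there, while the norm tends to
zero (`exists_local_uniqueness`). The length of the interval depends only on the norms, which are
invariant under time translation, so finitely many steps cover [0,T] (`IsMild.hat_unique`). -/

/-- The Cauchy–Schwarz inequality for lower integrals. -/
theorem sq_lintegral_mul_le {α : Type*} [MeasurableSpace α] (μ : Measure α) {f g : α → ℝ≥0∞}
    (hf : AEMeasurable f μ) (hg : AEMeasurable g μ) :
    (∫⁻ a, f a * g a ∂μ) ^ 2 ≤ (∫⁻ a, f a ^ 2 ∂μ) * ∫⁻ a, g a ^ 2 ∂μ := by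
  have h := ENNReal.lintegral_mul_le_Lp_mul_Lq μ Real.HolderConjugate.two_two hf hg
  simp only [Pi.mul_apply, ENNReal.rpow_two] at h
  calc (∫⁻ a, f a * g a ∂μ) ^ 2
      ≤ ((∫⁻ a, f a ^ 2 ∂μ) ^ (1 / 2 : ℝ) * (∫⁻ a, g a ^ 2 ∂μ) ^ (1 / 2 : ℝ)) ^ 2 := by gcongr
    _ = _ := by
        rw [mul_pow, ← ENNReal.rpow_two, ← ENNReal.rpow_two, ← ENNReal.rpow_mul,
          ← ENNReal.rpow_mul]
        norm_num

/-- A measurable function that pairs boundedly with `L²` is in `L²`. -/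
theorem lintegral_sq_le_of_forall_pairing {α : Type*} [MeasurableSpace α] (μ : Measure α)
    [SigmaFinite μ] {A : α → ℝ≥0∞} (hA : Measurable A) (M : ℝ≥0∞)
    (h : ∀ f : α → ℝ≥0∞, Measurable f → (∫⁻ a, f a * A a ∂μ) ^ 2 ≤ M * ∫⁻ a, f a ^ 2 ∂μ) :
    ∫⁻ a, A a ^ 2 ∂μ ≤ M := by
  -- Testing against A itself would give (∫ A²)² ≤ M ∫ A², but dividing requires ∫ A² to be finite.
  -- The truncations in height and in support have finite L² norm and increase to A.
  set B : ℕ → α → ℝ≥0∞ := fun N => (spanningSets μ N).indicator fun a => min (A a) N with hB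
  have hBm : ∀ N, Measurable (B N) := fun N =>
    (hA.min measurable_const).indicator (measurableSet_spanningSets μ N)
  have hBA : ∀ N a, B N a ≤ A a := fun N a =>
    (indicator_le_self _ _ a).trans (min_le_left _ _)
  have hfin : ∀ N, ∫⁻ a, B N a ^ 2 ∂μ ≠ ⊤ := by
    intro N
    have h1 : ∀ a, B N a ^ 2 ≤ (spanningSets μ N).indicator (fun _ => (N : ℝ≥0∞) ^ 2) a := by
      intro a
      by_cases ha : a ∈ spanningSets μ N
      · simp only [hB, indicator_of_mem ha]
        gcongr
        exact min_le_right _ _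
      · simp [hB, indicator_of_notMem ha]
    refine ((lintegral_mono h1).trans_lt ?_).ne
    rw [lintegral_indicator_const (measurableSet_spanningSets μ N)]
    exact ENNReal.mul_lt_top (by simp) (measure_spanningSets_lt_top μ N)
  have hle : ∀ N, ∫⁻ a, B N a ^ 2 ∂μ ≤ M := by
    intro N
    by_cases h0 : ∫⁻ a, B N a ^ 2 ∂μ = 0
    · simp [h0]
    have h1 : (∫⁻ a, B N a ^ 2 ∂μ) ^ 2 ≤ M * ∫⁻ a, B N a ^ 2 ∂μ := by
      refine le_trans ?_ (h (B N) (hBm N))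
      gcongr with a
      rw [sq]
      gcongr
      exact hBA N a
    rw [sq] at h1
    exact (ENNReal.mul_le_mul_iff_left h0 (hfin N)).mp h1
  have hmono : ∀ a, Monotone fun N => B N a ^ 2 := by
    intro a N N' hNN
    have h1 : B N a ≤ B N' a := by
      by_cases ha : a ∈ spanningSets μ N
      · have ha' := monotone_spanningSets μ hNN ha
        simp only [hB, indicator_of_mem ha, indicator_of_mem ha']
        gcongr
      · simp [hB, indicator_of_notMem ha]
    exact pow_le_pow_left' h1 2
  have hsup : ∀ a, ⨆ N, B N a ^ 2 = A a ^ 2 := by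
    intro a
    refine le_antisymm (iSup_le fun N => pow_le_pow_left' (hBA N a) 2) ?_
    obtain ⟨N₀, hN₀⟩ := mem_iUnion.mp ((iUnion_spanningSets μ).symm ▸ mem_univ a :
      a ∈ ⋃ i, spanningSets μ i)
    have ht : Filter.Tendsto (fun N : ℕ => min (A a) (N : ℝ≥0∞) ^ 2) Filter.atTop
        (nhds (min (A a) ⊤ ^ 2)) :=
      ENNReal.Tendsto.pow ((tendsto_const_nhds).min ENNReal.tendsto_nat_nhds_top)
    rw [min_eq_left le_top] at ht
    refine le_of_tendsto ht ?_
    filter_upwards [Filter.eventually_ge_atTop N₀] with N hN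
    refine le_trans (le_of_eq ?_) (le_iSup (fun N => B N a ^ 2) N)
    simp only [hB, indicator_of_mem (monotone_spanningSets μ hN hN₀)]
  simp_rw [← hsup]
  rw [lintegral_iSup (fun N => (hBm N).pow_const 2) (fun N N' hNN a => hmono a hNN)]
  exact iSup_le hle

theorem mul_le_sq_add_sq (x y : ℝ≥0∞) : x * y ≤ x ^ 2 + y ^ 2 := by
  rcases le_total x y with h | h
  · calc x * y ≤ y * y := by gcongr
      _ = y ^ 2 := (sq y).symm
      _ ≤ _ := le_add_self
  · calc x * y ≤ x * x := by gcongr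
      _ = x ^ 2 := (sq x).symm
      _ ≤ _ := le_self_add

theorem add_add_sq_le {x y z X : ℝ≥0∞} (hx : x ^ 2 ≤ X) (hy : y ^ 2 ≤ X) (hz : z ^ 2 ≤ X) :
    (x + y + z) ^ 2 ≤ 9 * X := by
  obtain ⟨m, hm, hxm, hym, hzm⟩ : ∃ m : ℝ≥0∞, m ^ 2 ≤ X ∧ x ≤ m ∧ y ≤ m ∧ z ≤ m := by
    refine ⟨max x (max y z), ?_, by simp, by simp, by simp⟩
    rcases max_choice x (max y z) with h | h
    · rwa [h]
    · rw [h]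
      rcases max_choice y z with h | h <;> rwa [h]
  calc (x + y + z) ^ 2 ≤ (m + m + m) ^ 2 := by gcongr
    _ = 9 * m ^ 2 := by ring
    _ ≤ _ := by gcongr

/-- Cauchy–Schwarz in x, then in y for each fixed x: only the supremum over x of the L² norm of k(x,
·) enters, while g is measured in L² of both variables. -/
theorem sq_lintegral_lintegral_kernel_le {α β : Type*} [MeasurableSpace α] [MeasurableSpace β]
    (μ : Measure α) (ν : Measure β) [SFinite ν] {h : α → ℝ≥0∞} {k g : α → β → ℝ≥0∞}
    (hh : Measurable h) (hk : Measurable (Function.uncurry k))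
    (hg : Measurable (Function.uncurry g)) {M : ℝ≥0∞} (hM : ∀ x, ∫⁻ y, k x y ^ 2 ∂ν ≤ M) :
    (∫⁻ x, h x * ∫⁻ y, k x y * g x y ∂ν ∂μ) ^ 2 ≤
      M * ((∫⁻ x, h x ^ 2 ∂μ) * ∫⁻ x, ∫⁻ y, g x y ^ 2 ∂ν ∂μ) := by
  have hm : Measurable fun x => ∫⁻ y, k x y * g x y ∂ν := (hk.mul hg).lintegral_prod_right'
  refine (sq_lintegral_mul_le μ hh.aemeasurable hm.aemeasurable).trans ?_
  have hg2 : Measurable fun x => ∫⁻ y, g x y ^ 2 ∂ν := (hg.pow_const 2).lintegral_prod_right'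
  rw [mul_left_comm, ← lintegral_const_mul _ hg2]
  gcongr with x
  refine (sq_lintegral_mul_le ν (hk.of_uncurry_left).aemeasurable
    (hg.of_uncurry_left).aemeasurable).trans ?_
  gcongr
  exact hM x

/-! ### Trilinear forms on an abelian group with invariant measure -/

section Group

variable {G : Type*} [AddCommGroup G] [MeasurableSpace G] [MeasurableAdd₂ G] [MeasurableNeg G]
  [MeasurableSub₂ G] (μ : Measure G) [SFinite μ] [μ.IsAddLeftInvariant] [μ.IsNegInvariant]

theorem lintegral_lintegral_sub_mul {f g : G → ℝ≥0∞} (hf : Measurable f) (hg : Measurable g) :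
    ∫⁻ x, ∫⁻ y, f (x - y) * g y ∂μ ∂μ = (∫⁻ x, f x ∂μ) * ∫⁻ x, g x ∂μ := by
  rw [lintegral_lintegral_swap (by fun_prop)]
  have h : ∀ y, ∫⁻ x, f (x - y) * g y ∂μ = (∫⁻ x, f x ∂μ) * g y := by
    intro y
    rw [lintegral_mul_const _ (by fun_prop), lintegral_sub_right_eq_self]
  simp_rw [h]
  rw [lintegral_const_mul _ hg]

theorem lintegral_lintegral_mul_sub {f g : G → ℝ≥0∞} (hf : Measurable f) (hg : Measurable g) :
    ∫⁻ x, ∫⁻ y, f (y - x) * g y ∂μ ∂μ = (∫⁻ x, f x ∂μ) * ∫⁻ x, g x ∂μ := by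
  rw [lintegral_lintegral_swap (by fun_prop)]
  have h : ∀ y, ∫⁻ x, f (y - x) * g y ∂μ = (∫⁻ x, f x ∂μ) * g y := by
    intro y
    rw [lintegral_mul_const _ (by fun_prop), lintegral_sub_left_eq_self]
  simp_rw [h]
  rw [lintegral_const_mul _ hg]

/-- The substitution q = p - r brings the pairing with a correlation to the common shape of the
trilinear forms below. -/
theorem lintegral_mul_correlation {a f g : G → ℝ≥0∞} (ha : Measurable a) (hf : Measurable f)
    (hg : Measurable g) :
    ∫⁻ r, a r * ∫⁻ p, f (p - r) * g p ∂μ ∂μ = ∫⁻ p, ∫⁻ q, a (p - q) * (f q * g p) ∂μ ∂μ := by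
  have h : ∀ r, a r * ∫⁻ p, f (p - r) * g p ∂μ = ∫⁻ p, a r * (f (p - r) * g p) ∂μ := fun r =>
    (lintegral_const_mul _ (by fun_prop)).symm
  simp_rw [h]
  rw [lintegral_lintegral_swap (by fun_prop)]
  congr 1
  funext p
  rw [← lintegral_sub_left_eq_self _ p]
  simp only [sub_sub_cancel]

variable {f₀ f₁ f₂ x₀ x₁ x₂ : G → ℝ≥0∞}

/-- The trilinear form `∫∫ f₀(p - q) f₁(p) f₂(q)`, with weights on `f₀` and `f₂`. -/
theorem trilinear_le_of_weights_zero_two (hf₀ : Measurable f₀) (hf₁ : Measurable f₁)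
    (hf₂ : Measurable f₂) (hx₀ : Measurable x₀) (hx₂ : Measurable x₂) {M : ℝ≥0∞}
    (hM : ∀ p, ∫⁻ q, (x₀ (p - q) * x₂ q) ^ 2 ∂μ ≤ M) :
    (∫⁻ p, ∫⁻ q, x₀ (p - q) * x₂ q * (f₀ (p - q) * f₁ p * f₂ q) ∂μ ∂μ) ^ 2 ≤
      M * ((∫⁻ p, f₀ p ^ 2 ∂μ) * (∫⁻ p, f₁ p ^ 2 ∂μ) * ∫⁻ p, f₂ p ^ 2 ∂μ) := by
  have h := sq_lintegral_lintegral_kernel_le μ μ (h := f₁) (k := fun p q => x₀ (p - q) * x₂ q)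
    (g := fun p q => f₀ (p - q) * f₂ q) hf₁ (by unfold Function.uncurry; fun_prop)
    (by unfold Function.uncurry; fun_prop) hM
  have h2 : ∫⁻ p, ∫⁻ q, (f₀ (p - q) * f₂ q) ^ 2 ∂μ ∂μ =
      (∫⁻ p, f₀ p ^ 2 ∂μ) * ∫⁻ p, f₂ p ^ 2 ∂μ := by
    simp_rw [mul_pow]
    exact lintegral_lintegral_sub_mul μ (hf₀.pow_const 2) (hf₂.pow_const 2)
  rw [h2] at h
  calc _ = (∫⁻ p, f₁ p * ∫⁻ q, x₀ (p - q) * x₂ q * (f₀ (p - q) * f₂ q) ∂μ ∂μ) ^ 2 := by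
        congr 2
        funext p
        rw [← lintegral_const_mul _ (by fun_prop)]
        congr 1
        funext q
        ring
    _ ≤ _ := h
    _ = _ := by ring

/-- The trilinear form `∫∫ f₀(p - q) f₁(p) f₂(q)`, with weights on `f₀` and `f₁`. -/
theorem trilinear_le_of_weights_zero_one (hf₀ : Measurable f₀) (hf₁ : Measurable f₁)
    (hf₂ : Measurable f₂) (hx₀ : Measurable x₀) (hx₁ : Measurable x₁) {M : ℝ≥0∞}
    (hM : ∀ q, ∫⁻ p, (x₀ (p - q) * x₁ p) ^ 2 ∂μ ≤ M) :
    (∫⁻ p, ∫⁻ q, x₀ (p - q) * x₁ p * (f₀ (p - q) * f₁ p * f₂ q) ∂μ ∂μ) ^ 2 ≤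
      M * ((∫⁻ p, f₀ p ^ 2 ∂μ) * (∫⁻ p, f₁ p ^ 2 ∂μ) * ∫⁻ p, f₂ p ^ 2 ∂μ) := by
  have h := sq_lintegral_lintegral_kernel_le μ μ (h := f₂) (k := fun q p => x₀ (p - q) * x₁ p)
    (g := fun q p => f₀ (p - q) * f₁ p) hf₂ (by unfold Function.uncurry; fun_prop)
    (by unfold Function.uncurry; fun_prop) hM
  have h2 : ∫⁻ q, ∫⁻ p, (f₀ (p - q) * f₁ p) ^ 2 ∂μ ∂μ =
      (∫⁻ p, f₀ p ^ 2 ∂μ) * ∫⁻ p, f₁ p ^ 2 ∂μ := by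
    simp_rw [mul_pow]
    exact lintegral_lintegral_mul_sub μ (hf₀.pow_const 2) (hf₁.pow_const 2)
  rw [h2] at h
  calc _ = (∫⁻ q, f₂ q * ∫⁻ p, x₀ (p - q) * x₁ p * (f₀ (p - q) * f₁ p) ∂μ ∂μ) ^ 2 := by
        rw [lintegral_lintegral_swap (by fun_prop)]
        congr 2
        funext q
        rw [← lintegral_const_mul _ (by fun_prop)]
        congr 1
        funext q
        ring
    _ ≤ _ := h
    _ = _ := by ring

set_option maxHeartbeats 1000000 in
/-- An `L²` bound for a correlation through the weights of the corresponding convolution. -/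
theorem lintegral_sq_correlation_le (hf₁ : Measurable f₁)
    (hf₂ : Measurable f₂) (hx₁ : Measurable x₁) (hx₂ : Measurable x₂) {M : ℝ≥0∞}
    (hM : ∀ p, ∫⁻ q, (x₁ (p - q) * x₂ q) ^ 2 ∂μ ≤ M) :
    ∫⁻ r, (∫⁻ q, x₁ (q + r) * f₁ (q + r) * (x₂ q * f₂ q) ∂μ) ^ 2 ∂μ ≤
      2 * M * ((∫⁻ p, f₁ p ^ 2 ∂μ) * ∫⁻ p, f₂ p ^ 2 ∂μ) := by
  -- This is the L² identity between |u w̄| and |u w|. A direct bound would meet the difference of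
  -- two Schrödinger phases, which is only linear in the frequency. The square of the correlation is
  -- the double integral of X(r,q,q') X(r,q',q); here x₁(q + r) is grouped with x₂(q') so that a
  -- convolution weight appears. The inequality ab ≤ a² + b² and the symmetry in q, q' cost the
  -- factor 2.
  set X : G → G → G → ℝ≥0∞ := fun r q q' => x₁ (q + r) * x₂ q' * (f₁ (q' + r) * f₂ q) with hX
  have hXm : Measurable fun z : G × G × G => X z.1 z.2.1 z.2.2 ^ 2 := by
    simp only [hX]
    fun_prop
  have h1 : ∀ r, (∫⁻ q, x₁ (q + r) * f₁ (q + r) * (x₂ q * f₂ q) ∂μ) ^ 2 ≤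
      2 * ∫⁻ q, ∫⁻ q', X r q q' ^ 2 ∂μ ∂μ := by
    intro r
    have hr : Measurable fun z : G × G => X r z.1 z.2 ^ 2 :=
      hXm.comp (measurable_const.prodMk measurable_id)
    have h2 : (∫⁻ q, x₁ (q + r) * f₁ (q + r) * (x₂ q * f₂ q) ∂μ) ^ 2 =
        ∫⁻ q, ∫⁻ q', X r q q' * X r q' q ∂μ ∂μ := by
      rw [sq, ← lintegral_mul_const _ (by fun_prop)]
      congr 1
      funext q
      rw [← lintegral_const_mul _ (by fun_prop)]
      congr 1
      funext q'
      simp only [hX]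
      ring
    rw [h2, two_mul]
    nth_rw 3 [lintegral_lintegral_swap (by unfold Function.uncurry; exact hr.aemeasurable)]
    rw [← lintegral_add_left (by exact hr.lintegral_prod_right')]
    gcongr with q
    rw [← lintegral_add_left (by exact hr.comp (measurable_const.prodMk measurable_id))]
    gcongr with q'
    exact mul_le_sq_add_sq _ _
  refine (lintegral_mono h1).trans ?_
  have hXi : Measurable fun z : G × G => ∫⁻ q', X z.1 z.2 q' ^ 2 ∂μ :=
    Measurable.lintegral_prod_right' (f := fun z : (G × G) × G => X z.1.1 z.1.2 z.2 ^ 2)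
      (hXm.comp (by fun_prop : Measurable fun z : (G × G) × G => (z.1.1, z.1.2, z.2)))
  rw [lintegral_const_mul _ hXi.lintegral_prod_right', mul_assoc]
  gcongr
  rw [lintegral_lintegral_swap (by exact hXi.aemeasurable)]
  -- Replacing r by r - q' turns x₁(q + r) x₂(q') into x₁((q + r) - q') x₂(q'), to which the
  -- hypothesis applies at the point q + r.
  have h3 : ∀ q, ∫⁻ r, ∫⁻ q', X r q q' ^ 2 ∂μ ∂μ ≤ M * (∫⁻ p, f₁ p ^ 2 ∂μ) * f₂ q ^ 2 := by
    intro q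
    have hq : Measurable fun z : G × G => X z.1 q z.2 ^ 2 :=
      hXm.comp (by fun_prop : Measurable fun z : G × G => (z.1, q, z.2))
    rw [lintegral_lintegral_swap (by exact hq.aemeasurable)]
    have h4 : ∀ q', ∫⁻ r, X r q q' ^ 2 ∂μ = ∫⁻ r, X (r - q') q q' ^ 2 ∂μ := fun q' =>
      (lintegral_sub_right_eq_self (fun r => X r q q' ^ 2) q').symm
    simp_rw [h4]
    rw [lintegral_lintegral_swap (by unfold Function.uncurry; exact (hq.comp (by fun_prop :
      Measurable fun z : G × G => (z.2 - z.1, z.1))).aemeasurable),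
      ← lintegral_const_mul _ (by fun_prop), ← lintegral_mul_const _ (by fun_prop)]
    gcongr with r
    calc ∫⁻ q', X (r - q') q q' ^ 2 ∂μ
        = ∫⁻ q', (x₁ (q + r - q') * x₂ q') ^ 2 * (f₁ r ^ 2 * f₂ q ^ 2) ∂μ := by
          congr 1
          funext q'
          simp only [hX]
          rw [show q' + (r - q') = r by abel, show q + (r - q') = q + r - q' by abel]
          ring
      _ = (∫⁻ q', (x₁ (q + r - q') * x₂ q') ^ 2 ∂μ) * (f₁ r ^ 2 * f₂ q ^ 2) :=
          lintegral_mul_const _ (by fun_prop)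
      _ ≤ M * (f₁ r ^ 2 * f₂ q ^ 2) := by gcongr; exact hM _
      _ = _ := by ring
  refine (lintegral_mono h3).trans (le_of_eq ?_)
  rw [lintegral_const_mul _ (by fun_prop), mul_assoc]

/-- The trilinear form `∫∫ f₀(p - q) f₁(p) f₂(q)`, with weights on `f₁` and `f₂`. -/
theorem trilinear_le_of_weights_one_two (hf₀ : Measurable f₀) (hf₁ : Measurable f₁)
    (hf₂ : Measurable f₂) (hx₁ : Measurable x₁) (hx₂ : Measurable x₂) {M : ℝ≥0∞}
    (hM : ∀ p, ∫⁻ q, (x₁ (p - q) * x₂ q) ^ 2 ∂μ ≤ M) :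
    (∫⁻ p, ∫⁻ q, x₁ p * x₂ q * (f₀ (p - q) * f₁ p * f₂ q) ∂μ ∂μ) ^ 2 ≤
      2 * M * ((∫⁻ p, f₀ p ^ 2 ∂μ) * (∫⁻ p, f₁ p ^ 2 ∂μ) * ∫⁻ p, f₂ p ^ 2 ∂μ) := by
  have h1 : ∫⁻ p, ∫⁻ q, x₁ p * x₂ q * (f₀ (p - q) * f₁ p * f₂ q) ∂μ ∂μ =
      ∫⁻ r, f₀ r * ∫⁻ q, x₁ (q + r) * f₁ (q + r) * (x₂ q * f₂ q) ∂μ ∂μ := by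
    rw [lintegral_lintegral_swap (by fun_prop)]
    have h2 : ∀ q, ∫⁻ p, x₁ p * x₂ q * (f₀ (p - q) * f₁ p * f₂ q) ∂μ =
        ∫⁻ r, f₀ r * (x₁ (q + r) * f₁ (q + r) * (x₂ q * f₂ q)) ∂μ := by
      intro q
      rw [← lintegral_add_left_eq_self _ q]
      congr 1
      funext r
      rw [add_sub_cancel_left]
      ring
    simp_rw [h2]
    rw [lintegral_lintegral_swap (by fun_prop)]
    congr 1
    funext r
    rw [lintegral_const_mul _ (by fun_prop)]
  rw [h1]
  have hm : Measurable fun r => ∫⁻ q, x₁ (q + r) * f₁ (q + r) * (x₂ q * f₂ q) ∂μ :=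
    Measurable.lintegral_prod_right'
      (f := fun z : G × G => x₁ (z.2 + z.1) * f₁ (z.2 + z.1) * (x₂ z.2 * f₂ z.2)) (by fun_prop)
  refine (sq_lintegral_mul_le μ hf₀.aemeasurable hm.aemeasurable).trans ?_
  calc _ ≤ (∫⁻ p, f₀ p ^ 2 ∂μ) * (2 * M * ((∫⁻ p, f₁ p ^ 2 ∂μ) * ∫⁻ p, f₂ p ^ 2 ∂μ)) := by
        gcongr
        exact lintegral_sq_correlation_le μ hf₁ hf₂ hx₁ hx₂ hM
    _ = _ := by ring

end Group

/-! ### Brackets and sums over quadratic sequences -/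

theorem one_le_bracket (x : ℝ) : 1 ≤ bracket x := by
  unfold bracket
  linarith [abs_nonneg x]

theorem bracket_pos (x : ℝ) : 0 < bracket x := one_pos.trans_le (one_le_bracket x)

theorem bracket_neg (x : ℝ) : bracket (-x) = bracket x := by
  simp [bracket]

theorem bracket_add_le (x y : ℝ) : bracket (x + y) ≤ bracket x * bracket y := by
  unfold bracket
  nlinarith [abs_add_le x y, mul_nonneg (abs_nonneg x) (abs_nonneg y)]

theorem measurable_bracket : Measurable bracket := by
  unfold bracket
  fun_prop

/-- Completing the square gives c((m - μ₀)² + D). If D ≥ 0, the vertex serves as both points. If D <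
0, they are the two real roots, and each factor of m is at least the smaller distance. -/
theorem exists_quadratic_lower_bound (c d θ : ℝ) (hc : c ≠ 0) :
    ∃ x₁ x₂ : ℝ, ∀ m : ℝ, |c| * min |m - x₁| |m - x₂| ^ 2 ≤ |θ + c * m ^ 2 + d * m| := by
  set μ₀ := -d / (2 * c) with hμ
  set D := θ / c - μ₀ ^ 2 with hD
  have hQ : ∀ m : ℝ, θ + c * m ^ 2 + d * m = c * ((m - μ₀) ^ 2 + D) := by
    intro m
    rw [hD, hμ]
    field_simp
    ring
  rcases le_or_gt 0 D with h | h
  · refine ⟨μ₀, μ₀, fun m => ?_⟩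
    rw [hQ, abs_mul, min_self, sq_abs]
    gcongr
    rw [abs_of_nonneg (by positivity)]
    linarith
  · refine ⟨μ₀ + √(-D), μ₀ - √(-D), fun m => ?_⟩
    have h1 : (m - μ₀) ^ 2 + D = (m - (μ₀ + √(-D))) * (m - (μ₀ - √(-D))) := by
      have := Real.sq_sqrt (by linarith : 0 ≤ -D)
      nlinarith
    rw [hQ, abs_mul, h1, abs_mul, sq]
    gcongr
    · exact min_le_left _ _
    · exact min_le_right _ _

/-- Reindexing by the integer part of x reduces to a shift in [0, 1), where 1 + |m - x| is at least
half of |m + 1/2|. The half-integer keeps the comparison series free of a vanishing denominator. -/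
theorem exists_tsum_shift_le :
    ∃ C : ℝ≥0∞, C ≠ ⊤ ∧ ∀ x : ℝ, ∑' m : ℤ, ENNReal.ofReal ((1 + |(m : ℝ) - x|) ^ (-(3 / 2) : ℝ)) ≤ C := by
  have hs : Summable fun m : ℤ => (1 / 2 : ℝ) ^ (-(3 / 2) : ℝ) * (1 / |(m : ℝ) + 1 / 2| ^ (3 / 2 : ℝ)) :=
    ((Real.summable_one_div_int_add_rpow (1 / 2) (3 / 2)).mpr (by norm_num)).mul_left _
  refine ⟨∑' m : ℤ, ENNReal.ofReal ((1 / 2 : ℝ) ^ (-(3 / 2) : ℝ) * (1 / |(m : ℝ) + 1 / 2| ^ (3 / 2 : ℝ))),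
    hs.tsum_ofReal_ne_top, fun x => ?_⟩
  rw [← (Equiv.addRight ⌊x⌋).tsum_eq]
  refine ENNReal.tsum_le_tsum fun m => ENNReal.ofReal_le_ofReal ?_
  have h0 : (0 : ℝ) < |(m : ℝ) + 1 / 2| := by
    rw [abs_pos]
    intro h
    have h2 : (2 * m + 1 : ℤ) = 0 := by
      have : (2 * (m : ℝ) + 1) = 0 := by linarith
      exact_mod_cast this
    omega
  rw [one_div (_ ^ _), ← Real.rpow_neg h0.le, ← Real.mul_rpow (by norm_num) h0.le]
  refine Real.rpow_le_rpow_of_nonpos (by positivity) ?_ (by norm_num)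
  have h1 := Int.floor_le x
  have h2 := Int.lt_floor_add_one x
  simp only [Equiv.coe_addRight, Int.cast_add]
  have h3 : |(m : ℝ)| ≤ |(m : ℝ) + ⌊x⌋ - x| + 1 := by
    rw [show (m : ℝ) = (m + ⌊x⌋ - x) + (x - ⌊x⌋) by ring]
    refine (abs_add_le _ _).trans ?_
    have : |x - ⌊x⌋| ≤ 1 := by rw [abs_le]; constructor <;> linarith
    ring_nf at this ⊢
    linarith
  have h4 : |(m : ℝ) + 1 / 2| ≤ |(m : ℝ)| + 1 / 2 := by
    refine (abs_add_le _ _).trans ?_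
    norm_num
  have h5 := abs_nonneg ((m : ℝ) + ⌊x⌋ - x)
  linarith

/-- Sums of `⟨Q(m)⟩^{-3/4}` over the integers are bounded uniformly over the quadratic polynomials
`Q` whose leading coefficient is bounded away from zero. -/
theorem exists_tsum_quadratic_le {c₀ : ℝ} (hc₀ : 0 < c₀) :
    ∃ C : ℝ≥0∞, C ≠ ⊤ ∧ ∀ c d θ : ℝ, c₀ ≤ |c| →
      ∑' m : ℤ, ENNReal.ofReal (bracket (θ + c * (m : ℝ) ^ 2 + d * m) ^ (-(3 / 4) : ℝ)) ≤ C := by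
  obtain ⟨C, hC, h⟩ := exists_tsum_shift_le
  -- Chosen so that 1 + |c| r² ≥ c₁ (1 + r)², by (1 + r)² ≤ 2(1 + r²). The power -3/4 of the
  -- quadratic then becomes the summable power -3/2 of the distance to a root.
  set c₁ := min 1 c₀ / 2 with hc₁
  have hc₁p : 0 < c₁ := by positivity
  refine ⟨ENNReal.ofReal (c₁ ^ (-(3 / 4) : ℝ)) * (C + C),
    ENNReal.mul_ne_top ENNReal.ofReal_ne_top (by simp [hC]), fun c d θ hc => ?_⟩
  obtain ⟨x₁, x₂, hx⟩ := exists_quadratic_lower_bound c d θ (by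
    intro h0
    rw [h0, abs_zero] at hc
    linarith)
  have key : ∀ m : ℤ, ENNReal.ofReal (bracket (θ + c * (m : ℝ) ^ 2 + d * m) ^ (-(3 / 4) : ℝ)) ≤
      ENNReal.ofReal (c₁ ^ (-(3 / 4) : ℝ)) *
        (ENNReal.ofReal ((1 + |(m : ℝ) - x₁|) ^ (-(3 / 2) : ℝ)) +
          ENNReal.ofReal ((1 + |(m : ℝ) - x₂|) ^ (-(3 / 2) : ℝ))) := by
    intro m
    set r := min |(m : ℝ) - x₁| |(m : ℝ) - x₂| with hr
    have hr0 : 0 ≤ r := le_min (abs_nonneg _) (abs_nonneg _)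
    have h1 : c₁ * (1 + r) ^ 2 ≤ bracket (θ + c * (m : ℝ) ^ 2 + d * m) := by
      have h2 := hx m
      have h3 : c₁ ≤ 1 / 2 := by rw [hc₁]; linarith [min_le_left 1 c₀]
      have h4 : c₁ ≤ |c| / 2 := by rw [hc₁]; linarith [min_le_right 1 c₀]
      unfold bracket
      nlinarith [sq_nonneg (1 - r), sq_nonneg r]
    have h5 : bracket (θ + c * (m : ℝ) ^ 2 + d * m) ^ (-(3 / 4) : ℝ) ≤
        c₁ ^ (-(3 / 4) : ℝ) * (1 + r) ^ (-(3 / 2) : ℝ) := by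
      refine (Real.rpow_le_rpow_of_nonpos (by positivity) h1 (by norm_num)).trans (le_of_eq ?_)
      rw [Real.mul_rpow hc₁p.le (by positivity), ← Real.rpow_natCast,
        ← Real.rpow_mul (by positivity)]
      norm_num
    refine (ENNReal.ofReal_le_ofReal h5).trans ?_
    rw [ENNReal.ofReal_mul (by positivity)]
    gcongr
    rcases min_choice |(m : ℝ) - x₁| |(m : ℝ) - x₂| with h6 | h6
    · rw [hr, h6]; exact le_self_add
    · rw [hr, h6]; exact le_add_self
  refine (ENNReal.tsum_le_tsum key).trans ?_
  rw [ENNReal.tsum_mul_left, ENNReal.tsum_add]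
  gcongr
  · exact h x₁
  · exact h x₂

theorem lintegral_bracket_rpow_ne_top {r : ℝ} (hr : 1 < r) :
    ∫⁻ ξ : ℝ, ENNReal.ofReal (bracket (2 * Real.pi * ξ) ^ (-r)) ≠ ⊤ := by
  have h := (integrable_one_add_norm (E := ℝ) (μ := volume) (r := r) (by simpa using hr))
  have h2 : Integrable fun ξ : ℝ => bracket (2 * Real.pi * ξ) ^ (-r) := by
    have := h.comp_mul_left' (R := 2 * Real.pi) (by positivity)
    simpa [bracket] using this
  rw [← lt_top_iff_ne_top]
  exact h2.lintegral_lt_top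

theorem bracket_rpow_sq (x e : ℝ) :
    ENNReal.ofReal (bracket x ^ (-e)) ^ 2 = ENNReal.ofReal (bracket x ^ (-(2 * e))) := by
  rw [← ENNReal.ofReal_pow (by have := bracket_pos x; positivity), ← Real.rpow_natCast,
    ← Real.rpow_mul (bracket_pos x).le]
  congr 2
  push_cast
  ring

/-- A translation in ξ frees the bracket of exponent at least 2b from n, and the other one then
contains only A n + B n. Summing over n first, with ξ fixed, uses the hypothesis uniformly; the
ξ-integral of the free bracket remains. The two alternatives differ in which bracket is freed. -/
theorem tsum_lintegral_brackets_le {A B : ℤ → ℝ} {C : ℝ≥0∞}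
    (hC : ∀ θ : ℝ, ∑' n, ENNReal.ofReal (bracket (θ + (A n + B n)) ^ (-(3 / 4) : ℝ)) ≤ C)
    {b e e' : ℝ} (hee : 3 / 8 ≤ e ∧ b ≤ e' ∨ b ≤ e ∧ 3 / 8 ≤ e') :
    ∑' n, ∫⁻ ξ : ℝ, (ENNReal.ofReal (bracket (-(2 * Real.pi * ξ) + A n) ^ (-e)) *
      ENNReal.ofReal (bracket (2 * Real.pi * ξ + B n) ^ (-e'))) ^ 2 ≤
    C * ∫⁻ ξ : ℝ, ENNReal.ofReal (bracket (2 * Real.pi * ξ) ^ (-(2 * b))) := by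
  have hmono : ∀ x r r' : ℝ, r ≤ r' →
      ENNReal.ofReal (bracket x ^ (-(2 * r'))) ≤ ENNReal.ofReal (bracket x ^ (-(2 * r))) := by
    intro x r r' h
    exact ENNReal.ofReal_le_ofReal (Real.rpow_le_rpow_of_exponent_le (one_le_bracket x) (by linarith))
  have hpi : (2 * Real.pi) ≠ 0 := by positivity
  have hm : ∀ x r : ℝ, Measurable fun ξ : ℝ => ENNReal.ofReal (bracket (2 * Real.pi * ξ + x) ^ r) :=
    fun x r => ((measurable_bracket.comp (by fun_prop)).pow_const r).ennreal_ofReal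
  have hm' : ∀ x r : ℝ,
      Measurable fun ξ : ℝ => ENNReal.ofReal (bracket (-(2 * Real.pi * ξ) + x) ^ r) :=
    fun x r => ((measurable_bracket.comp (by fun_prop)).pow_const r).ennreal_ofReal
  have hm0 : Measurable fun ξ : ℝ => ENNReal.ofReal (bracket (2 * Real.pi * ξ) ^ (-(2 * b))) := by
    simpa using hm 0 _
  simp only [mul_pow, bracket_rpow_sq]
  rcases hee with ⟨h1, h2⟩ | ⟨h1, h2⟩
  · have key : ∀ n, ∫⁻ ξ : ℝ, ENNReal.ofReal (bracket (-(2 * Real.pi * ξ) + A n) ^ (-(2 * e))) *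
        ENNReal.ofReal (bracket (2 * Real.pi * ξ + B n) ^ (-(2 * e'))) ≤
        ∫⁻ ξ : ℝ, ENNReal.ofReal (bracket (-(2 * Real.pi * ξ) + (A n + B n)) ^ (-(3 / 4) : ℝ)) *
          ENNReal.ofReal (bracket (2 * Real.pi * ξ) ^ (-(2 * b))) := by
      intro n
      rw [← lintegral_sub_right_eq_self _ (B n / (2 * Real.pi))]
      refine lintegral_mono fun ξ => ?_
      have e1 : -(2 * Real.pi * (ξ - B n / (2 * Real.pi))) + A n =
        -(2 * Real.pi * ξ) + (A n + B n) := by field_simp; ring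
      have e2 : 2 * Real.pi * (ξ - B n / (2 * Real.pi)) + B n = 2 * Real.pi * ξ := by
        field_simp; ring
      simp only [e1, e2]
      refine mul_le_mul' ((hmono _ _ _ h1).trans (le_of_eq ?_)) (hmono _ _ _ h2)
      norm_num
    refine (ENNReal.tsum_le_tsum key).trans ?_
    rw [← lintegral_tsum (by intro n; exact ((hm' _ _).mul hm0).aemeasurable),
      ← lintegral_const_mul _ hm0]
    refine lintegral_mono fun ξ => ?_
    simp only [ENNReal.tsum_mul_right]
    gcongr
    exact hC _
  · have key : ∀ n, ∫⁻ ξ : ℝ, ENNReal.ofReal (bracket (-(2 * Real.pi * ξ) + A n) ^ (-(2 * e))) *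
        ENNReal.ofReal (bracket (2 * Real.pi * ξ + B n) ^ (-(2 * e'))) ≤
        ∫⁻ ξ : ℝ, ENNReal.ofReal (bracket (2 * Real.pi * ξ) ^ (-(2 * b))) *
          ENNReal.ofReal (bracket (2 * Real.pi * ξ + (A n + B n)) ^ (-(3 / 4) : ℝ)) := by
      intro n
      rw [← lintegral_add_right_eq_self _ (A n / (2 * Real.pi))]
      refine lintegral_mono fun ξ => ?_
      have e1 : -(2 * Real.pi * (ξ + A n / (2 * Real.pi))) + A n = -(2 * Real.pi * ξ) := by
        field_simp; ring
      have e2 : 2 * Real.pi * (ξ + A n / (2 * Real.pi)) + B n =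
        2 * Real.pi * ξ + (A n + B n) := by field_simp; ring
      simp only [e1, e2, bracket_neg]
      refine mul_le_mul' (hmono _ _ _ h1) ((hmono _ _ _ h2).trans (le_of_eq ?_))
      norm_num
    refine (ENNReal.tsum_le_tsum key).trans ?_
    rw [← lintegral_tsum (by intro n; exact (hm0.mul (hm _ _)).aemeasurable),
      mul_comm C, ← lintegral_mul_const _ hm0]
    refine lintegral_mono fun ξ => ?_
    simp only [ENNReal.tsum_mul_left]
    gcongr
    exact hC _

/-! ### The two dispersion relations -/

/-- The Schrödinger dispersion relation. -/
def phiX (L : ℝ) (n : ℤ) : ℝ := waveNumber L n ^ 2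

/-- The Benjamin–Ono dispersion relation. -/
def phiY (L γ : ℝ) (n : ℤ) : ℝ := γ * |waveNumber L n| * waveNumber L n

/-- The modulation `τ + φ(n)`, with `τ = 2πξ`. -/
def modulation (φ : ℤ → ℝ) (p : ℤ × ℝ) : ℝ := 2 * Real.pi * p.2 + φ p.1

theorem measurable_modulation (φ : ℤ → ℝ) : Measurable (modulation φ) := by
  unfold modulation
  exact (measurable_snd.const_mul _).add ((measurable_of_countable φ).comp measurable_fst)

/-- The weight `⟨τ + φ(n)⟩^{-e}`. -/
def modW (φ : ℤ → ℝ) (e : ℝ) (p : ℤ × ℝ) : ℝ≥0∞ :=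
  ENNReal.ofReal (bracket (modulation φ p) ^ (-e))

theorem measurable_modW (φ : ℤ → ℝ) (e : ℝ) : Measurable (modW φ e) :=
  ((measurable_bracket.comp (measurable_modulation φ)).pow_const _).ennreal_ofReal

theorem lintegral_freqMeasure {f : ℤ × ℝ → ℝ≥0∞} (hf : Measurable f) :
    ∫⁻ p, f p ∂freqMeasure = ∑' n, ∫⁻ ξ, f (n, ξ) := by
  rw [lintegral_prod _ hf.aemeasurable, lintegral_count]

/-- The integration variable ξ cancels in the sum of the two modulations, so only the phase φ₁(N -
n) + φ₂(n) matters. -/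
theorem lintegral_modW_sub_mul_le {φ₁ φ₂ : ℤ → ℝ} {C : ℝ≥0∞}
    (hC : ∀ (N : ℤ) (θ : ℝ),
      ∑' n, ENNReal.ofReal (bracket (θ + (φ₁ (N - n) + φ₂ n)) ^ (-(3 / 4) : ℝ)) ≤ C)
    {b e e' : ℝ} (hee : 3 / 8 ≤ e ∧ b ≤ e' ∨ b ≤ e ∧ 3 / 8 ≤ e') (p : ℤ × ℝ) :
    ∫⁻ q, (modW φ₁ e (p - q) * modW φ₂ e' q) ^ 2 ∂freqMeasure ≤
      C * ∫⁻ ξ : ℝ, ENNReal.ofReal (bracket (2 * Real.pi * ξ) ^ (-(2 * b))) := by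
  have hm1 := measurable_modW φ₁ e
  have hm2 := measurable_modW φ₂ e'
  rw [lintegral_freqMeasure (by fun_prop)]
  have h := tsum_lintegral_brackets_le (A := fun n => 2 * Real.pi * p.2 + φ₁ (p.1 - n)) (B := φ₂)
    (C := C) (b := b) (e := e) (e' := e') ?_ hee
  · refine le_trans (le_of_eq ?_) h
    simp only [modW, modulation, Prod.fst_sub, Prod.snd_sub]
    refine tsum_congr fun n => lintegral_congr fun ξ => ?_
    congr 5
    ring
  · intro θ
    refine le_trans (le_of_eq (tsum_congr fun n => ?_)) (hC p.1 (θ + 2 * Real.pi * p.2))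
    congr 3
    ring

theorem lintegral_modW_mul_sub_le {φ₁ φ₂ : ℤ → ℝ} {C : ℝ≥0∞}
    (hC : ∀ (N : ℤ) (θ : ℝ),
      ∑' n, ENNReal.ofReal (bracket (θ + (-φ₁ (n - N) + φ₂ n)) ^ (-(3 / 4) : ℝ)) ≤ C)
    {b e e' : ℝ} (hee : 3 / 8 ≤ e ∧ b ≤ e' ∨ b ≤ e ∧ 3 / 8 ≤ e') (q : ℤ × ℝ) :
    ∫⁻ p, (modW φ₁ e (p - q) * modW φ₂ e' p) ^ 2 ∂freqMeasure ≤
      C * ∫⁻ ξ : ℝ, ENNReal.ofReal (bracket (2 * Real.pi * ξ) ^ (-(2 * b))) := by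
  have hm1 := measurable_modW φ₁ e
  have hm2 := measurable_modW φ₂ e'
  rw [lintegral_freqMeasure (by fun_prop)]
  have h := tsum_lintegral_brackets_le (A := fun n => 2 * Real.pi * q.2 - φ₁ (n - q.1)) (B := φ₂)
    (C := C) (b := b) (e := e) (e' := e') ?_ hee
  · refine le_trans (le_of_eq ?_) h
    simp only [modW, modulation, Prod.fst_sub, Prod.snd_sub]
    refine tsum_congr fun n => lintegral_congr fun ξ => ?_
    congr 4
    rw [← bracket_neg]
    congr 2
    ring
  · intro θ
    refine le_trans (le_of_eq (tsum_congr fun n => ?_)) (hC q.1 (θ + 2 * Real.pi * q.2))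
    congr 3
    ring

/-- The phase κ²((N - n)² + n²) is quadratic in n with leading coefficient 2κ², independent of N. -/
theorem tsum_phiX_add_phiX (L : ℝ) [Fact (0 < L)] : ∃ C : ℝ≥0∞, C ≠ ⊤ ∧ ∀ (N : ℤ) (θ : ℝ),
    ∑' n, ENNReal.ofReal (bracket (θ + (phiX L (N - n) + phiX L n)) ^ (-(3 / 4) : ℝ)) ≤ C := by
  have hL : 0 < L := Fact.out
  set κ := 2 * Real.pi / L with hκ
  have hκ0 : 0 < κ := by positivity
  obtain ⟨C, hC, h⟩ := exists_tsum_quadratic_le (c₀ := 2 * κ ^ 2) (by positivity)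
  refine ⟨C, hC, fun N θ => ?_⟩
  refine le_trans (le_of_eq (tsum_congr fun n => ?_))
    (h (2 * κ ^ 2) (-2 * κ ^ 2 * N) (θ + κ ^ 2 * N ^ 2) (le_abs_self _))
  congr 3
  simp only [phiX, waveNumber, hκ]
  push_cast
  field_simp
  ring

/-- On each of the half-lines N - n ≥ 0 and N - n ≤ 0 the phase is a quadratic polynomial in n, with
leading coefficient κ²(1 + γ) or κ²(1 - γ). Both are nonzero because |γ| ≠ 1, and the sum is bounded
by the two full sums. -/
theorem tsum_phiY_add_phiX (L : ℝ) [Fact (0 < L)] {γ : ℝ} (hγ : |γ| ≠ 1) :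
    ∃ C : ℝ≥0∞, C ≠ ⊤ ∧ ∀ (N : ℤ) (θ : ℝ), ∑' n, ENNReal.ofReal
      (bracket (θ + (phiY L γ (N - n) + phiX L n)) ^ (-(3 / 4) : ℝ)) ≤ C := by
  have hL : 0 < L := Fact.out
  set κ := 2 * Real.pi / L with hκ
  have hκ0 : 0 < κ := by positivity
  have h1 : 1 + γ ≠ 0 := by
    intro h
    rw [show γ = -1 by linarith] at hγ
    simp at hγ
  have h2 : 1 - γ ≠ 0 := by
    intro h
    rw [show γ = 1 by linarith] at hγ
    simp at hγ
  obtain ⟨C₁, hC₁, h₁⟩ := exists_tsum_quadratic_le (c₀ := κ ^ 2 * |1 + γ|) (by positivity)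
  obtain ⟨C₂, hC₂, h₂⟩ := exists_tsum_quadratic_le (c₀ := κ ^ 2 * |1 - γ|) (by positivity)
  refine ⟨C₁ + C₂, by simp [hC₁, hC₂], fun N θ => ?_⟩
  have k1 := h₁ (κ ^ 2 * (1 + γ)) (-2 * κ ^ 2 * γ * N) (θ + κ ^ 2 * γ * N ^ 2)
    (by rw [abs_mul, abs_of_pos (by positivity : 0 < κ ^ 2)])
  have k2 := h₂ (κ ^ 2 * (1 - γ)) (2 * κ ^ 2 * γ * N) (θ - κ ^ 2 * γ * N ^ 2)
    (by rw [abs_mul, abs_of_pos (by positivity : 0 < κ ^ 2)])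
  refine le_trans ?_ (add_le_add k1 k2)
  rw [← ENNReal.tsum_add]
  refine ENNReal.tsum_le_tsum fun n => ?_
  have hw : waveNumber L (N - n) = κ * (N - n) := by
    simp only [waveNumber, hκ]
    push_cast
    ring
  have hw' : waveNumber L n = κ * n := by
    simp only [waveNumber, hκ]
    ring
  rcases le_total 0 ((N : ℝ) - n) with hs | hs
  · refine le_trans (le_of_eq ?_) le_self_add
    congr 3
    rw [phiY, phiX, hw, hw', abs_of_nonneg (by positivity)]
    ring
  · refine le_trans (le_of_eq ?_) le_add_self
    congr 3
    rw [phiY, phiX, hw, hw', abs_of_nonpos (mul_nonpos_of_nonneg_of_nonpos hκ0.le hs)]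
    ring

theorem phiY_neg (L γ : ℝ) (n : ℤ) : phiY L γ (-n) = -phiY L γ n := by
  simp only [phiY, waveNumber]
  push_cast
  rw [show 2 * Real.pi * -(n : ℝ) / L = -(2 * Real.pi * n / L) by ring, abs_neg]
  ring

theorem tsum_neg_phiY_add_phiX (L : ℝ) [Fact (0 < L)] {γ : ℝ} (hγ : |γ| ≠ 1) :
    ∃ C : ℝ≥0∞, C ≠ ⊤ ∧ ∀ (N : ℤ) (θ : ℝ), ∑' n, ENNReal.ofReal
      (bracket (θ + (-phiY L γ (n - N) + phiX L n)) ^ (-(3 / 4) : ℝ)) ≤ C := by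
  obtain ⟨C, hC, h⟩ := tsum_phiY_add_phiX L hγ
  refine ⟨C, hC, fun N θ => ?_⟩
  refine le_trans (le_of_eq (tsum_congr fun n => ?_)) (h N θ)
  rw [← phiY_neg, neg_sub]

/-! ### Resonance and the bilinear estimates -/

/-- `⟨σ₀⟩^{1/4} + ⟨σ₁⟩^{1/4} + ⟨σ₂⟩^{1/4}`. -/
def quarterSum (x y z : ℝ) : ℝ :=
  bracket x ^ (1 / 4 : ℝ) + bracket y ^ (1 / 4 : ℝ) + bracket z ^ (1 / 4 : ℝ)

theorem one_le_quarterSum (x y z : ℝ) : 1 ≤ quarterSum x y z := by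
  unfold quarterSum
  have h1 := Real.one_le_rpow (one_le_bracket x) (by norm_num : (0 : ℝ) ≤ 1 / 4)
  have h2 := Real.one_le_rpow (one_le_bracket y) (by norm_num : (0 : ℝ) ≤ 1 / 4)
  have h3 := Real.one_le_rpow (one_le_bracket z) (by norm_num : (0 : ℝ) ≤ 1 / 4)
  linarith

theorem bracket_add_bracket_le_quarterSum_pow (x y z : ℝ) :
    bracket x + bracket y + bracket z ≤ quarterSum x y z ^ 4 := by
  have h : ∀ x : ℝ, bracket x = (bracket x ^ (1 / 4 : ℝ)) ^ 4 := by
    intro x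
    rw [← Real.rpow_natCast, ← Real.rpow_mul (bracket_pos x).le]
    norm_num
  have hp : ∀ x : ℝ, 0 ≤ bracket x ^ (1 / 4 : ℝ) := fun x => by
    have := bracket_pos x
    positivity
  unfold quarterSum
  have key : ∀ u v w : ℝ, 0 ≤ u → 0 ≤ v → 0 ≤ w → u ^ 4 + v ^ 4 + w ^ 4 ≤ (u + v + w) ^ 4 := by
    intro u v w hu hv hw
    have h1 : u ^ 4 + v ^ 4 ≤ (u + v) ^ 4 := pow_add_pow_le hu hv (by norm_num)
    have h2 : (u + v) ^ 4 + w ^ 4 ≤ (u + v + w) ^ 4 :=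
      pow_add_pow_le (by positivity) hw (by norm_num)
    linarith
  calc bracket x + bracket y + bracket z = _ := by rw [h x, h y, h z]
    _ ≤ _ := by
      simp only [← h]
      convert key _ _ _ (hp x) (hp y) (hp z) using 1
      rw [← h x, ← h y, ← h z]

/-- With n = n₁ - n₂ the phase equals κ² n (γ|n| - (n₁ + n₂)). Where the second factor exceeds c|n|,
the phase is at least κ² c n², and a fourth root gives the second alternative. Where it does not, n₁
+ n₂ is close to γ|n|, and since |γ| ≠ 1 neither 2n₁ = (n₁ + n₂) + n nor 2n₂ = (n₁ + n₂) - n can be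
small compared with n. -/
theorem resonance_dichotomy (L : ℝ) [Fact (0 < L)] {γ : ℝ} (hγ : |γ| ≠ 1) :
    ∃ C : ℝ, 1 ≤ C ∧ ∀ (n₁ n₂ : ℤ) (σ₀ σ₁ σ₂ : ℝ),
      σ₀ - σ₁ + σ₂ = phiY L γ (n₁ - n₂) - phiX L n₁ + phiX L n₂ →
      (bracket ((n₁ - n₂ : ℤ) : ℝ) ≤ C * bracket n₁ ∧ bracket ((n₁ - n₂ : ℤ) : ℝ) ≤ C * bracket n₂ ∧
        bracket n₁ ≤ C * bracket ((n₁ - n₂ : ℤ) : ℝ)) ∨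
      bracket ((n₁ - n₂ : ℤ) : ℝ) ^ (1 / 2 : ℝ) ≤ C * quarterSum σ₀ σ₁ σ₂ := by
  have hL : 0 < L := Fact.out
  set κ := 2 * Real.pi / L with hκ
  have hκ0 : 0 < κ := by positivity
  -- Half of the gap between |γ| and 1, so that a perturbation of size c|n| cannot close it.
  set c := |(|γ| - 1)| / 2 with hc
  have hc0 : 0 < c := by
    have := abs_pos.mpr (sub_ne_zero.mpr hγ)
    positivity
  set D := 2 * (1 + 1 / (κ ^ 2 * c)) with hD
  have hD0 : 0 < 1 / (κ ^ 2 * c) := by positivity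
  -- `D` serves the nonresonant case, 2/c the lower bounds for |n₁| and |n₂|, and 1 + |γ| + c the
  -- upper bound for |n₁|.
  set C := D + 2 / c + (1 + |γ| + c) with hC
  have hγ0 := abs_nonneg γ
  have hc2 : 0 < 2 / c := by positivity
  have hC1 : 1 ≤ C := by linarith
  refine ⟨C, hC1, fun n₁ n₂ σ₀ σ₁ σ₂ hσ => ?_⟩
  set n : ℝ := ((n₁ - n₂ : ℤ) : ℝ) with hn
  have hnn : n = n₁ - n₂ := by rw [hn]; push_cast; ring
  have hn0 := abs_nonneg n
  have hH : phiY L γ (n₁ - n₂) - phiX L n₁ + phiX L n₂ = κ ^ 2 * (n * (γ * |n| - (n₁ + n₂))) := by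
    have hw : waveNumber L (n₁ - n₂) = κ * n := by
      rw [waveNumber, hκ]; ring
    rw [phiY, hw, abs_mul, abs_of_pos hκ0]
    simp only [phiX, waveNumber, hκ]
    rw [hnn]
    field_simp
    ring
  by_cases hr : |γ * |n| - (n₁ + n₂)| ≤ c * |n|
  · left
    have e1 : |(γ * |n|)| = |γ| * |n| := by rw [abs_mul, abs_abs]
    have h1 : |((n₁ : ℝ) + n₂ - γ * |n|)| ≤ c * |n| := by rwa [abs_sub_comm]
    have h2 : |(|γ| * |n| - |n|)| = 2 * c * |n| := by
      rw [show |γ| * |n| - |n| = (|γ| - 1) * |n| by ring, abs_mul, abs_abs, hc]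
      ring
    -- The number 2m is within c|n| of γ|n| ± n, whose modulus is at least ||γ| - 1||n| = 2c|n|.
    have key : ∀ m : ℝ, (2 * m = (n₁ + n₂) + n ∨ 2 * m = (n₁ + n₂) - n) → c * |n| ≤ 2 * |m| := by
      intro m hm
      have h3 : |(|(γ * |n|)| - |n|)| ≤ |(2 * m - ((n₁ + n₂) - γ * |n|))| := by
        rcases hm with hm | hm
        · rw [hm, show (n₁ : ℝ) + n₂ + n - (n₁ + n₂ - γ * |n|) = γ * |n| - (-n) by ring,
            ← abs_neg n]
          exact abs_abs_sub_abs_le_abs_sub _ _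
        · rw [hm, show (n₁ : ℝ) + n₂ - n - (n₁ + n₂ - γ * |n|) = γ * |n| - n by ring]
          exact abs_abs_sub_abs_le_abs_sub _ _
      rw [e1, h2] at h3
      have h4 := abs_sub (2 * m) ((n₁ + n₂) - γ * |n|)
      rw [abs_mul, abs_two] at h4
      linarith
    have k1 := key n₁ (Or.inl (by rw [hnn]; ring))
    have k2 := key n₂ (Or.inr (by rw [hnn]; ring))
    have hfin : ∀ m : ℝ, c * |n| ≤ 2 * |m| → bracket n ≤ C * bracket m := by
      intro m hm
      have h5 : |n| ≤ 2 / c * |m| := by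
        rw [div_mul_eq_mul_div, le_div_iff₀ hc0]
        linarith
      unfold bracket
      have h6 : 2 / c * |m| ≤ C * |m| :=
        mul_le_mul_of_nonneg_right (by linarith) (abs_nonneg m)
      linarith
    refine ⟨hfin _ k1, hfin _ k2, ?_⟩
    have h7 : |(n₁ : ℝ)| ≤ (1 + |γ| + c) * |n| := by
      have h8 : 2 * (n₁ : ℝ) = n + (((n₁ : ℝ) + n₂) - γ * |n|) + γ * |n| := by rw [hnn]; ring
      have h9 : 2 * |(n₁ : ℝ)| ≤ |n| + c * |n| + |γ| * |n| := by
        rw [← abs_two, ← abs_mul, h8]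
        refine (abs_add_three _ _ _).trans ?_
        rw [e1]
        linarith
      nlinarith [abs_nonneg (n₁ : ℝ)]
    unfold bracket
    have h10 : (1 + |γ| + c) * |n| ≤ C * |n| := mul_le_mul_of_nonneg_right (by linarith) hn0
    linarith
  · right
    push Not at hr
    have hS := one_le_quarterSum σ₀ σ₁ σ₂
    have h1 : κ ^ 2 * c * n ^ 2 ≤ |σ₀ - σ₁ + σ₂| := by
      rw [hσ, hH, abs_mul, abs_mul, abs_of_pos (by positivity : 0 < κ ^ 2), mul_assoc]
      refine mul_le_mul_of_nonneg_left ?_ (by positivity)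
      rw [← sq_abs n]
      nlinarith
    have h2 : |σ₀ - σ₁ + σ₂| + 1 ≤ quarterSum σ₀ σ₁ σ₂ ^ 4 := by
      refine le_trans ?_ (bracket_add_bracket_le_quarterSum_pow _ _ _)
      have h3 := abs_add_three σ₀ (-σ₁) σ₂
      rw [abs_neg, ← sub_eq_add_neg] at h3
      unfold bracket
      linarith
    have h4 : bracket n ^ 2 ≤ D * quarterSum σ₀ σ₁ σ₂ ^ 4 := by
      have h5 : bracket n ^ 2 ≤ 2 * (1 + n ^ 2) := by
        unfold bracket
        rw [← sq_abs n]
        nlinarith [sq_nonneg (1 - |n|)]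
      have h6 : n ^ 2 ≤ 1 / (κ ^ 2 * c) * |σ₀ - σ₁ + σ₂| := by
        rw [div_mul_eq_mul_div, le_div_iff₀ (by positivity)]
        linarith
      have h7 : 1 / (κ ^ 2 * c) * |σ₀ - σ₁ + σ₂| ≤
          1 / (κ ^ 2 * c) * quarterSum σ₀ σ₁ σ₂ ^ 4 :=
        mul_le_mul_of_nonneg_left (by linarith) hD0.le
      have h8 : (1 : ℝ) ≤ quarterSum σ₀ σ₁ σ₂ ^ 4 := one_le_pow₀ hS
      rw [hD]
      nlinarith
    have hD1 : 1 ≤ D := by rw [hD]; linarith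
    have h9 : bracket n ^ (1 / 2 : ℝ) ≤ D * quarterSum σ₀ σ₁ σ₂ := by
      refine le_of_pow_le_pow_left₀ (n := 4) (by norm_num) (by positivity) ?_
      rw [← Real.rpow_natCast, ← Real.rpow_mul (bracket_pos n).le, mul_pow]
      have : bracket n ^ ((1 / 2 : ℝ) * (4 : ℕ)) = bracket n ^ 2 := by
        rw [← Real.rpow_natCast]
        norm_num
      rw [this]
      refine h4.trans ?_
      gcongr
      exact le_self_pow₀ hD1 (by norm_num)
    refine h9.trans ?_
    gcongr
    linarith

/-- In both inequalities the loss to be paid is ⟨n⟩^{1/2} with n = n₁ - n₂: once because v has half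
a derivative less than u, once because the full derivative in the second equation acts on a function
measured with s - 1/2 derivatives. If n₁, n₂ and n are comparable, ⟨n⟩^{1/2} ≤ ⟨n⟩^s is moved to
another factor, which is where s ≥ 1/2 enters. Otherwise the modulations absorb it, and ⟨x + y⟩ ≤
⟨x⟩⟨y⟩ distributes the remaining s derivatives. -/
theorem weight_bounds (L : ℝ) [Fact (0 < L)] {γ s : ℝ} (hγ : |γ| ≠ 1) (hs : 1 / 2 ≤ s) :
    ∃ C : ℝ, 0 ≤ C ∧ ∀ (n₁ n₂ : ℤ) (σ₀ σ₁ σ₂ : ℝ),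
      σ₀ - σ₁ + σ₂ = phiY L γ (n₁ - n₂) - phiX L n₁ + phiX L n₂ →
      bracket n₁ ^ s ≤ C * quarterSum σ₀ σ₁ σ₂ *
        (bracket ((n₁ - n₂ : ℤ) : ℝ) ^ (s - 1 / 2) * bracket n₂ ^ s) ∧
      |waveNumber L (n₁ - n₂)| * bracket ((n₁ - n₂ : ℤ) : ℝ) ^ (s - 1 / 2) ≤
        C * quarterSum σ₀ σ₁ σ₂ * (bracket n₁ ^ s * bracket n₂ ^ s) := by
  have hL : 0 < L := Fact.out
  obtain ⟨C, hC, h⟩ := resonance_dichotomy L hγ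
  set κ := 2 * Real.pi / L with hκ
  have hκ0 : 0 < κ := by positivity
  have hCs : 1 ≤ C ^ s := Real.one_le_rpow hC (by linarith)
  set D := C ^ s * C ^ s * C with hD
  have hD1 : C ^ s * C ^ s ≤ D := le_mul_of_one_le_right (by positivity) hC
  have hD2 : C ≤ D := le_mul_of_one_le_left (by positivity) (one_le_mul_of_one_le_of_one_le hCs hCs)
  have main : ∀ (n₁ n₂ : ℤ) (σ₀ σ₁ σ₂ : ℝ),
      σ₀ - σ₁ + σ₂ = phiY L γ (n₁ - n₂) - phiX L n₁ + phiX L n₂ →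
      bracket n₁ ^ s ≤ D * quarterSum σ₀ σ₁ σ₂ *
        (bracket ((n₁ - n₂ : ℤ) : ℝ) ^ (s - 1 / 2) * bracket n₂ ^ s) ∧
      bracket ((n₁ - n₂ : ℤ) : ℝ) ^ (1 / 2 : ℝ) * bracket ((n₁ - n₂ : ℤ) : ℝ) ^ s ≤
        D * quarterSum σ₀ σ₁ σ₂ * (bracket n₁ ^ s * bracket n₂ ^ s) := by
    intro n₁ n₂ σ₀ σ₁ σ₂ hσ
    set n : ℝ := ((n₁ - n₂ : ℤ) : ℝ) with hn
    have hnn : n = n₁ - n₂ := by rw [hn]; push_cast; ring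
    have hS := one_le_quarterSum σ₀ σ₁ σ₂
    have p0 := bracket_pos n
    have p1 := bracket_pos n₁
    have p2 := bracket_pos n₂
    have hsplit : bracket n ^ s = bracket n ^ (s - 1 / 2) * bracket n ^ (1 / 2 : ℝ) := by
      rw [← Real.rpow_add p0]
      ring_nf
    have hhalf : bracket n ^ (1 / 2 : ℝ) ≤ bracket n ^ s :=
      Real.rpow_le_rpow_of_exponent_le (one_le_bracket n) hs
    rcases h n₁ n₂ σ₀ σ₁ σ₂ hσ with ⟨h1, h2, h3⟩ | h1
    · have k1 : bracket n ^ s ≤ C ^ s * bracket n₁ ^ s := by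
        rw [← Real.mul_rpow (by linarith) p1.le]
        exact Real.rpow_le_rpow p0.le h1 (by linarith)
      have k2 : bracket n ^ s ≤ C ^ s * bracket n₂ ^ s := by
        rw [← Real.mul_rpow (by linarith) p2.le]
        exact Real.rpow_le_rpow p0.le h2 (by linarith)
      have k3 : bracket n₁ ^ s ≤ C ^ s * bracket n ^ s := by
        rw [← Real.mul_rpow (by linarith) p0.le]
        exact Real.rpow_le_rpow p1.le h3 (by linarith)
      have hDS : C ^ s * C ^ s ≤ D * quarterSum σ₀ σ₁ σ₂ :=
        hD1.trans (le_mul_of_one_le_right (by positivity) hS)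
      constructor
      · calc bracket n₁ ^ s ≤ C ^ s * bracket n ^ s := k3
          _ = C ^ s * (bracket n ^ (s - 1 / 2) * bracket n ^ (1 / 2 : ℝ)) := by rw [← hsplit]
          _ ≤ C ^ s * (bracket n ^ (s - 1 / 2) * (C ^ s * bracket n₂ ^ s)) := by
            gcongr
            exact hhalf.trans k2
          _ = C ^ s * C ^ s * (bracket n ^ (s - 1 / 2) * bracket n₂ ^ s) := by ring
          _ ≤ _ := by gcongr
      · calc bracket n ^ (1 / 2 : ℝ) * bracket n ^ s ≤
            (C ^ s * bracket n₁ ^ s) * (C ^ s * bracket n₂ ^ s) := by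
              gcongr
              exact hhalf.trans k1
          _ = C ^ s * C ^ s * (bracket n₁ ^ s * bracket n₂ ^ s) := by ring
          _ ≤ _ := by gcongr
    · have hCS : C * quarterSum σ₀ σ₁ σ₂ ≤ D * quarterSum σ₀ σ₁ σ₂ := by gcongr
      have h1' := h1.trans hCS
      constructor
      · have k : bracket n₁ ^ s ≤ bracket n ^ s * bracket n₂ ^ s := by
          rw [← Real.mul_rpow p0.le p2.le]
          refine Real.rpow_le_rpow p1.le ?_ (by linarith)
          rw [show (n₁ : ℝ) = n + n₂ by rw [hnn]; ring]
          exact bracket_add_le _ _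
        calc bracket n₁ ^ s ≤ bracket n ^ s * bracket n₂ ^ s := k
          _ = bracket n ^ (1 / 2 : ℝ) * (bracket n ^ (s - 1 / 2) * bracket n₂ ^ s) := by
            rw [hsplit]; ring
          _ ≤ _ := by gcongr
      · have k : bracket n ^ s ≤ bracket n₁ ^ s * bracket n₂ ^ s := by
          rw [← Real.mul_rpow p1.le p2.le]
          refine Real.rpow_le_rpow p0.le ?_ (by linarith)
          rw [hnn, sub_eq_add_neg, ← bracket_neg (n₂ : ℝ)]
          exact bracket_add_le _ _
        gcongr
  refine ⟨(1 + κ) * D, by positivity, fun n₁ n₂ σ₀ σ₁ σ₂ hσ => ?_⟩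
  obtain ⟨h1, h2⟩ := main n₁ n₂ σ₀ σ₁ σ₂ hσ
  have hS := one_le_quarterSum σ₀ σ₁ σ₂
  have p1 := bracket_pos n₁
  have p2 := bracket_pos n₂
  set n : ℝ := ((n₁ - n₂ : ℤ) : ℝ) with hn
  have p0 := bracket_pos n
  constructor
  · refine h1.trans ?_
    gcongr
    exact le_mul_of_one_le_left (by positivity) (by linarith)
  · have hw : |waveNumber L (n₁ - n₂)| ≤ (1 + κ) * bracket n := by
      have : waveNumber L (n₁ - n₂) = κ * n := by rw [waveNumber, hκ]; ring
      rw [this, abs_mul, abs_of_pos hκ0]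
      have := abs_nonneg n
      unfold bracket
      nlinarith
    calc |waveNumber L (n₁ - n₂)| * bracket n ^ (s - 1 / 2)
        ≤ (1 + κ) * bracket n * bracket n ^ (s - 1 / 2) := by gcongr
      _ = (1 + κ) * (bracket n ^ (1 / 2 : ℝ) * bracket n ^ s) := by
          rw [← Real.rpow_add p0, mul_assoc, ← Real.rpow_one_add' p0.le (by linarith)]
          ring_nf
      _ ≤ (1 + κ) * (D * quarterSum σ₀ σ₁ σ₂ * (bracket n₁ ^ s * bracket n₂ ^ s)) := by gcongr
      _ = _ := by ring

theorem ofReal_bracket_quarter_mul_modW_le {φ : ℤ → ℝ} {e : ℝ} (he : 3 / 8 ≤ e) (p : ℤ × ℝ) :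
    ENNReal.ofReal (bracket (modulation φ p) ^ (1 / 4 : ℝ)) * modW φ e p ≤ 1 := by
  have h := bracket_pos (modulation φ p)
  rw [modW, ← ENNReal.ofReal_mul (by positivity), ← Real.rpow_add h, ENNReal.ofReal_le_one]
  exact Real.rpow_le_one_of_one_le_of_nonpos (one_le_bracket _) (by linarith)

instance : freqMeasure.IsNegInvariant where
  neg_eq_self := by
    have h := (Measure.measurePreserving_neg (Measure.count : Measure ℤ)).prod
      (Measure.measurePreserving_neg (volume : Measure ℝ))
    exact h.map_eq

/-- The basic trilinear estimate. -/
theorem trilinear_estimate (L : ℝ) [Fact (0 < L)] {γ b : ℝ} (hγ : |γ| ≠ 1) (hb : 1 / 2 < b) :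
    ∃ C : ℝ≥0∞, C ≠ ⊤ ∧ ∀ (e₀ e₁ e₂ : ℝ), 3 / 8 ≤ e₀ → 3 / 8 ≤ e₁ → 3 / 8 ≤ e₂ →
      (b ≤ e₀ ∧ b ≤ e₁ ∨ b ≤ e₀ ∧ b ≤ e₂ ∨ b ≤ e₁ ∧ b ≤ e₂) →
      ∀ f₀ f₁ f₂ : ℤ × ℝ → ℝ≥0∞, Measurable f₀ → Measurable f₁ → Measurable f₂ →
      (∫⁻ p, ∫⁻ q, ENNReal.ofReal (quarterSum (modulation (phiY L γ) (p - q))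
          (modulation (phiX L) p) (modulation (phiX L) q)) *
        (modW (phiY L γ) e₀ (p - q) * modW (phiX L) e₁ p * modW (phiX L) e₂ q) *
        (f₀ (p - q) * f₁ p * f₂ q) ∂freqMeasure ∂freqMeasure) ^ 2 ≤
      C * ((∫⁻ p, f₀ p ^ 2 ∂freqMeasure) * (∫⁻ p, f₁ p ^ 2 ∂freqMeasure) *
        ∫⁻ p, f₂ p ^ 2 ∂freqMeasure) := by
  obtain ⟨C₀, hC₀, h₀⟩ := tsum_phiX_add_phiX L
  obtain ⟨C₁, hC₁, h₁⟩ := tsum_phiY_add_phiX L hγ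
  obtain ⟨C₂, hC₂, h₂⟩ := tsum_neg_phiY_add_phiX L hγ
  set I := ∫⁻ ξ : ℝ, ENNReal.ofReal (bracket (2 * Real.pi * ξ) ^ (-(2 * b))) with hI
  have hIt : I ≠ ⊤ := lintegral_bracket_rpow_ne_top (by linarith)
  set M := 2 * (C₀ * I) + C₁ * I + C₂ * I with hM
  have hMt : M ≠ ⊤ := by
    rw [hM]
    finiteness
  refine ⟨9 * M, by finiteness, fun e₀ e₁ e₂ he₀ he₁ he₂ hee f₀ f₁ f₂ hf₀ hf₁ hf₂ => ?_⟩
  have m0 := measurable_modW (phiY L γ) e₀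
  have m1 := measurable_modW (phiX L) e₁
  have m2 := measurable_modW (phiX L) e₂
  set x₀ := modW (phiY L γ) e₀
  set x₁ := modW (phiX L) e₁
  set x₂ := modW (phiX L) e₂
  -- Each of the three terms of `quarterSum` is cancelled by the modulation weight of its own
  -- factor, as 3/8 ≥ 1/4. Two weights survive. Since at least two of the three exponents are ≥ b,
  -- at least one survivor has exponent ≥ b, and the other has exponent ≥ 3/8. The pairs are (1,2),
  -- (0,2) and (0,1), with constants from the three phase sums.
  have t0 := trilinear_le_of_weights_one_two freqMeasure hf₀ hf₁ hf₂ m1 m2 (M := C₀ * I)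
    (fun p => lintegral_modW_sub_mul_le h₀ (by rcases hee with h | h | h <;> tauto) p)
  have t1 := trilinear_le_of_weights_zero_two freqMeasure hf₀ hf₁ hf₂ m0 m2 (M := C₁ * I)
    (fun p => lintegral_modW_sub_mul_le h₁ (by rcases hee with h | h | h <;> tauto) p)
  have t2 := trilinear_le_of_weights_zero_one freqMeasure hf₀ hf₁ hf₂ m0 m1 (M := C₂ * I)
    (fun p => lintegral_modW_mul_sub_le h₂ (by rcases hee with h | h | h <;> tauto) p)
  set N := (∫⁻ p, f₀ p ^ 2 ∂freqMeasure) * (∫⁻ p, f₁ p ^ 2 ∂freqMeasure) *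
        ∫⁻ p, f₂ p ^ 2 ∂freqMeasure
  have t0' := t0.trans (b := _) (c := M * N) (by gcongr; rw [hM, add_assoc]; exact le_self_add)
  have t1' := t1.trans (b := _) (c := M * N)
    (by gcongr; rw [hM]; exact le_add_self.trans le_self_add)
  have t2' := t2.trans (b := _) (c := M * N) (by gcongr; rw [hM]; exact le_add_self)
  rw [mul_assoc]
  refine le_trans ?_ (add_add_sq_le t0' t1' t2')
  gcongr
  have i0 : Measurable fun p => ∫⁻ q, x₁ p * x₂ q * (f₀ (p - q) * f₁ p * f₂ q) ∂freqMeasure :=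
    Measurable.lintegral_prod_right' (f := fun z : (ℤ × ℝ) × (ℤ × ℝ) =>
      x₁ z.1 * x₂ z.2 * (f₀ (z.1 - z.2) * f₁ z.1 * f₂ z.2)) (by fun_prop)
  have i1 : Measurable fun p =>
      ∫⁻ q, x₀ (p - q) * x₂ q * (f₀ (p - q) * f₁ p * f₂ q) ∂freqMeasure :=
    Measurable.lintegral_prod_right' (f := fun z : (ℤ × ℝ) × (ℤ × ℝ) =>
      x₀ (z.1 - z.2) * x₂ z.2 * (f₀ (z.1 - z.2) * f₁ z.1 * f₂ z.2)) (by fun_prop)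
  rw [← lintegral_add_left i0, ← lintegral_add_left (by exact i0.add i1)]
  gcongr with p
  rw [← lintegral_add_left (by fun_prop), ← lintegral_add_left (by fun_prop)]
  gcongr with q
  have g0 : ENNReal.ofReal (bracket (modulation (phiY L γ) (p - q)) ^ (1 / 4 : ℝ)) * x₀ (p - q) ≤ 1 :=
    ofReal_bracket_quarter_mul_modW_le he₀ _
  have g1 : ENNReal.ofReal (bracket (modulation (phiX L) p) ^ (1 / 4 : ℝ)) * x₁ p ≤ 1 :=
    ofReal_bracket_quarter_mul_modW_le he₁ _
  have g2 : ENNReal.ofReal (bracket (modulation (phiX L) q) ^ (1 / 4 : ℝ)) * x₂ q ≤ 1 :=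
    ofReal_bracket_quarter_mul_modW_le he₂ _
  rw [quarterSum, ENNReal.ofReal_add, ENNReal.ofReal_add]
  · generalize ENNReal.ofReal (bracket (modulation (phiY L γ) (p - q)) ^ (1 / 4 : ℝ)) = y₀ at *
    generalize ENNReal.ofReal (bracket (modulation (phiX L) p) ^ (1 / 4 : ℝ)) = y₁ at *
    generalize ENNReal.ofReal (bracket (modulation (phiX L) q) ^ (1 / 4 : ℝ)) = y₂ at *
    calc _ = (y₀ * x₀ (p - q)) * (x₁ p * x₂ q * (f₀ (p - q) * f₁ p * f₂ q)) +
          (y₁ * x₁ p) * (x₀ (p - q) * x₂ q * (f₀ (p - q) * f₁ p * f₂ q)) +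
          (y₂ * x₂ q) * (x₀ (p - q) * x₁ p * (f₀ (p - q) * f₁ p * f₂ q)) := by ring
      _ ≤ 1 * (x₁ p * x₂ q * (f₀ (p - q) * f₁ p * f₂ q)) +
          1 * (x₀ (p - q) * x₂ q * (f₀ (p - q) * f₁ p * f₂ q)) +
          1 * (x₀ (p - q) * x₁ p * (f₀ (p - q) * f₁ p * f₂ q)) := by gcongr
      _ = _ := by simp only [one_mul]
  all_goals
    have h1 := bracket_pos (modulation (phiY L γ) (p - q))
    have h2 := bracket_pos (modulation (phiX L) p)
    have h3 := bracket_pos (modulation (phiX L) q)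
    positivity

/-! ### Frequency functions, their weighted norms and the two bilinear bounds -/

/-- The weight `(Λ + |τ + φ(n)|)^b ⟨n⟩^s`. -/
def wt (φ : ℤ → ℝ) (Λ s b : ℝ) (p : ℤ × ℝ) : ℝ :=
  (Λ + |modulation φ p|) ^ b * bracket (p.1 : ℝ) ^ s

theorem wt_pos {φ : ℤ → ℝ} {Λ s b : ℝ} (hΛ : 1 ≤ Λ) (p : ℤ × ℝ) : 0 < wt φ Λ s b p := by
  have h1 := bracket_pos (p.1 : ℝ)
  have h2 : 0 < Λ + |modulation φ p| := by linarith [abs_nonneg (modulation φ p)]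
  unfold wt
  positivity

theorem measurable_wt (φ : ℤ → ℝ) (Λ s b : ℝ) : Measurable (wt φ Λ s b) := by
  have h1 := measurable_modulation φ
  have h2 : Measurable fun p : ℤ × ℝ => bracket (p.1 : ℝ) :=
    measurable_bracket.comp ((measurable_of_countable fun n : ℤ => (n : ℝ)).comp measurable_fst)
  unfold wt
  exact ((measurable_const.add (measurable_norm.comp h1)).pow_const b).mul (h2.pow_const s)

/-- The squared norm of a frequency function in the Bourgain space with parameter `Λ`. -/
def nsq (φ : ℤ → ℝ) (Λ s b : ℝ) (F : ℤ × ℝ → ℂ) : ℝ≥0∞ :=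
  ∫⁻ p, (ENNReal.ofReal (wt φ Λ s b p) * ‖F p‖ₑ) ^ 2 ∂freqMeasure

/-- Convolution of frequency functions. -/
def conv (G F : ℤ × ℝ → ℂ) (p : ℤ × ℝ) : ℂ := ∫ q, G (p - q) * F q ∂freqMeasure

/-- The frequency function of the complex conjugate. -/
def cnj (F : ℤ × ℝ → ℂ) (p : ℤ × ℝ) : ℂ := starRingEnd ℂ (F (-p))

/-- The frequency function of the spatial derivative. -/
def dx (L : ℝ) (K : ℤ × ℝ → ℂ) (p : ℤ × ℝ) : ℂ := Complex.I * waveNumber L p.1 * K p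

theorem measurable_conv {G F : ℤ × ℝ → ℂ} (hG : Measurable G) (hF : Measurable F) :
    Measurable (conv G F) := by
  have h : StronglyMeasurable fun z : (ℤ × ℝ) × (ℤ × ℝ) => G (z.1 - z.2) * F z.2 :=
    (by fun_prop : Measurable fun z : (ℤ × ℝ) × (ℤ × ℝ) => G (z.1 - z.2) * F z.2).stronglyMeasurable
  exact (h.integral_prod_right' (ν := freqMeasure)).measurable

theorem measurable_cnj {F : ℤ × ℝ → ℂ} (hF : Measurable F) : Measurable (cnj F) := by
  unfold cnj
  fun_prop

theorem measurable_dx (L : ℝ) {K : ℤ × ℝ → ℂ} (hK : Measurable K) : Measurable (dx L K) := by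
  unfold dx
  have h : Measurable fun p : ℤ × ℝ => (waveNumber L p.1 : ℂ) :=
    (measurable_of_countable fun n : ℤ => (waveNumber L n : ℂ)).comp measurable_fst
  fun_prop

theorem enorm_conv_le (G F : ℤ × ℝ → ℂ) (p : ℤ × ℝ) :
    ‖conv G F p‖ₑ ≤ ∫⁻ q, ‖G (p - q)‖ₑ * ‖F q‖ₑ ∂freqMeasure := by
  refine (enorm_integral_le_lintegral_enorm _).trans (le_of_eq ?_)
  simp only [enorm_mul]

theorem ofReal_bracket_mul_eq {φ : ℤ → ℝ} {s b : ℝ} (F : ℤ × ℝ → ℂ) (p : ℤ × ℝ) :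
    ENNReal.ofReal (bracket (p.1 : ℝ) ^ s) * ‖F p‖ₑ =
      modW φ b p * (ENNReal.ofReal (wt φ 1 s b p) * ‖F p‖ₑ) := by
  have h1 := bracket_pos (p.1 : ℝ)
  have h2 := bracket_pos (modulation φ p)
  rw [← mul_assoc, modW, ← ENNReal.ofReal_mul (by positivity), wt, ← mul_assoc]
  change _ = ENNReal.ofReal (bracket (modulation φ p) ^ (-b) * bracket (modulation φ p) ^ b * _) * _
  rw [← Real.rpow_add h2, neg_add_cancel, Real.rpow_zero, one_mul]

theorem ofReal_wt_one_eq {φ : ℤ → ℝ} {s e : ℝ} (p : ℤ × ℝ) :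
    ENNReal.ofReal (wt φ 1 s (-e) p) = modW φ e p * ENNReal.ofReal (bracket (p.1 : ℝ) ^ s) := by
  have h2 := bracket_pos (modulation φ p)
  rw [wt, ENNReal.ofReal_mul (by positivity)]
  rfl

/-- The time frequencies cancel in this alternating sum, leaving the resonance function of the
spatial frequencies. -/
theorem modulation_relation (L γ : ℝ) (p q : ℤ × ℝ) :
    modulation (phiY L γ) (p - q) - modulation (phiX L) p + modulation (phiX L) q =
      phiY L γ (p.1 - q.1) - phiX L p.1 + phiX L q.1 := by
  simp only [modulation, Prod.fst_sub, Prod.snd_sub]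
  ring

/-- The bilinear estimate for the product `v u`. -/
theorem nsq_conv_le (L : ℝ) [Fact (0 < L)] {γ s b : ℝ} (hγ : |γ| ≠ 1) (hs : 1 / 2 ≤ s)
    (hb : 1 / 2 < b) :
    ∃ C : ℝ≥0∞, C ≠ ⊤ ∧ ∀ G F : ℤ × ℝ → ℂ, Measurable G → Measurable F →
      nsq (phiX L) 1 s (-(3 / 8)) (conv G F) ≤
        C * (nsq (phiY L γ) 1 (s - 1 / 2) b G * nsq (phiX L) 1 s b F) := by
  obtain ⟨C₁, hC₁, h₁⟩ := weight_bounds L hγ hs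
  obtain ⟨C₂, hC₂, h₂⟩ := trilinear_estimate L hγ hb
  refine ⟨ENNReal.ofReal C₁ ^ 2 * C₂, by finiteness, fun G F hG hF => ?_⟩
  set g : ℤ × ℝ → ℝ≥0∞ := fun p => ENNReal.ofReal (wt (phiY L γ) 1 (s - 1 / 2) b p) * ‖G p‖ₑ
  set f : ℤ × ℝ → ℝ≥0∞ := fun p => ENNReal.ofReal (wt (phiX L) 1 s b p) * ‖F p‖ₑ
  have hg : Measurable g := (measurable_wt _ _ _ _).ennreal_ofReal.mul hG.enorm
  have hf : Measurable f := (measurable_wt _ _ _ _).ennreal_ofReal.mul hF.enorm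
  have hI : Measurable fun p => ∫⁻ q, ‖G (p - q)‖ₑ * ‖F q‖ₑ ∂freqMeasure :=
    Measurable.lintegral_prod_right' (f := fun z : (ℤ × ℝ) × (ℤ × ℝ) =>
      ‖G (z.1 - z.2)‖ₑ * ‖F z.2‖ₑ) (by fun_prop)
  have hw := (measurable_wt (phiX L) 1 s (-(3 / 8))).ennreal_ofReal
  set A : ℤ × ℝ → ℝ≥0∞ := fun p => ENNReal.ofReal (wt (phiX L) 1 s (-(3 / 8)) p) *
    ∫⁻ q, ‖G (p - q)‖ₑ * ‖F q‖ₑ ∂freqMeasure with hA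
  have h3 : nsq (phiX L) 1 s (-(3 / 8)) (conv G F) ≤ ∫⁻ p, A p ^ 2 ∂freqMeasure := by
    unfold nsq
    gcongr with p
    simp only [hA]
    gcongr
    exact enorm_conv_le G F p
  have hAm : Measurable A := hw.mul hI
  refine h3.trans (lintegral_sq_le_of_forall_pairing _ hAm _ fun h hh => ?_)
  -- The test function takes the slot of the output frequency p, with exponent 3/8; the two inputs
  -- keep exponent b.
  have h4 := h₂ b (3 / 8) b (by linarith) le_rfl (by linarith)
    (Or.inr (Or.inl ⟨le_rfl, le_rfl⟩)) g h f hg hh hf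
  have h5 : ∫⁻ p, h p * A p ∂freqMeasure ≤ ENNReal.ofReal C₁ *
      ∫⁻ p, ∫⁻ q, ENNReal.ofReal (quarterSum (modulation (phiY L γ) (p - q))
          (modulation (phiX L) p) (modulation (phiX L) q)) *
        (modW (phiY L γ) b (p - q) * modW (phiX L) (3 / 8) p * modW (phiX L) b q) *
        (g (p - q) * h p * f q) ∂freqMeasure ∂freqMeasure := by
    rw [← lintegral_const_mul' _ _ ENNReal.ofReal_ne_top]
    refine lintegral_mono fun p => ?_
    simp only [hA]
    rw [← mul_assoc, ← lintegral_const_mul _ (by fun_prop),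
      ← lintegral_const_mul' _ _ ENNReal.ofReal_ne_top]
    refine lintegral_mono fun q => ?_
    have hS := one_le_quarterSum (modulation (phiY L γ) (p - q)) (modulation (phiX L) p)
      (modulation (phiX L) q)
    have h6 := ENNReal.ofReal_le_ofReal (h₁ p.1 q.1 _ _ _ (modulation_relation L γ p q)).1
    have b0 := bracket_pos ((p.1 - q.1 : ℤ) : ℝ)
    have b1 := bracket_pos (q.1 : ℝ)
    rw [ENNReal.ofReal_mul (by positivity), ENNReal.ofReal_mul hC₁,
      ENNReal.ofReal_mul (by positivity)] at h6
    rw [ofReal_wt_one_eq]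
    calc _ ≤ h p * (modW (phiX L) (3 / 8) p * (ENNReal.ofReal C₁ *
          ENNReal.ofReal (quarterSum (modulation (phiY L γ) (p - q))
          (modulation (phiX L) p) (modulation (phiX L) q)) *
          (ENNReal.ofReal (bracket ((p.1 - q.1 : ℤ) : ℝ) ^ (s - 1 / 2)) *
            ENNReal.ofReal (bracket (q.1 : ℝ) ^ s)))) * (‖G (p - q)‖ₑ * ‖F q‖ₑ) := by gcongr
      _ = h p * modW (phiX L) (3 / 8) p * ENNReal.ofReal C₁ *
          ENNReal.ofReal (quarterSum (modulation (phiY L γ) (p - q))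
          (modulation (phiX L) p) (modulation (phiX L) q)) *
          (ENNReal.ofReal (bracket (((p - q).1 : ℤ) : ℝ) ^ (s - 1 / 2)) * ‖G (p - q)‖ₑ) *
            (ENNReal.ofReal (bracket (q.1 : ℝ) ^ s) * ‖F q‖ₑ) := by
          rw [Prod.fst_sub]
          ring
      _ = _ := by
          rw [ofReal_bracket_mul_eq (φ := phiY L γ) (b := b) G,
            ofReal_bracket_mul_eq (φ := phiX L) (b := b) F]
          ring
  refine (pow_le_pow_left' h5 2).trans ?_
  rw [mul_pow]
  refine (mul_le_mul_right h4 _).trans (le_of_eq ?_)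
  unfold nsq
  ring

/-- The bilinear estimate for `(u w̄)ₓ`. -/
theorem nsq_dx_conv_cnj_le (L : ℝ) [Fact (0 < L)] {γ s b : ℝ} (hγ : |γ| ≠ 1) (hs : 1 / 2 ≤ s)
    (hb : 1 / 2 < b) :
    ∃ C : ℝ≥0∞, C ≠ ⊤ ∧ ∀ F F' : ℤ × ℝ → ℂ, Measurable F → Measurable F' →
      nsq (phiY L γ) 1 (s - 1 / 2) (-(3 / 8)) (dx L (conv (cnj F') F)) ≤
        C * (nsq (phiX L) 1 s b F * nsq (phiX L) 1 s b F') := by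
  obtain ⟨C₁, hC₁, h₁⟩ := weight_bounds L hγ hs
  obtain ⟨C₂, hC₂, h₂⟩ := trilinear_estimate L hγ hb
  refine ⟨ENNReal.ofReal C₁ ^ 2 * C₂, by finiteness, fun F F' hF hF' => ?_⟩
  set f : ℤ × ℝ → ℝ≥0∞ := fun p => ENNReal.ofReal (wt (phiX L) 1 s b p) * ‖F p‖ₑ
  set f' : ℤ × ℝ → ℝ≥0∞ := fun p => ENNReal.ofReal (wt (phiX L) 1 s b p) * ‖F' p‖ₑ
  have hf : Measurable f := (measurable_wt _ _ _ _).ennreal_ofReal.mul hF.enorm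
  have hf' : Measurable f' := (measurable_wt _ _ _ _).ennreal_ofReal.mul hF'.enorm
  have hI : Measurable fun r => ∫⁻ p, ‖F' (p - r)‖ₑ * ‖F p‖ₑ ∂freqMeasure :=
    Measurable.lintegral_prod_right' (f := fun z : (ℤ × ℝ) × (ℤ × ℝ) =>
      ‖F' (z.2 - z.1)‖ₑ * ‖F z.2‖ₑ) (by fun_prop)
  have hw := (measurable_wt (phiY L γ) 1 (s - 1 / 2) (-(3 / 8))).ennreal_ofReal
  have hk : Measurable fun r : ℤ × ℝ => ENNReal.ofReal |waveNumber L r.1| :=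
    (measurable_of_countable fun n : ℤ => ENNReal.ofReal |waveNumber L n|).comp measurable_fst
  set A : ℤ × ℝ → ℝ≥0∞ := fun r => ENNReal.ofReal (wt (phiY L γ) 1 (s - 1 / 2) (-(3 / 8)) r) *
    (ENNReal.ofReal |waveNumber L r.1| * ∫⁻ p, ‖F' (p - r)‖ₑ * ‖F p‖ₑ ∂freqMeasure) with hA
  have h3 : nsq (phiY L γ) 1 (s - 1 / 2) (-(3 / 8)) (dx L (conv (cnj F') F)) ≤
      ∫⁻ p, A p ^ 2 ∂freqMeasure := by
    unfold nsq
    gcongr with r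
    simp only [hA]
    gcongr
    rw [dx, enorm_mul, enorm_mul]
    have e1 : ‖Complex.I‖ₑ * ‖(waveNumber L r.1 : ℂ)‖ₑ = ENNReal.ofReal |waveNumber L r.1| := by
      rw [← ofReal_norm, ← ofReal_norm, Complex.norm_I, Complex.norm_real]
      simp
    rw [e1]
    gcongr
    refine (enorm_conv_le _ F r).trans (le_of_eq (lintegral_congr fun p => ?_))
    rw [cnj, neg_sub]
    congr 1
    simp [← ofReal_norm]
  have hAm : Measurable A := hw.mul (hk.mul hI)
  refine h3.trans (lintegral_sq_le_of_forall_pairing _ hAm _ fun h hh => ?_)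
  -- Now the output is the Benjamin–Ono slot p - q, so the exponent 3/8 goes there and both
  -- Schrödinger slots carry b.
  have h4 := h₂ (3 / 8) b b le_rfl (by linarith) (by linarith)
    (Or.inr (Or.inr ⟨le_rfl, le_rfl⟩)) h f f' hh hf hf'
  have h5 : ∫⁻ r, h r * A r ∂freqMeasure ≤ ENNReal.ofReal C₁ *
      ∫⁻ p, ∫⁻ q, ENNReal.ofReal (quarterSum (modulation (phiY L γ) (p - q))
          (modulation (phiX L) p) (modulation (phiX L) q)) *
        (modW (phiY L γ) (3 / 8) (p - q) * modW (phiX L) b p * modW (phiX L) b q) *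
        (h (p - q) * f p * f' q) ∂freqMeasure ∂freqMeasure := by
    have h6 : ∫⁻ r, h r * A r ∂freqMeasure = ∫⁻ p, ∫⁻ q, h (p - q) *
        (ENNReal.ofReal (wt (phiY L γ) 1 (s - 1 / 2) (-(3 / 8)) (p - q)) *
        ENNReal.ofReal |waveNumber L (p - q).1|) * (‖F' q‖ₑ * ‖F p‖ₑ) ∂freqMeasure ∂freqMeasure := by
      refine Eq.trans ?_ (lintegral_mul_correlation freqMeasure (hh.mul (hw.mul hk)) hF'.enorm
        hF.enorm)
      refine lintegral_congr fun r => ?_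
      simp only [hA, Pi.mul_apply]
      ring
    rw [h6, ← lintegral_const_mul' _ _ ENNReal.ofReal_ne_top]
    refine lintegral_mono fun p => ?_
    rw [← lintegral_const_mul' _ _ ENNReal.ofReal_ne_top]
    refine lintegral_mono fun q => ?_
    have hS := one_le_quarterSum (modulation (phiY L γ) (p - q)) (modulation (phiX L) p)
      (modulation (phiX L) q)
    have h6 := ENNReal.ofReal_le_ofReal (h₁ p.1 q.1 _ _ _ (modulation_relation L γ p q)).2
    have b0 := bracket_pos (p.1 : ℝ)
    have b1 := bracket_pos (q.1 : ℝ)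
    rw [ENNReal.ofReal_mul (by positivity), ENNReal.ofReal_mul (by positivity),
      ENNReal.ofReal_mul hC₁, ENNReal.ofReal_mul (by positivity)] at h6
    rw [ofReal_wt_one_eq]
    calc _ = h (p - q) * modW (phiY L γ) (3 / 8) (p - q) *
          (ENNReal.ofReal |waveNumber L (p.1 - q.1)| *
            ENNReal.ofReal (bracket ((p.1 - q.1 : ℤ) : ℝ) ^ (s - 1 / 2))) *
            (‖F' q‖ₑ * ‖F p‖ₑ) := by
          rw [Prod.fst_sub]
          ring
      _ ≤ _ := mul_le_mul_left (mul_le_mul_right h6 _) _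
      _ = h (p - q) * modW (phiY L γ) (3 / 8) (p - q) * ENNReal.ofReal C₁ *
          ENNReal.ofReal (quarterSum (modulation (phiY L γ) (p - q))
          (modulation (phiX L) p) (modulation (phiX L) q)) *
          (ENNReal.ofReal (bracket (p.1 : ℝ) ^ s) * ‖F p‖ₑ) *
            (ENNReal.ofReal (bracket (q.1 : ℝ) ^ s) * ‖F' q‖ₑ) := by ring
      _ = _ := by
          rw [ofReal_bracket_mul_eq (φ := phiX L) (b := b) F,
            ofReal_bracket_mul_eq (φ := phiX L) (b := b) F']
          ring
  refine (pow_le_pow_left' h5 2).trans ?_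
  rw [mul_pow]
  refine (mul_le_mul_right h4 _).trans (le_of_eq ?_)
  unfold nsq
  ring

/-! ### From frequency functions to functions of time -/

/-- The character `e^{2πi ξ t}`. -/
def echar (ξ t : ℝ) : ℂ := Complex.exp (2 * Real.pi * ξ * t * Complex.I)

theorem norm_echar (ξ t : ℝ) : ‖echar ξ t‖ = 1 := by
  rw [echar, show (2 * Real.pi * ξ * t * Complex.I : ℂ) = ((2 * Real.pi * ξ * t : ℝ) : ℂ) * Complex.I
    by push_cast; ring]
  exact Complex.norm_exp_ofReal_mul_I _

theorem enorm_echar (ξ t : ℝ) : ‖echar ξ t‖ₑ = 1 := by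
  rw [← ofReal_norm, norm_echar, ENNReal.ofReal_one]

theorem continuous_echar_left (t : ℝ) : Continuous fun ξ => echar ξ t := by
  unfold echar
  fun_prop

theorem continuous_echar_right (ξ : ℝ) : Continuous fun t => echar ξ t := by
  unfold echar
  fun_prop

theorem measurable_echar (t : ℝ) : Measurable fun ξ => echar ξ t :=
  (continuous_echar_left t).measurable

theorem echar_add_left (ξ η t : ℝ) : echar (ξ + η) t = echar ξ t * echar η t := by
  rw [echar, echar, echar, ← Complex.exp_add]
  push_cast
  ring_nf

theorem echar_add_right (ξ t t' : ℝ) : echar ξ (t + t') = echar ξ t * echar ξ t' := by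
  rw [echar, echar, echar, ← Complex.exp_add]
  push_cast
  ring_nf

theorem conj_echar (ξ t : ℝ) : starRingEnd ℂ (echar ξ t) = echar (-ξ) t := by
  rw [echar, echar, ← Complex.exp_conj]
  simp [Complex.conj_ofNat]

theorem fourierInv_eq_echar (f : ℝ → ℂ) (t : ℝ) : 𝓕⁻ f t = ∫ ξ, echar ξ t * f ξ := by
  rw [Real.fourierInv_eq']
  refine integral_congr_ae (Filter.Eventually.of_forall fun ξ => ?_)
  simp only [echar, smul_eq_mul]
  congr 2
  simp
  ring

/-- The function of time and spatial frequency with space-time Fourier transform `F`. -/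
def hat (F : ℤ × ℝ → ℂ) (t : ℝ) (n : ℤ) : ℂ := ∫ ξ, echar ξ t * F (n, ξ)

/-- The `L¹` norm in the time frequency. -/
def l1 (F : ℤ × ℝ → ℂ) (n : ℤ) : ℝ≥0∞ := ∫⁻ ξ, ‖F (n, ξ)‖ₑ

/-- Measurable frequency functions in `ℓ²ₙ L¹_ξ`. -/
structure IsWiener (F : ℤ × ℝ → ℂ) : Prop where
  measurable : Measurable F
  summable : ∑' n, l1 F n ^ 2 ≠ ⊤

/-- Measurable frequency functions whose slices are integrable. -/
structure IsSliceIntegrable (F : ℤ × ℝ → ℂ) : Prop where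
  measurable : Measurable F
  integrable : ∀ n, Integrable fun ξ => F (n, ξ)

theorem measurable_slice {F : ℤ × ℝ → ℂ} (hF : Measurable F) (n : ℤ) :
    Measurable fun ξ => F (n, ξ) := hF.comp (by fun_prop)

theorem IsWiener.l1_ne_top {F : ℤ × ℝ → ℂ} (hF : IsWiener F) (n : ℤ) : l1 F n ≠ ⊤ := by
  have h := ENNReal.ne_top_of_tsum_ne_top hF.summable n
  contrapose! h
  simp [h]

theorem isSliceIntegrable_of_l1 {F : ℤ × ℝ → ℂ} (hF : Measurable F) (h : ∀ n, l1 F n ≠ ⊤) :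
    IsSliceIntegrable F :=
  ⟨hF, fun n => ⟨(measurable_slice hF n).aestronglyMeasurable, (h n).lt_top⟩⟩

theorem IsWiener.isSliceIntegrable {F : ℤ × ℝ → ℂ} (hF : IsWiener F) : IsSliceIntegrable F :=
  isSliceIntegrable_of_l1 hF.measurable hF.l1_ne_top

theorem IsSliceIntegrable.integrable_echar {F : ℤ × ℝ → ℂ} (hF : IsSliceIntegrable F) (t : ℝ)
    (n : ℤ) : Integrable fun ξ => echar ξ t * F (n, ξ) :=
  (hF.integrable n).bdd_mul (c := 1) (measurable_echar t).aestronglyMeasurable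
    (Filter.Eventually.of_forall fun ξ => (norm_echar ξ t).le)

theorem IsSliceIntegrable.smul {F : ℤ × ℝ → ℂ} (hF : IsSliceIntegrable F) (c : ℂ) :
    IsSliceIntegrable (c • F) :=
  ⟨hF.measurable.const_smul c, fun n => (hF.integrable n).const_mul c⟩

theorem IsSliceIntegrable.dx {F : ℤ × ℝ → ℂ} (hF : IsSliceIntegrable F) (L : ℝ) :
    IsSliceIntegrable (dx L F) :=
  ⟨measurable_dx L hF.measurable, fun n =>
    (hF.integrable n).const_mul (Complex.I * waveNumber L n)⟩

theorem hat_add {F G : ℤ × ℝ → ℂ} (hF : IsSliceIntegrable F) (hG : IsSliceIntegrable G) (t : ℝ)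
    (n : ℤ) : hat (F + G) t n = hat F t n + hat G t n := by
  rw [hat, hat, hat, ← integral_add (hF.integrable_echar t n) (hG.integrable_echar t n)]
  simp only [Pi.add_apply, mul_add]

theorem hat_smul (c : ℂ) (F : ℤ × ℝ → ℂ) (t : ℝ) (n : ℤ) : hat (c • F) t n = c * hat F t n := by
  rw [hat, hat, ← integral_const_mul]
  congr 1
  funext ξ
  simp only [Pi.smul_apply, smul_eq_mul]
  ring

theorem hat_dx (L : ℝ) (F : ℤ × ℝ → ℂ) (t : ℝ) (n : ℤ) :
    hat (dx L F) t n = Complex.I * waveNumber L n * hat F t n := by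
  rw [hat, hat, ← integral_const_mul]
  congr 1
  funext ξ
  simp only [dx]
  ring

theorem hat_cnj (F : ℤ × ℝ → ℂ) (t : ℝ) (n : ℤ) :
    hat (cnj F) t n = starRingEnd ℂ (hat F t (-n)) := by
  rw [hat, hat, ← integral_conj, ← integral_neg_eq_self]
  congr 1
  funext ξ
  simp [cnj, conj_echar]

theorem enorm_hat_le (F : ℤ × ℝ → ℂ) (t : ℝ) (n : ℤ) : ‖hat F t n‖ₑ ≤ l1 F n := by
  refine (enorm_integral_le_lintegral_enorm _).trans (le_of_eq ?_)
  simp only [enorm_mul, enorm_echar, one_mul, l1]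

theorem IsSliceIntegrable.continuous_hat {F : ℤ × ℝ → ℂ} (hF : IsSliceIntegrable F) (n : ℤ) :
    Continuous fun t => hat F t n := by
  refine continuous_of_dominated (bound := fun ξ => ‖F (n, ξ)‖)
    (fun t => (hF.integrable_echar t n).aestronglyMeasurable) ?_ (hF.integrable n).norm ?_
  · intro t
    refine Filter.Eventually.of_forall fun ξ => ?_
    rw [norm_mul, norm_echar, one_mul]
  · exact Filter.Eventually.of_forall fun ξ => (continuous_echar_right ξ).mul continuous_const

/-- The frequency function of a translate in time. -/
def shift (t₀ : ℝ) (F : ℤ × ℝ → ℂ) (p : ℤ × ℝ) : ℂ := echar p.2 t₀ * F p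

theorem measurable_shift (t₀ : ℝ) {F : ℤ × ℝ → ℂ} (hF : Measurable F) :
    Measurable (shift t₀ F) := by
  unfold shift
  exact ((measurable_echar t₀).comp measurable_snd).mul hF

theorem hat_shift (t₀ : ℝ) (F : ℤ × ℝ → ℂ) (t : ℝ) (n : ℤ) :
    hat (shift t₀ F) t n = hat F (t₀ + t) n := by
  rw [hat, hat]
  congr 1
  funext ξ
  rw [shift, echar_add_right]
  ring

theorem nsq_shift (t₀ : ℝ) (φ : ℤ → ℝ) (Λ s b : ℝ) (F : ℤ × ℝ → ℂ) :
    nsq φ Λ s b (shift t₀ F) = nsq φ Λ s b F := by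
  simp only [nsq, shift, enorm_mul, enorm_echar, one_mul]

theorem l1_cnj (F : ℤ × ℝ → ℂ) (n : ℤ) : l1 (cnj F) n = l1 F (-n) := by
  rw [l1, l1, ← lintegral_neg_eq_self]
  congr 1
  funext ξ
  simp [cnj, ← ofReal_norm]

theorem IsWiener.cnj {F : ℤ × ℝ → ℂ} (hF : IsWiener F) : IsWiener (cnj F) := by
  refine ⟨measurable_cnj hF.measurable, ?_⟩
  simp only [l1_cnj]
  exact ((Equiv.neg ℤ).tsum_eq (fun n => l1 F n ^ 2)).trans_ne hF.summable

theorem l1_shift (t₀ : ℝ) (F : ℤ × ℝ → ℂ) (n : ℤ) : l1 (shift t₀ F) n = l1 F n := by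
  simp only [l1, shift, enorm_mul, enorm_echar, one_mul]

theorem IsWiener.shift {F : ℤ × ℝ → ℂ} (hF : IsWiener F) (t₀ : ℝ) : IsWiener (shift t₀ F) :=
  ⟨measurable_shift t₀ hF.measurable, by simpa only [l1_shift] using hF.summable⟩

/-! ### Convolution -/

theorem sq_tsum_mul_le (a b : ℤ → ℝ≥0∞) :
    (∑' m, a m * b m) ^ 2 ≤ (∑' m, a m ^ 2) * ∑' m, b m ^ 2 := by
  simp only [← lintegral_count]
  exact sq_lintegral_mul_le _ (measurable_of_countable a).aemeasurable
    (measurable_of_countable b).aemeasurable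

theorem tsum_l1_mul_l1_ne_top {G F : ℤ × ℝ → ℂ} (hG : IsWiener G) (hF : IsWiener F) (n : ℤ) :
    ∑' m, l1 F m * l1 G (n - m) ≠ ⊤ := by
  have h := sq_tsum_mul_le (l1 F) fun m => l1 G (n - m)
  have h1 : ∑' m, l1 G (n - m) ^ 2 = ∑' m, l1 G m ^ 2 :=
    (Equiv.subLeft n).tsum_eq (fun m => l1 G m ^ 2)
  rw [h1] at h
  have h2 := h.trans_lt (ENNReal.mul_lt_top hF.summable.lt_top hG.summable.lt_top)
  contrapose! h2
  simp [h2]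

/-- By Tonelli and translation invariance, integrating in the output time frequency first separates
the L¹ norms of the slices. -/
theorem lintegral_lintegral_conv {G F : ℤ × ℝ → ℂ} (hG : IsWiener G) (hF : IsWiener F) (n : ℤ) :
    ∫⁻ ξ, ∫⁻ q, ‖G ((n, ξ) - q)‖ₑ * ‖F q‖ₑ ∂freqMeasure = ∑' m, l1 F m * l1 G (n - m) := by
  have mG := hG.measurable
  have mF := hF.measurable
  have hm : Measurable fun z : ℝ × (ℤ × ℝ) => ‖G ((n, z.1) - z.2)‖ₑ * ‖F z.2‖ₑ := by fun_prop
  rw [lintegral_lintegral_swap (by exact hm.aemeasurable)]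
  have h : ∀ q : ℤ × ℝ, ∫⁻ ξ, ‖G ((n, ξ) - q)‖ₑ * ‖F q‖ₑ = l1 G (n - q.1) * ‖F q‖ₑ := by
    intro q
    rw [lintegral_mul_const _ (by fun_prop), l1,
      ← lintegral_sub_right_eq_self (fun ξ => ‖G (n - q.1, ξ)‖ₑ) q.2]
    rfl
  simp_rw [h]
  have hm2 : Measurable fun q : ℤ × ℝ => l1 G (n - q.1) * ‖F q‖ₑ :=
    ((measurable_of_countable fun m => l1 G (n - m)).comp measurable_fst).mul mF.enorm
  rw [lintegral_freqMeasure hm2]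
  refine tsum_congr fun m => ?_
  rw [mul_comm]
  exact lintegral_const_mul (l1 G (n - m)) (measurable_slice mF m).enorm

theorem isSliceIntegrable_conv {G F : ℤ × ℝ → ℂ} (hG : IsWiener G) (hF : IsWiener F) :
    IsSliceIntegrable (conv G F) := by
  refine isSliceIntegrable_of_l1 (measurable_conv hG.measurable hF.measurable) fun n => ?_
  refine ((lintegral_mono fun ξ => enorm_conv_le G F (n, ξ)).trans_lt ?_).ne
  rw [lintegral_lintegral_conv hG hF]
  exact (tsum_l1_mul_l1_ne_top hG hF n).lt_top

/-- Convolution in frequency is the product in space-time. -/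
theorem hat_conv {G F : ℤ × ℝ → ℂ} (hG : IsWiener G) (hF : IsWiener F) (t : ℝ) (n : ℤ) :
    hat (conv G F) t n = ∑' m, hat F t m * hat G t (n - m) := by
  have mG := hG.measurable
  have mF := hF.measurable
  have me := measurable_echar t
  have hm : Measurable fun z : ℝ × (ℤ × ℝ) => echar z.1 t * (G ((n, z.1) - z.2) * F z.2) := by
    fun_prop
  have hint : Integrable (fun z : ℝ × (ℤ × ℝ) => echar z.1 t * (G ((n, z.1) - z.2) * F z.2))
      (volume.prod freqMeasure) := by
    refine ⟨hm.aestronglyMeasurable, ?_⟩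
    rw [HasFiniteIntegral, lintegral_prod _ hm.enorm.aemeasurable]
    simp only [enorm_mul, enorm_echar, one_mul]
    rw [lintegral_lintegral_conv hG hF]
    exact (tsum_l1_mul_l1_ne_top hG hF n).lt_top
  have h1 : hat (conv G F) t n =
      ∫ ξ, ∫ q, echar ξ t * (G ((n, ξ) - q) * F q) ∂freqMeasure := by
    rw [hat]
    congr 1
    funext ξ
    rw [conv, ← integral_const_mul]
  rw [h1, integral_integral_swap (by exact hint)]
  have h2 : ∀ q : ℤ × ℝ, ∫ ξ, echar ξ t * (G ((n, ξ) - q) * F q) =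
      hat G t (n - q.1) * (echar q.2 t * F q) := by
    intro q
    rw [hat, ← integral_sub_right_eq_self (fun ξ => echar ξ t * G (n - q.1, ξ)) q.2,
      ← integral_mul_const]
    congr 1
    funext ξ
    have h3 : echar ξ t = echar (ξ - q.2) t * echar q.2 t := by
      rw [← echar_add_left, sub_add_cancel]
    rw [h3, show ((n, ξ) : ℤ × ℝ) - q = (n - q.1, ξ - q.2) from rfl]
    ring
  have hint2 := hint.integral_prod_right
  simp only [h2] at hint2 ⊢
  rw [integral_prod _ hint2, integral_countable hint2.integral_prod_left]
  refine tsum_congr fun m => ?_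
  simp only [Measure.real, Measure.count_singleton, ENNReal.toReal_one, one_smul]
  rw [integral_const_mul, mul_comm]
  rfl

/-! ### Bounds by the Bourgain norms -/

theorem wt_le_wt {φ : ℤ → ℝ} {Λ s b : ℝ} (hΛ : 1 ≤ Λ) (hb : 0 ≤ b) (p : ℤ × ℝ) :
    wt φ 1 s b p ≤ wt φ Λ s b p := by
  have h1 := bracket_pos (p.1 : ℝ)
  have := abs_nonneg (modulation φ p)
  unfold wt
  gcongr

theorem nsq_one_le {φ : ℤ → ℝ} {Λ s b : ℝ} (hΛ : 1 ≤ Λ) (hb : 0 ≤ b) (F : ℤ × ℝ → ℂ) :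
    nsq φ 1 s b F ≤ nsq φ Λ s b F := by
  unfold nsq
  gcongr with p
  exact wt_le_wt hΛ hb p

/-- The constant in the embedding of `X^{s,b}` in `C(ℝ; H^s)`. -/
def embC (b : ℝ) : ℝ≥0∞ := ∫⁻ ξ : ℝ, ENNReal.ofReal (bracket (2 * Real.pi * ξ) ^ (-(2 * b)))

theorem embC_ne_top {b : ℝ} (hb : 1 / 2 < b) : embC b ≠ ⊤ :=
  lintegral_bracket_rpow_ne_top (by linarith)

/-- Cauchy–Schwarz in ξ against ⟨σ⟩^{-b}. A translation shows that the L² norm of this factor does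
not depend on n. Together with b > 1/2, which makes `embC b` finite, this is the embedding of the
Bourgain space in continuous curves. -/
theorem sq_l1_le {φ : ℤ → ℝ} {s b : ℝ} {F : ℤ × ℝ → ℂ} (hF : Measurable F) (n : ℤ) :
    (ENNReal.ofReal (bracket n ^ s) * l1 F n) ^ 2 ≤
      embC b * ∫⁻ ξ, (ENNReal.ofReal (wt φ 1 s b (n, ξ)) * ‖F (n, ξ)‖ₑ) ^ 2 := by
  have mF := measurable_slice hF n
  have mw : Measurable fun ξ => ENNReal.ofReal (wt φ 1 s b (n, ξ)) :=
    (measurable_wt φ 1 s b).ennreal_ofReal.comp (by fun_prop : Measurable fun ξ : ℝ => (n, ξ))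
  have mm : Measurable fun ξ => modW φ b (n, ξ) :=
    (measurable_modW φ b).comp (by fun_prop : Measurable fun ξ : ℝ => (n, ξ))
  have h1 : ENNReal.ofReal (bracket n ^ s) * l1 F n =
      ∫⁻ ξ, modW φ b (n, ξ) * (ENNReal.ofReal (wt φ 1 s b (n, ξ)) * ‖F (n, ξ)‖ₑ) := by
    rw [l1, ← lintegral_const_mul _ mF.enorm]
    refine lintegral_congr fun ξ => ?_
    rw [← ofReal_bracket_mul_eq]
  rw [h1]
  refine (sq_lintegral_mul_le _ mm.aemeasurable (mw.mul mF.enorm).aemeasurable).trans (le_of_eq ?_)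
  congr 1
  rw [embC, ← lintegral_add_right_eq_self
    (fun ξ => ENNReal.ofReal (bracket (2 * Real.pi * ξ) ^ (-(2 * b)))) (φ n / (2 * Real.pi))]
  refine lintegral_congr fun ξ => ?_
  rw [modW, bracket_rpow_sq, modulation]
  congr 3
  have := Real.pi_pos
  field_simp

theorem tsum_sq_l1_le {φ : ℤ → ℝ} {s b : ℝ} {F : ℤ × ℝ → ℂ} (hF : Measurable F) :
    ∑' n : ℤ, (ENNReal.ofReal (bracket n ^ s) * l1 F n) ^ 2 ≤ embC b * nsq φ 1 s b F := by
  have mw := (measurable_wt φ 1 s b).ennreal_ofReal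
  rw [nsq, lintegral_freqMeasure (by fun_prop), ← ENNReal.tsum_mul_left]
  exact ENNReal.tsum_le_tsum fun n => sq_l1_le hF n

theorem isWiener_of_nsq {φ : ℤ → ℝ} {s b : ℝ} (hs : 0 ≤ s) (hb : 1 / 2 < b) {F : ℤ × ℝ → ℂ}
    (hF : Measurable F) (h : nsq φ 1 s b F ≠ ⊤) : IsWiener F := by
  refine ⟨hF, ?_⟩
  have h1 := tsum_sq_l1_le (φ := φ) (s := s) (b := b) hF
  have h2 : ∑' n, l1 F n ^ 2 ≤ ∑' n : ℤ, (ENNReal.ofReal (bracket n ^ s) * l1 F n) ^ 2 := by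
    refine ENNReal.tsum_le_tsum fun n => ?_
    gcongr
    refine le_mul_of_one_le_left' ?_
    rw [ENNReal.one_le_ofReal]
    exact Real.one_le_rpow (one_le_bracket _) hs
  exact ((h2.trans h1).trans_lt (ENNReal.mul_lt_top (embC_ne_top hb).lt_top h.lt_top)).ne

theorem add_sq_le_two_mul (x y : ℝ≥0∞) : (x + y) ^ 2 ≤ 2 * (x ^ 2 + y ^ 2) := by
  have h := ENNReal.rpow_add_le_mul_rpow_add_rpow x y (p := 2) (by norm_num)
  simp only [ENNReal.rpow_two] at h
  refine h.trans (le_of_eq ?_)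
  norm_num

theorem nsq_add_le (φ : ℤ → ℝ) (Λ s b : ℝ) {F G : ℤ × ℝ → ℂ} (hF : Measurable F) :
    nsq φ Λ s b (F + G) ≤ 2 * (nsq φ Λ s b F + nsq φ Λ s b G) := by
  have mw := (measurable_wt φ Λ s b).ennreal_ofReal
  unfold nsq
  rw [← lintegral_add_left (by fun_prop), ← lintegral_const_mul' _ _ (by simp)]
  refine lintegral_mono fun p => ?_
  have h1 : ENNReal.ofReal (wt φ Λ s b p) * ‖(F + G) p‖ₑ ≤
      ENNReal.ofReal (wt φ Λ s b p) * ‖F p‖ₑ + ENNReal.ofReal (wt φ Λ s b p) * ‖G p‖ₑ := by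
    rw [← mul_add]
    gcongr
    exact enorm_add_le _ _
  refine (pow_le_pow_left' h1 2).trans ?_
  exact add_sq_le_two_mul _ _

theorem nsq_smul (φ : ℤ → ℝ) (Λ s b : ℝ) (c : ℂ) (F : ℤ × ℝ → ℂ) :
    nsq φ Λ s b (c • F) = ‖c‖ₑ ^ 2 * nsq φ Λ s b F := by
  unfold nsq
  rw [← lintegral_const_mul' _ _ (by simp)]
  refine lintegral_congr fun p => ?_
  simp only [Pi.smul_apply, smul_eq_mul, enorm_mul]
  ring

/-! ### The Duhamel operator: a bound for its kernel -/

/-- Young's inequality `L¹ * L² ⊆ L²`. -/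
theorem lintegral_sq_convolution_le {m u : ℝ → ℝ≥0∞} (hm : Measurable m) (hu : Measurable u) :
    ∫⁻ x', (∫⁻ x, m (x' - x) * u x) ^ 2 ≤ (∫⁻ x, m x) ^ 2 * ∫⁻ x, u x ^ 2 := by
  have h1 : ∀ x', (∫⁻ x, m (x' - x) * u x) ^ 2 ≤ (∫⁻ x, m x) * ∫⁻ x, m (x' - x) * u x ^ 2 := by
    intro x'
    have hsq : ∀ y : ℝ≥0∞, y ^ (1 / 2 : ℝ) * y ^ (1 / 2 : ℝ) = y := by
      intro y
      rw [← ENNReal.rpow_add_of_nonneg _ _ (by norm_num) (by norm_num)]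
      norm_num
    have h2 := sq_lintegral_mul_le volume (f := fun x => m (x' - x) ^ (1 / 2 : ℝ))
      (g := fun x => m (x' - x) ^ (1 / 2 : ℝ) * u x) (by fun_prop) (by fun_prop)
    simp only [← mul_assoc, hsq, mul_pow] at h2
    simp only [sq, hsq] at h2 ⊢
    rwa [lintegral_sub_left_eq_self] at h2
  refine (lintegral_mono h1).trans ?_
  rw [lintegral_const_mul _ (Measurable.lintegral_prod_right'
    (f := fun z : ℝ × ℝ => m (z.1 - z.2) * u z.2 ^ 2) (by fun_prop)),
    lintegral_lintegral_sub_mul volume hm (hu.pow_const 2), sq, mul_assoc]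

theorem lintegral_comp_div {f : ℝ → ℝ≥0∞} (hf : Measurable f) {Λ : ℝ} (hΛ : 0 < Λ) :
    ∫⁻ x, f (x / Λ) = ENNReal.ofReal Λ * ∫⁻ x, f x := by
  have h : ∫⁻ x, f (x / Λ) = ∫⁻ x, f x ∂(Measure.map (fun x => Λ⁻¹ * x) volume) := by
    rw [lintegral_map hf (by fun_prop)]
    refine lintegral_congr fun x => ?_
    rw [div_eq_inv_mul]
  rw [h, Real.map_volume_mul_left (by positivity), lintegral_smul_measure, inv_inv,
    abs_of_pos hΛ]
  rfl

/-- The bound for the kernel of the Duhamel operator. -/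
def kerBound (Λ x' x : ℝ) : ℝ :=
  Λ⁻¹ * (Λ + |2 * Real.pi * x|)⁻¹ * (bracket (2 * Real.pi * ((x' - x) / Λ)) ^ (-3 : ℝ) +
    bracket (2 * Real.pi * (x' / Λ)) ^ (-3 : ℝ))

/-- With m = 2πx and m' = 2πx', there are two terms. In the first, Λ + |m'| ≤ (Λ + |m|)⟨(m' - m)/Λ⟩
transfers the weight from output to input, and (Λ + |m|)^{b-1} is split into (Λ + |m|)^{b-5/8} ≤
Λ^{b-5/8} and the dual weight of exponent -3/8. In the second, Λ + |m'| = Λ⟨m'/Λ⟩ exactly, and the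
factor (Λ + |m|)^{-5/8} is kept for a later Cauchy–Schwarz in x. The decay drops from -3 to -2 to
absorb the power b ≤ 1. -/
theorem weight_mul_kerBound_le {b Λ : ℝ} (hb : 0 ≤ b) (hb' : b ≤ 5 / 8) (hΛ : 1 ≤ Λ) (x' x : ℝ) :
    (Λ + |2 * Real.pi * x'|) ^ b * kerBound Λ x' x ≤
      (Λ ^ (b - 5 / 8) * (Λ⁻¹ * bracket (2 * Real.pi * ((x' - x) / Λ)) ^ (-2 : ℝ)) +
        Λ ^ (b - 1) * bracket (2 * Real.pi * (x' / Λ)) ^ (-2 : ℝ) *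
          (Λ + |2 * Real.pi * x|) ^ (-(5 / 8) : ℝ)) * (1 + |2 * Real.pi * x|) ^ (-(3 / 8) : ℝ) := by
  have hΛ0 : 0 < Λ := by linarith
  set m := 2 * Real.pi * x with hm
  set m' := 2 * Real.pi * x' with hm'
  have e1 : 2 * Real.pi * ((x' - x) / Λ) = (m' - m) / Λ := by rw [hm, hm']; ring
  have e2 : 2 * Real.pi * (x' / Λ) = m' / Λ := by rw [hm']; ring
  rw [kerBound, e1, e2, ← hm]
  set P := bracket ((m' - m) / Λ) with hP
  set P' := bracket (m' / Λ) with hP'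
  have hP0 : 1 ≤ P := one_le_bracket _
  have hP'0 : 1 ≤ P' := one_le_bracket _
  have hA : 0 < Λ + |m| := by positivity
  have hA' : 0 < Λ + |m'| := by positivity
  have hB : 0 < 1 + |m| := by positivity
  have k1 : (Λ + |m'|) ≤ (Λ + |m|) * P := by
    rw [hP, bracket, abs_div, abs_of_pos hΛ0]
    have h1 : |m'| ≤ |m| + |m' - m| := by
      have := abs_add_le m (m' - m)
      rwa [add_sub_cancel] at this
    have h2 : (Λ + |m|) * (1 + |m' - m| / Λ) =
        Λ + |m| + |m' - m| + |m| * (|m' - m| / Λ) := by field_simp; ring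
    rw [h2]
    have : 0 ≤ |m| * (|m' - m| / Λ) := by positivity
    linarith
  have k2 : (Λ + |m'|) = Λ * P' := by
    rw [hP', bracket, abs_div, abs_of_pos hΛ0]
    field_simp
  have k3 : ∀ Q : ℝ, 1 ≤ Q → Q ^ b * Q ^ (-3 : ℝ) ≤ Q ^ (-2 : ℝ) := by
    intro Q hQ
    rw [← Real.rpow_add (by linarith)]
    exact Real.rpow_le_rpow_of_exponent_le hQ (by linarith)
  have k4 : (Λ + |m|) ^ (-(3 / 8) : ℝ) ≤ (1 + |m|) ^ (-(3 / 8) : ℝ) :=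
    Real.rpow_le_rpow_of_nonpos hB (by linarith) (by norm_num)
  have k5 : (Λ + |m|) ^ (b - 5 / 8) ≤ Λ ^ (b - 5 / 8) :=
    Real.rpow_le_rpow_of_nonpos hΛ0 (by linarith [abs_nonneg m]) (by linarith)
  have k6 : (Λ + |m|) ^ b * (Λ + |m|)⁻¹ = (Λ + |m|) ^ (b - 5 / 8) * (Λ + |m|) ^ (-(3 / 8) : ℝ) := by
    rw [← Real.rpow_neg_one, ← Real.rpow_add hA, ← Real.rpow_add hA]
    ring_nf
  have k7 : (Λ + |m|)⁻¹ = (Λ + |m|) ^ (-(5 / 8) : ℝ) * (Λ + |m|) ^ (-(3 / 8) : ℝ) := by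
    rw [← Real.rpow_neg_one, ← Real.rpow_add hA]
    norm_num
  have k8 : Λ ^ b * Λ⁻¹ = Λ ^ (b - 1) := by
    rw [← Real.rpow_neg_one, ← Real.rpow_add hΛ0]
    ring_nf
  have t1 : (Λ + |m'|) ^ b * (Λ⁻¹ * (Λ + |m|)⁻¹ * P ^ (-3 : ℝ)) ≤
      Λ ^ (b - 5 / 8) * (Λ⁻¹ * P ^ (-2 : ℝ)) * (1 + |m|) ^ (-(3 / 8) : ℝ) := by
    calc (Λ + |m'|) ^ b * (Λ⁻¹ * (Λ + |m|)⁻¹ * P ^ (-3 : ℝ))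
        ≤ ((Λ + |m|) * P) ^ b * (Λ⁻¹ * (Λ + |m|)⁻¹ * P ^ (-3 : ℝ)) := by gcongr
      _ = ((Λ + |m|) ^ b * (Λ + |m|)⁻¹) * (P ^ b * P ^ (-3 : ℝ)) * Λ⁻¹ := by
        rw [Real.mul_rpow hA.le (by linarith)]
        ring
      _ ≤ (Λ ^ (b - 5 / 8) * (1 + |m|) ^ (-(3 / 8) : ℝ)) * P ^ (-2 : ℝ) * Λ⁻¹ := by
        rw [k6]
        have := k3 P hP0
        gcongr
      _ = _ := by ring
  have t2 : (Λ + |m'|) ^ b * (Λ⁻¹ * (Λ + |m|)⁻¹ * P' ^ (-3 : ℝ)) ≤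
      Λ ^ (b - 1) * P' ^ (-2 : ℝ) * (Λ + |m|) ^ (-(5 / 8) : ℝ) * (1 + |m|) ^ (-(3 / 8) : ℝ) := by
    calc (Λ + |m'|) ^ b * (Λ⁻¹ * (Λ + |m|)⁻¹ * P' ^ (-3 : ℝ))
        = (Λ ^ b * Λ⁻¹) * (P' ^ b * P' ^ (-3 : ℝ)) *
          ((Λ + |m|) ^ (-(5 / 8) : ℝ) * (Λ + |m|) ^ (-(3 / 8) : ℝ)) := by
          rw [k2, Real.mul_rpow hΛ0.le (by linarith), ← k7]
          ring
      _ ≤ Λ ^ (b - 1) * P' ^ (-2 : ℝ) *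
          ((Λ + |m|) ^ (-(5 / 8) : ℝ) * (1 + |m|) ^ (-(3 / 8) : ℝ)) := by
        rw [k8]
        have := k3 P' hP'0
        gcongr
      _ = _ := by ring
  calc _ = (Λ + |m'|) ^ b * (Λ⁻¹ * (Λ + |m|)⁻¹ * P ^ (-3 : ℝ)) +
        (Λ + |m'|) ^ b * (Λ⁻¹ * (Λ + |m|)⁻¹ * P' ^ (-3 : ℝ)) := by ring
    _ ≤ _ := add_le_add t1 t2
    _ = _ := by ring

theorem lintegral_bracket_div {r Λ : ℝ} (hΛ : 0 < Λ) :
    ∫⁻ x : ℝ, ENNReal.ofReal (bracket (2 * Real.pi * (x / Λ)) ^ (-r)) =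
      ENNReal.ofReal Λ * ∫⁻ x : ℝ, ENNReal.ofReal (bracket (2 * Real.pi * x) ^ (-r)) :=
  lintegral_comp_div (f := fun x => ENNReal.ofReal (bracket (2 * Real.pi * x) ^ (-r)))
    ((measurable_bracket.comp (by fun_prop)).pow_const _).ennreal_ofReal hΛ

theorem kerBound_nonneg {Λ : ℝ} (hΛ : 1 ≤ Λ) (x' x : ℝ) : 0 ≤ kerBound Λ x' x := by
  have h1 := bracket_pos (2 * Real.pi * ((x' - x) / Λ))
  have h2 := bracket_pos (2 * Real.pi * (x' / Λ))
  unfold kerBound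
  positivity

/-- The first term of the pointwise bound is a convolution with a function whose L¹ norm does not
depend on Λ, and Young's inequality applies. The second has rank one, and Cauchy–Schwarz applies to
its input functional. -/
theorem exists_lintegral_kerBound_le {b : ℝ} (hb : 0 ≤ b) (hb' : b ≤ 5 / 8) :
    ∃ C : ℝ≥0∞, C ≠ ⊤ ∧ ∀ Λ : ℝ, 1 ≤ Λ → ∀ k : ℝ → ℝ≥0∞, Measurable k →
      ∫⁻ x', (ENNReal.ofReal ((Λ + |2 * Real.pi * x'|) ^ b) *
          ∫⁻ x, ENNReal.ofReal (kerBound Λ x' x) * k x) ^ 2 ≤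
        C * ENNReal.ofReal (Λ ^ (b - 5 / 8)) ^ 2 *
          ∫⁻ x, (ENNReal.ofReal ((1 + |2 * Real.pi * x|) ^ (-(3 / 8) : ℝ)) * k x) ^ 2 := by
  set I : ℝ → ℝ≥0∞ := fun r => ∫⁻ x : ℝ, ENNReal.ofReal (bracket (2 * Real.pi * x) ^ (-r)) with hI
  have hIt : ∀ r, 1 < r → I r ≠ ⊤ := fun r hr => lintegral_bracket_rpow_ne_top hr
  refine ⟨2 * (I 2 ^ 2 + I 4 * I (5 / 4)), ?_, fun Λ hΛ k hk => ?_⟩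
  · have h2 := hIt 2 (by norm_num)
    have h4 := hIt 4 (by norm_num)
    have h5 := hIt (5 / 4) (by norm_num)
    finiteness
  have hΛ0 : 0 < Λ := by linarith
  set u : ℝ → ℝ≥0∞ := fun x => ENNReal.ofReal ((1 + |2 * Real.pi * x|) ^ (-(3 / 8) : ℝ)) * k x
    with hu
  have hum : Measurable u := Measurable.mul
    ((Continuous.measurable (by fun_prop) : Measurable fun x : ℝ =>
      1 + |2 * Real.pi * x|).pow_const _).ennreal_ofReal hk
  set m : ℝ → ℝ≥0∞ := fun y =>
    ENNReal.ofReal (Λ⁻¹ * bracket (2 * Real.pi * (y / Λ)) ^ (-2 : ℝ)) with hm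
  have hmm : Measurable m :=
    (((measurable_bracket.comp (by fun_prop)).pow_const _).const_mul _).ennreal_ofReal
  set c : ℝ → ℝ≥0∞ := fun x => ENNReal.ofReal ((Λ + |2 * Real.pi * x|) ^ (-(5 / 8) : ℝ)) with hc
  have hcm : Measurable c := ((Continuous.measurable (by fun_prop) : Measurable fun x : ℝ =>
      Λ + |2 * Real.pi * x|).pow_const _).ennreal_ofReal
  set d : ℝ → ℝ≥0∞ := fun x' => ENNReal.ofReal (Λ ^ (b - 1) *
    bracket (2 * Real.pi * (x' / Λ)) ^ (-2 : ℝ)) with hd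
  have hdm : Measurable d :=
    (((measurable_bracket.comp (by fun_prop)).pow_const _).const_mul _).ennreal_ofReal
  set a := ENNReal.ofReal (Λ ^ (b - 5 / 8)) with ha
  have hmain : ∀ x', ENNReal.ofReal ((Λ + |2 * Real.pi * x'|) ^ b) *
      ∫⁻ x, ENNReal.ofReal (kerBound Λ x' x) * k x ≤
      a * (∫⁻ x, m (x' - x) * u x) + d x' * ∫⁻ x, c x * u x := by
    intro x'
    rw [← lintegral_const_mul' _ _ ENNReal.ofReal_ne_top,
      ← lintegral_const_mul' _ _ ENNReal.ofReal_ne_top,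
      ← lintegral_const_mul' _ _ ENNReal.ofReal_ne_top, ← lintegral_add_left (by fun_prop)]
    refine lintegral_mono fun x => ?_
    have hp1 := bracket_pos (2 * Real.pi * ((x' - x) / Λ))
    have hp2 := bracket_pos (2 * Real.pi * (x' / Λ))
    rw [← mul_assoc, ← ENNReal.ofReal_mul (by positivity)]
    calc _ ≤ _ := mul_le_mul_left (ENNReal.ofReal_le_ofReal
          (weight_mul_kerBound_le hb hb' hΛ x' x)) _
      _ = _ := by
          rw [ENNReal.ofReal_mul (by positivity), ENNReal.ofReal_add (by positivity)
            (by positivity), ENNReal.ofReal_mul (p := Λ ^ (b - 5 / 8)) (by positivity),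
            ENNReal.ofReal_mul (p := Λ ^ (b - 1) * _) (by positivity)]
          simp only [hu, hm, hc]
          ring
  have hImd : Measurable fun x' => ∫⁻ x, m (x' - x) * u x :=
    Measurable.lintegral_prod_right' (f := fun z : ℝ × ℝ => m (z.1 - z.2) * u z.2) (by fun_prop)
  have s1 : ∫⁻ x', (∫⁻ x, m (x' - x) * u x) ^ 2 ≤ I 2 ^ 2 * ∫⁻ x, u x ^ 2 := by
    refine (lintegral_sq_convolution_le hmm hum).trans (le_of_eq ?_)
    congr 2
    simp only [hm, hI]
    simp_rw [ENNReal.ofReal_mul (inv_nonneg.mpr hΛ0.le)]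
    rw [lintegral_const_mul' _ _ ENNReal.ofReal_ne_top, lintegral_bracket_div hΛ0, ← mul_assoc,
      ← ENNReal.ofReal_mul (by positivity), inv_mul_cancel₀ hΛ0.ne', ENNReal.ofReal_one, one_mul]
  have s2 : (∫⁻ x, c x * u x) ^ 2 ≤ ENNReal.ofReal (Λ ^ (-(1 / 4) : ℝ)) * I (5 / 4) *
      ∫⁻ x, u x ^ 2 := by
    refine (sq_lintegral_mul_le _ hcm.aemeasurable hum.aemeasurable).trans (le_of_eq ?_)
    congr 1
    have h1 : ∀ x, c x ^ 2 = ENNReal.ofReal (Λ ^ (-(5 / 4) : ℝ)) *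
        ENNReal.ofReal (bracket (2 * Real.pi * (x / Λ)) ^ (-(5 / 4) : ℝ)) := by
      intro x
      have h2 : Λ + |2 * Real.pi * x| = Λ * bracket (2 * Real.pi * (x / Λ)) := by
        rw [bracket, show 2 * Real.pi * (x / Λ) = (2 * Real.pi * x) / Λ by ring, abs_div,
          abs_of_pos hΛ0]
        field_simp
      have hp := bracket_pos (2 * Real.pi * (x / Λ))
      simp only [hc]
      rw [← ENNReal.ofReal_pow (by positivity), ← ENNReal.ofReal_mul (by positivity),
        ← Real.mul_rpow hΛ0.le hp.le, ← h2, ← Real.rpow_natCast, ← Real.rpow_mul (by positivity)]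
      norm_num
    simp_rw [h1]
    rw [lintegral_const_mul' _ _ ENNReal.ofReal_ne_top, lintegral_bracket_div hΛ0, ← mul_assoc,
      ← ENNReal.ofReal_mul (by positivity)]
    congr 2
    rw [← Real.rpow_add_one hΛ0.ne']
    norm_num
  have s3 : ∫⁻ x, d x ^ 2 = ENNReal.ofReal (Λ ^ (2 * b - 1)) * I 4 := by
    have h1 : ∀ x, d x ^ 2 = ENNReal.ofReal (Λ ^ (2 * b - 2)) *
        ENNReal.ofReal (bracket (2 * Real.pi * (x / Λ)) ^ (-4 : ℝ)) := by
      intro x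
      have hp := bracket_pos (2 * Real.pi * (x / Λ))
      simp only [hd]
      rw [← ENNReal.ofReal_pow (by positivity), ← ENNReal.ofReal_mul (by positivity), mul_pow,
        ← Real.rpow_natCast, ← Real.rpow_natCast, ← Real.rpow_mul hΛ0.le, ← Real.rpow_mul hp.le]
      congr 3
      · push_cast; ring
      · norm_num
    simp_rw [h1]
    rw [lintegral_const_mul' _ _ ENNReal.ofReal_ne_top, lintegral_bracket_div hΛ0, ← mul_assoc,
      ← ENNReal.ofReal_mul (by positivity)]
    congr 2
    rw [← Real.rpow_add_one hΛ0.ne']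
    ring_nf
  calc _ ≤ ∫⁻ x', 2 * (a ^ 2 * (∫⁻ x, m (x' - x) * u x) ^ 2 +
        d x' ^ 2 * (∫⁻ x, c x * u x) ^ 2) := by
        refine lintegral_mono fun x' => ?_
        refine (pow_le_pow_left' (hmain x') 2).trans ((add_sq_le_two_mul _ _).trans (le_of_eq ?_))
        ring
    _ = 2 * (a ^ 2 * (∫⁻ x', (∫⁻ x, m (x' - x) * u x) ^ 2) +
        (∫⁻ x', d x' ^ 2) * (∫⁻ x, c x * u x) ^ 2) := by
        rw [lintegral_const_mul' _ _ (by simp), lintegral_add_left (by fun_prop),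
          lintegral_const_mul _ (by fun_prop), lintegral_mul_const _ (by fun_prop)]
    _ ≤ 2 * (a ^ 2 * (I 2 ^ 2 * ∫⁻ x, u x ^ 2) + (ENNReal.ofReal (Λ ^ (2 * b - 1)) * I 4) *
        (ENNReal.ofReal (Λ ^ (-(1 / 4) : ℝ)) * I (5 / 4) * ∫⁻ x, u x ^ 2)) := by
        rw [s3]
        gcongr
    _ = 2 * (a ^ 2 * (I 2 ^ 2 * ∫⁻ x, u x ^ 2) + (ENNReal.ofReal (Λ ^ (2 * b - 1)) *
        ENNReal.ofReal (Λ ^ (-(1 / 4) : ℝ))) * (I 4 * I (5 / 4) * ∫⁻ x, u x ^ 2)) := by ring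
    _ = _ := by
        -- The rank-one term has the same size as the convolution term: (2b - 1) - 1/4 = 2(b - 5/8).
        have h1 : ENNReal.ofReal (Λ ^ (2 * b - 1)) * ENNReal.ofReal (Λ ^ (-(1 / 4) : ℝ)) = a ^ 2 := by
          rw [ha, ← ENNReal.ofReal_mul (by positivity), ← ENNReal.ofReal_pow (by positivity),
            ← Real.rpow_add hΛ0, ← Real.rpow_natCast, ← Real.rpow_mul hΛ0.le]
          congr 2
          push_cast
          ring
        rw [h1]
        ring

/-- Decay of the differences of a Schwartz function. -/
theorem exists_schwartz_sub_le (S : SchwartzMap ℝ ℂ) :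
    ∃ C : ℝ, 0 ≤ C ∧ (∀ y : ℝ, ‖S y‖ ≤ C * bracket (2 * Real.pi * y) ^ (-3 : ℝ)) ∧
      ∀ y' y : ℝ, ‖S (y' - y) - S y'‖ ≤ C * (|2 * Real.pi * y| / bracket (2 * Real.pi * y)) *
        (bracket (2 * Real.pi * (y' - y)) ^ (-3 : ℝ) + bracket (2 * Real.pi * y') ^ (-3 : ℝ)) := by
  have hπ := Real.pi_gt_three
  set A := 2 ^ 3 * ((Finset.Iic ((3, 1) : ℕ × ℕ)).sup (fun m => SchwartzMap.seminorm ℝ m.1 m.2)) S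
    with hA
  have hA0 : 0 ≤ A := by positivity
  have hb : ∀ y : ℝ, bracket (2 * Real.pi * y) ≤ 2 * Real.pi * (1 + |y|) := by
    intro y
    rw [bracket, abs_mul, abs_of_pos (by positivity)]
    nlinarith
  have hd : ∀ (n : ℕ), n ≤ 1 → ∀ y : ℝ, ‖iteratedFDeriv ℝ n S y‖ ≤
      A * (2 * Real.pi) ^ 3 * bracket (2 * Real.pi * y) ^ (-3 : ℝ) := by
    intro n hn y
    have h1 := SchwartzMap.one_add_le_sup_seminorm_apply (𝕜 := ℝ) (m := (3, 1)) (k := 3) (n := n)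
      le_rfl hn S y
    rw [← hA, Real.norm_eq_abs] at h1
    have hp := bracket_pos (2 * Real.pi * y)
    rw [Real.rpow_neg hp.le, ← div_eq_mul_inv, le_div_iff₀ (by positivity)]
    have h2 : bracket (2 * Real.pi * y) ^ (3 : ℝ) ≤ (2 * Real.pi * (1 + |y|)) ^ 3 := by
      rw [← Real.rpow_natCast]
      exact Real.rpow_le_rpow hp.le (hb y) (by norm_num)
    calc ‖iteratedFDeriv ℝ n S y‖ * bracket (2 * Real.pi * y) ^ (3 : ℝ)
        ≤ ‖iteratedFDeriv ℝ n S y‖ * (2 * Real.pi * (1 + |y|)) ^ 3 := by gcongr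
      _ = ((1 + |y|) ^ 3 * ‖iteratedFDeriv ℝ n S y‖) * (2 * Real.pi) ^ 3 := by ring
      _ ≤ _ := by gcongr
  set B := A * (2 * Real.pi) ^ 3 with hB
  have hB0 : 0 ≤ B := by positivity
  have h0 : ∀ y : ℝ, ‖S y‖ ≤ B * bracket (2 * Real.pi * y) ^ (-3 : ℝ) := by
    intro y
    have := hd 0 (by norm_num) y
    rwa [norm_iteratedFDeriv_zero] at this
  have h1 : ∀ y : ℝ, ‖deriv S y‖ ≤ B * bracket (2 * Real.pi * y) ^ (-3 : ℝ) := by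
    intro y
    have := hd 1 le_rfl y
    rwa [norm_iteratedFDeriv_one, ← norm_deriv_eq_norm_fderiv] at this
  refine ⟨16 * B, by positivity, fun y => (h0 y).trans ?_, fun y' y => ?_⟩
  · have hp := bracket_pos (2 * Real.pi * y)
    gcongr
    linarith
  set m := 2 * Real.pi * y with hm
  have p0 := bracket_pos m
  have p1 := bracket_pos (2 * Real.pi * (y' - y))
  have p2 := bracket_pos (2 * Real.pi * y')
  -- The factor |m|/⟨m⟩ is comparable to min(1, |m|). For |m| ≥ 1 the triangle inequality suffices.
  -- For |m| < 1 the mean value inequality is used on a segment along which ⟨2πy'⟩ ≤ 2⟨2πz⟩; this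
  -- costs 2³ = 8, and |m|/2 ≤ |m|/⟨m⟩ costs another 2, whence 16.
  rcases le_or_gt 1 |m| with h | h
  · have h2 : (1 : ℝ) / 2 ≤ |m| / bracket m := by
      rw [le_div_iff₀ p0, bracket]
      linarith
    calc ‖S (y' - y) - S y'‖ ≤ ‖S (y' - y)‖ + ‖S y'‖ := norm_sub_le _ _
      _ ≤ B * bracket (2 * Real.pi * (y' - y)) ^ (-3 : ℝ) +
          B * bracket (2 * Real.pi * y') ^ (-3 : ℝ) := add_le_add (h0 _) (h0 _)
      _ = B * (bracket (2 * Real.pi * (y' - y)) ^ (-3 : ℝ) +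
          bracket (2 * Real.pi * y') ^ (-3 : ℝ)) := by ring
      _ ≤ _ := by
          gcongr
          nlinarith
  · have h2 : ∀ z ∈ segment ℝ y' (y' - y), ‖deriv S z‖ ≤
        8 * B * bracket (2 * Real.pi * y') ^ (-3 : ℝ) := by
      intro z hz
      refine (h1 z).trans ?_
      have pz := bracket_pos (2 * Real.pi * z)
      have h3 : bracket (2 * Real.pi * y') ≤ 2 * bracket (2 * Real.pi * z) := by
        rw [segment_eq_image] at hz
        obtain ⟨θ, hθ, rfl⟩ := hz
        simp only [smul_eq_mul]
        have e : 2 * Real.pi * y' = 2 * Real.pi * ((1 - θ) * y' + θ * (y' - y)) + θ * m := by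
          rw [hm]; ring
        rw [e]
        refine (bracket_add_le _ _).trans ?_
        have h4 : bracket (θ * m) ≤ 2 := by
          rw [bracket, abs_mul, abs_of_nonneg hθ.1]
          nlinarith [hθ.2, abs_nonneg m]
        nlinarith [bracket_pos (2 * Real.pi * ((1 - θ) * y' + θ * (y' - y)))]
      have h5 : (2 * bracket (2 * Real.pi * z)) ^ (-3 : ℝ) ≤ bracket (2 * Real.pi * y') ^ (-3 : ℝ) :=
        Real.rpow_le_rpow_of_nonpos p2 h3 (by norm_num)
      rw [Real.mul_rpow (by norm_num) pz.le] at h5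
      have h6 : (2 : ℝ) ^ (-3 : ℝ) = 1 / 8 := by
        rw [Real.rpow_neg (by norm_num)]
        norm_num
      rw [h6] at h5
      nlinarith
    have h3 := (convex_segment y' (y' - y)).norm_image_sub_le_of_norm_deriv_le
      (fun z _ => S.differentiableAt) h2 (left_mem_segment ℝ _ _) (right_mem_segment ℝ _ _)
    refine h3.trans ?_
    have h4 : ‖y' - y - y'‖ = |y| := by
      rw [Real.norm_eq_abs, show y' - y - y' = -y by ring, abs_neg]
    rw [h4]
    have h5 : |y| ≤ |m| := by
      rw [hm, abs_mul, abs_of_pos (by positivity : 0 < 2 * Real.pi)]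
      nlinarith [abs_nonneg y]
    have h6 : |m| / 2 ≤ |m| / bracket m := by
      have h7 : bracket m ≤ 2 := by rw [bracket]; linarith
      gcongr
    have hq : 0 ≤ bracket (2 * Real.pi * (y' - y)) ^ (-3 : ℝ) := by positivity
    have hq' : 0 ≤ bracket (2 * Real.pi * y') ^ (-3 : ℝ) := by positivity
    calc 8 * B * bracket (2 * Real.pi * y') ^ (-3 : ℝ) * |y|
        ≤ 8 * B * bracket (2 * Real.pi * y') ^ (-3 : ℝ) * |m| := by gcongr
      _ = 16 * B * (|m| / 2) * bracket (2 * Real.pi * y') ^ (-3 : ℝ) := by ring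
      _ ≤ 16 * B * (|m| / bracket m) * (bracket (2 * Real.pi * (y' - y)) ^ (-3 : ℝ) +
          bracket (2 * Real.pi * y') ^ (-3 : ℝ)) := by
          gcongr
          linarith

/-! ### The localized Duhamel operator -/

/-- The Fourier transform of `t ↦ Ψ (Λ t)`. -/
def gker (Ψ : SchwartzMap ℝ ℂ) (Λ x : ℝ) : ℂ := ((Λ⁻¹ : ℝ) : ℂ) * (𝓕 Ψ) (x / Λ)

theorem continuous_gker (Ψ : SchwartzMap ℝ ℂ) (Λ : ℝ) : Continuous (gker Ψ Λ) := by
  unfold gker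
  exact continuous_const.mul ((𝓕 Ψ).continuous.comp (continuous_id.div_const _))

theorem integrable_gker (Ψ : SchwartzMap ℝ ℂ) {Λ : ℝ} (hΛ : 0 < Λ) : Integrable (gker Ψ Λ) :=
  ((𝓕 Ψ).integrable.comp_div hΛ.ne').const_mul _

theorem echar_mul_left (a ξ t : ℝ) : echar (a * ξ) t = echar ξ (a * t) := by
  rw [echar, echar]
  congr 1
  push_cast
  ring

theorem integral_echar_mul_gker (Ψ : SchwartzMap ℝ ℂ) {Λ : ℝ} (hΛ : 0 < Λ) (t : ℝ) :
    ∫ x, echar x t * gker Ψ Λ x = Ψ (Λ * t) := by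
  have h1 : ∀ x, echar x t * gker Ψ Λ x =
      (fun y => ((Λ⁻¹ : ℝ) : ℂ) * (echar y (Λ * t) * (𝓕 Ψ) y)) (x / Λ) := by
    intro x
    have : echar x t = echar (x / Λ) (Λ * t) := by
      rw [← echar_mul_left, mul_div_cancel₀ _ hΛ.ne']
    simp only [gker, this]
    ring
  simp only [h1]
  rw [Measure.integral_comp_div
    (fun y => ((Λ⁻¹ : ℝ) : ℂ) * (echar y (Λ * t) * (𝓕 Ψ : SchwartzMap ℝ ℂ) y)),
    integral_const_mul, abs_of_pos hΛ, ← fourierInv_eq_echar,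
    Complex.real_smul, ← mul_assoc, ← Complex.ofReal_mul, mul_inv_cancel₀ hΛ.ne',
    Complex.ofReal_one, one_mul, ← SchwartzMap.fourierInv_coe,
    FourierTransform.fourierInv_fourier_eq]

/-- The kernel of the localized Duhamel operator for the trivial group. -/
def dKer (Ψ : SchwartzMap ℝ ℂ) (Λ x' x : ℝ) : ℂ :=
  (gker Ψ Λ (x' - x) - gker Ψ Λ x') / (2 * Real.pi * x * Complex.I)

theorem measurable_dKer (Ψ : SchwartzMap ℝ ℂ) (Λ : ℝ) :
    Measurable fun z : ℝ × ℝ => dKer Ψ Λ z.1 z.2 := by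
  have := (continuous_gker Ψ Λ).measurable
  unfold dKer
  fun_prop

/-- The numerator vanishes at x = 0, so its decay estimate for differences cancels the singularity
of 1/x and leaves (Λ + |2πx|)⁻¹. -/
theorem exists_norm_dKer_le (Ψ : SchwartzMap ℝ ℂ) : ∃ C : ℝ, 0 ≤ C ∧ ∀ Λ : ℝ, 1 ≤ Λ →
    (∀ x, ‖gker Ψ Λ x‖ ≤ C * (Λ⁻¹ * bracket (2 * Real.pi * (x / Λ)) ^ (-3 : ℝ))) ∧
    ∀ x' x, ‖dKer Ψ Λ x' x‖ ≤ C * kerBound Λ x' x := by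
  obtain ⟨C, hC, h1, h2⟩ := exists_schwartz_sub_le (𝓕 Ψ)
  refine ⟨C, hC, fun Λ hΛ => ?_⟩
  have hΛ0 : 0 < Λ := by linarith
  refine ⟨fun x => ?_, fun x' x => ?_⟩
  · rw [gker, norm_mul, Complex.norm_real, Real.norm_of_nonneg (by positivity)]
    have := h1 (x / Λ)
    calc Λ⁻¹ * ‖(𝓕 Ψ) (x / Λ)‖ ≤ Λ⁻¹ * (C * bracket (2 * Real.pi * (x / Λ)) ^ (-3 : ℝ)) := by
          gcongr
      _ = _ := by ring
  -- At x = 0 the kernel is 0 by the convention for division by zero.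
  · rcases eq_or_ne x 0 with rfl | hx
    · simp only [dKer, Complex.ofReal_zero, mul_zero, zero_mul, div_zero, norm_zero]
      exact mul_nonneg hC (kerBound_nonneg hΛ _ _)
    · have hπ := Real.pi_pos
      have h3 := h2 (x' / Λ) (x / Λ)
      have h4 : ‖(2 * Real.pi * x * Complex.I : ℂ)‖ = |2 * Real.pi * x| := by
        rw [show (2 * Real.pi * x * Complex.I : ℂ) = ((2 * Real.pi * x : ℝ) : ℂ) * Complex.I by
          push_cast; ring, norm_mul, Complex.norm_I, mul_one, Complex.norm_real, Real.norm_eq_abs]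
      have h5 : 0 < |2 * Real.pi * x| := abs_pos.mpr (by positivity)
      have h6 : |2 * Real.pi * (x / Λ)| = |2 * Real.pi * x| / Λ := by
        rw [← mul_div_assoc, abs_div, abs_of_pos hΛ0]
      rw [dKer, norm_div, h4, gker, gker, ← mul_sub, norm_mul, Complex.norm_real,
        Real.norm_of_nonneg (by positivity), div_le_iff₀ h5, sub_div]
      refine (mul_le_mul_of_nonneg_left h3 (by positivity)).trans (le_of_eq ?_)
      rw [kerBound, sub_div]
      generalize bracket (2 * Real.pi * (x' / Λ - x / Λ)) ^ (-3 : ℝ) +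
        bracket (2 * Real.pi * (x' / Λ)) ^ (-3 : ℝ) = B
      rw [bracket, h6]
      field_simp

/-- The time frequency at which the modulation vanishes, up to sign. -/
def freqShift (φ : ℤ → ℝ) (n : ℤ) : ℝ := φ n / (2 * Real.pi)

theorem two_pi_mul_sub_freqShift (φ : ℤ → ℝ) (n : ℤ) (x : ℝ) :
    2 * Real.pi * (x - freqShift φ n) + φ n = 2 * Real.pi * x := by
  have hπ := Real.pi_pos
  unfold freqShift
  field_simp
  ring

/-- The Fourier transform of `Ψ(Λt) ∫₀ᵗ exp (-iφ(n)(t-r)) w(r, n) dr`, as an operator on the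
Fourier transform of `w`. -/
def duhamel (Ψ : SchwartzMap ℝ ℂ) (Λ : ℝ) (φ : ℤ → ℝ) (K : ℤ × ℝ → ℂ) (p : ℤ × ℝ) : ℂ :=
  ∫ ξ, dKer Ψ Λ (p.2 + freqShift φ p.1) (ξ + freqShift φ p.1) * K (p.1, ξ)

theorem measurable_freqShift (φ : ℤ → ℝ) : Measurable (freqShift φ) := measurable_of_countable _

theorem measurable_duhamel_kernel (Ψ : SchwartzMap ℝ ℂ) (Λ : ℝ) (φ : ℤ → ℝ) {K : ℤ × ℝ → ℂ}
    (hK : Measurable K) : Measurable fun z : (ℤ × ℝ) × ℝ =>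
      dKer Ψ Λ (z.1.2 + freqShift φ z.1.1) (z.2 + freqShift φ z.1.1) * K (z.1.1, z.2) := by
  have h1 := measurable_freqShift φ
  have h2 : Measurable fun z : (ℤ × ℝ) × ℝ =>
      (z.1.2 + freqShift φ z.1.1, z.2 + freqShift φ z.1.1) := by fun_prop
  exact ((measurable_dKer Ψ Λ).comp h2).mul (hK.comp (by fun_prop))

theorem measurable_duhamel (Ψ : SchwartzMap ℝ ℂ) (Λ : ℝ) (φ : ℤ → ℝ) {K : ℤ × ℝ → ℂ}
    (hK : Measurable K) : Measurable (duhamel Ψ Λ φ K) :=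
  (measurable_duhamel_kernel Ψ Λ φ hK).stronglyMeasurable.integral_prod_right.measurable

/-- Translating each slice by `freqShift φ n` turns the modulation into 2πx. In these coordinates
the Duhamel operator and the free evolution have the same kernel for every n, so their bounds are
uniform in n and φ. -/
theorem nsq_eq_tsum (φ : ℤ → ℝ) (Λ s b : ℝ) {F : ℤ × ℝ → ℂ} (hF : Measurable F) :
    nsq φ Λ s b F = ∑' n : ℤ, ENNReal.ofReal (bracket n ^ s) ^ 2 *
      ∫⁻ x, (ENNReal.ofReal ((Λ + |2 * Real.pi * x|) ^ b) * ‖F (n, x - freqShift φ n)‖ₑ) ^ 2 := by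
  have mw := (measurable_wt φ Λ s b).ennreal_ofReal
  rw [nsq, lintegral_freqMeasure (by fun_prop)]
  congr 1
  funext n
  rw [← lintegral_const_mul' _ _ (by simp), ← lintegral_sub_right_eq_self _ (freqShift φ n)]
  refine lintegral_congr fun x => ?_
  have hb := bracket_pos (n : ℝ)
  simp only [wt, modulation, two_pi_mul_sub_freqShift]
  rw [ENNReal.ofReal_mul' (by positivity)]
  ring

/-- The Duhamel operator gains `1 - 3/8 - b` powers of `Λ`. -/
theorem exists_nsq_duhamel_le (Ψ : SchwartzMap ℝ ℂ) {b : ℝ} (hb : 0 ≤ b) (hb' : b ≤ 5 / 8) :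
    ∃ C : ℝ≥0∞, C ≠ ⊤ ∧ ∀ (φ : ℤ → ℝ) (s Λ : ℝ), 1 ≤ Λ → ∀ K : ℤ × ℝ → ℂ, Measurable K →
      nsq φ Λ s b (duhamel Ψ Λ φ K) ≤
        C * ENNReal.ofReal (Λ ^ (b - 5 / 8)) ^ 2 * nsq φ 1 s (-(3 / 8)) K := by
  obtain ⟨C₁, hC₁, h1⟩ := exists_norm_dKer_le Ψ
  obtain ⟨C₂, hC₂, h2⟩ := exists_lintegral_kerBound_le hb hb'
  refine ⟨ENNReal.ofReal C₁ ^ 2 * C₂, ENNReal.mul_ne_top (by simp) hC₂,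
    fun φ s Λ hΛ K hK => ?_⟩
  rw [nsq_eq_tsum φ Λ s b (measurable_duhamel Ψ Λ φ hK), nsq_eq_tsum φ 1 s _ hK,
    ← ENNReal.tsum_mul_left]
  refine ENNReal.tsum_le_tsum fun n => ?_
  have mk : Measurable fun x => ‖K (n, x - freqShift φ n)‖ₑ := by fun_prop
  have h3 := h2 Λ hΛ _ mk
  have h4 : ∀ x', ‖duhamel Ψ Λ φ K (n, x' - freqShift φ n)‖ₑ ≤
      ENNReal.ofReal C₁ * ∫⁻ x, ENNReal.ofReal (kerBound Λ x' x) *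
        ‖K (n, x - freqShift φ n)‖ₑ := by
    intro x'
    refine (enorm_integral_le_lintegral_enorm _).trans ?_
    rw [← lintegral_sub_right_eq_self _ (freqShift φ n), ← lintegral_const_mul' _ _ (by simp)]
    refine lintegral_mono fun x => ?_
    simp only [sub_add_cancel, enorm_mul]
    rw [← mul_assoc, ← ENNReal.ofReal_mul hC₁, ← ofReal_norm]
    gcongr
    exact (h1 Λ hΛ).2 x' x
  have h5 : ∫⁻ x', (ENNReal.ofReal ((Λ + |2 * Real.pi * x'|) ^ b) *
      ‖duhamel Ψ Λ φ K (n, x' - freqShift φ n)‖ₑ) ^ 2 ≤ ENNReal.ofReal C₁ ^ 2 *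
      ∫⁻ x', (ENNReal.ofReal ((Λ + |2 * Real.pi * x'|) ^ b) *
        ∫⁻ x, ENNReal.ofReal (kerBound Λ x' x) * ‖K (n, x - freqShift φ n)‖ₑ) ^ 2 := by
    rw [← lintegral_const_mul' _ _ (by simp)]
    refine lintegral_mono fun x' => ?_
    rw [← mul_pow, mul_left_comm]
    gcongr
    exact h4 x'
  calc _ ≤ ENNReal.ofReal (bracket n ^ s) ^ 2 * (ENNReal.ofReal C₁ ^ 2 *
        (C₂ * ENNReal.ofReal (Λ ^ (b - 5 / 8)) ^ 2 * ∫⁻ x, (ENNReal.ofReal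
        ((1 + |2 * Real.pi * x|) ^ (-(3 / 8) : ℝ)) * ‖K (n, x - freqShift φ n)‖ₑ) ^ 2)) := by
        gcongr
        exact h5.trans (by gcongr)
    _ = _ := by ring

theorem kerBound_le {Λ : ℝ} (hΛ : 1 ≤ Λ) (x' x : ℝ) : kerBound Λ x' x ≤
    Λ⁻¹ * (bracket (2 * Real.pi * ((x' - x) / Λ)) ^ (-3 : ℝ) +
      bracket (2 * Real.pi * (x' / Λ)) ^ (-3 : ℝ)) := by
  have h1 := bracket_pos (2 * Real.pi * ((x' - x) / Λ))
  have h2 := bracket_pos (2 * Real.pi * (x' / Λ))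
  have h3 : (Λ + |2 * Real.pi * x|)⁻¹ ≤ 1 :=
    inv_le_one_of_one_le₀ (by linarith [abs_nonneg (2 * Real.pi * x)])
  have h0 : 0 ≤ Λ⁻¹ := by positivity
  rw [kerBound]
  gcongr
  exact mul_le_of_le_one_right h0 h3

/-- Provides absolute integrability for Fubini with fixed Λ; no uniformity in Λ is sought here. -/
theorem exists_lintegral_dKer_le (Ψ : SchwartzMap ℝ ℂ) {Λ : ℝ} (hΛ : 1 ≤ Λ) :
    ∃ C : ℝ≥0∞, C ≠ ⊤ ∧ ∀ x, ∫⁻ x', ‖dKer Ψ Λ x' x‖ₑ ≤ C := by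
  obtain ⟨C₁, hC₁, h1⟩ := exists_norm_dKer_le Ψ
  have hΛ0 : 0 < Λ := by linarith
  set J : ℝ≥0∞ := ∫⁻ x', ENNReal.ofReal (bracket (2 * Real.pi * (x' / Λ)) ^ (-3 : ℝ)) with hJ
  have hJt : J ≠ ⊤ := by
    have := measurable_bracket
    rw [hJ, lintegral_comp_div (f := fun y => ENNReal.ofReal (bracket (2 * Real.pi * y) ^ (-3 : ℝ)))
      (by fun_prop) hΛ0]
    exact ENNReal.mul_ne_top (by simp) (lintegral_bracket_rpow_ne_top (r := 3) (by norm_num))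
  refine ⟨ENNReal.ofReal (C₁ * Λ⁻¹) * (J + J), ENNReal.mul_ne_top (by simp) (by simp [hJt]),
    fun x => ?_⟩
  have hm : Measurable fun x' => ENNReal.ofReal (bracket (2 * Real.pi * (x' / Λ)) ^ (-3 : ℝ)) := by
    have := measurable_bracket
    fun_prop
  calc ∫⁻ x', ‖dKer Ψ Λ x' x‖ₑ ≤ ∫⁻ x', ENNReal.ofReal (C₁ * Λ⁻¹) *
        (ENNReal.ofReal (bracket (2 * Real.pi * ((x' - x) / Λ)) ^ (-3 : ℝ)) +
          ENNReal.ofReal (bracket (2 * Real.pi * (x' / Λ)) ^ (-3 : ℝ))) := by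
        refine lintegral_mono fun x' => ?_
        have h2 := bracket_pos (2 * Real.pi * ((x' - x) / Λ))
        have h3 := bracket_pos (2 * Real.pi * (x' / Λ))
        rw [← ENNReal.ofReal_add (by positivity) (by positivity), ← ENNReal.ofReal_mul
          (by positivity), ← ofReal_norm]
        refine ENNReal.ofReal_le_ofReal (((h1 Λ hΛ).2 x' x).trans ?_)
        rw [mul_assoc]
        gcongr
        exact kerBound_le hΛ x' x
    _ = _ := by
        rw [lintegral_const_mul' _ _ (by simp), lintegral_add_right _ hm, ← hJ,
          lintegral_sub_right_eq_self
            (fun x' => ENNReal.ofReal (bracket (2 * Real.pi * (x' / Λ)) ^ (-3 : ℝ))) x]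

theorem integrable_duhamel_kernel (Ψ : SchwartzMap ℝ ℂ) {Λ : ℝ} (hΛ : 1 ≤ Λ) (φ : ℤ → ℝ)
    {K : ℤ × ℝ → ℂ} (hK : IsSliceIntegrable K) (n : ℤ) :
    Integrable (Function.uncurry fun ξ' ξ : ℝ => dKer Ψ Λ (ξ' + freqShift φ n)
      (ξ + freqShift φ n) * K (n, ξ)) ((volume : Measure ℝ).prod volume) := by
  obtain ⟨C, hC, h⟩ := exists_lintegral_dKer_le Ψ hΛ
  have hm : Measurable (Function.uncurry fun ξ' ξ : ℝ => dKer Ψ Λ (ξ' + freqShift φ n)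
      (ξ + freqShift φ n) * K (n, ξ)) :=
    ((measurable_dKer Ψ Λ).comp (by fun_prop : Measurable fun z : ℝ × ℝ =>
      (z.1 + freqShift φ n, z.2 + freqShift φ n))).mul
      ((measurable_slice hK.measurable n).comp measurable_snd)
  refine ⟨hm.aestronglyMeasurable, ?_⟩
  rw [hasFiniteIntegral_iff_enorm, lintegral_prod_symm' _ hm.enorm]
  refine lt_of_le_of_lt (b := ∫⁻ ξ, C * ‖K (n, ξ)‖ₑ) (lintegral_mono fun ξ => ?_) ?_
  · simp only [Function.uncurry_apply_pair, enorm_mul]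
    rw [lintegral_mul_const' _ _ (by simp), lintegral_add_right_eq_self
      (fun ξ' => ‖dKer Ψ Λ ξ' (ξ + freqShift φ n)‖ₑ) (freqShift φ n)]
    gcongr
    exact h _
  · rw [lintegral_const_mul' _ _ hC]
    exact ENNReal.mul_lt_top hC.lt_top (hK.integrable n).2

theorem isSliceIntegrable_duhamel (Ψ : SchwartzMap ℝ ℂ) {Λ : ℝ} (hΛ : 1 ≤ Λ) (φ : ℤ → ℝ)
    {K : ℤ × ℝ → ℂ} (hK : IsSliceIntegrable K) : IsSliceIntegrable (duhamel Ψ Λ φ K) :=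
  ⟨measurable_duhamel Ψ Λ φ hK.measurable, fun n =>
    (integrable_duhamel_kernel Ψ hΛ φ hK n).integral_prod_left⟩

/-- Translation by x in frequency is modulation in time, so the left side is Ψ(Λt)(e^{2πixt} -
1)/(2πix), and the quotient is the integral of the character over [0, t]. -/
theorem integral_echar_mul_dKer (Ψ : SchwartzMap ℝ ℂ) {Λ : ℝ} (hΛ : 0 < Λ) (t : ℝ) {x : ℝ}
    (hx : x ≠ 0) : ∫ x', echar x' t * dKer Ψ Λ x' x = Ψ (Λ * t) * ∫ t' in (0)..t, echar x t' := by
  have hi : ∀ f : ℝ → ℂ, Integrable f → Integrable fun x' => echar x' t * f x' := fun f hf =>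
    hf.bdd_mul (c := 1) (measurable_echar t).aestronglyMeasurable
      (Filter.Eventually.of_forall fun ξ => (norm_echar ξ t).le)
  have h1 : ∫ x', echar x' t * gker Ψ Λ (x' - x) = echar x t * Ψ (Λ * t) := by
    rw [← integral_echar_mul_gker Ψ hΛ, ← integral_add_right_eq_self _ x, ← integral_const_mul]
    congr 1
    funext y
    rw [add_sub_cancel_right, echar_add_left]
    ring
  have hg := integrable_gker Ψ hΛ
  have hc : (2 * Real.pi * x * Complex.I : ℂ) ≠ 0 := by
    simp [hx, Real.pi_ne_zero]
  have h2 : ∫ t' in (0)..t, echar x t' = (echar x t - 1) / (2 * Real.pi * x * Complex.I) := by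
    have h3 : ∀ t' : ℝ, echar x t' = Complex.exp ((2 * Real.pi * x * Complex.I) * t') := by
      intro t'
      rw [echar]
      ring_nf
    simp only [h3]
    rw [integral_exp_mul_complex hc]
    simp
  have h4 : ∀ x', echar x' t * dKer Ψ Λ x' x = (2 * Real.pi * x * Complex.I : ℂ)⁻¹ *
      (echar x' t * gker Ψ Λ (x' - x) - echar x' t * gker Ψ Λ x') := by
    intro x'
    rw [dKer]
    ring
  simp only [h4]
  rw [integral_const_mul, integral_sub (hi _ (hg.comp_sub_right x)) (hi _ hg), h1,
    integral_echar_mul_gker Ψ hΛ, h2]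
  ring

theorem hat_duhamel (Ψ : SchwartzMap ℝ ℂ) {Λ : ℝ} (hΛ : 1 ≤ Λ) (φ : ℤ → ℝ)
    {K : ℤ × ℝ → ℂ} (hK : IsSliceIntegrable K) {t : ℝ} (ht : 0 ≤ t) (n : ℤ) :
    hat (duhamel Ψ Λ φ K) t n = Ψ (Λ * t) *
      (echar (-freqShift φ n) t * ∫ t' in (0)..t, echar (freqShift φ n) t' * hat K t' n) := by
  set κ := freqShift φ n with hκ
  have hΛ0 : 0 < Λ := by linarith
  have me := measurable_echar t
  have h1 := integrable_duhamel_kernel Ψ hΛ φ hK n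
  have h2 : Integrable (Function.uncurry fun ξ' ξ : ℝ => echar ξ' t * (dKer Ψ Λ (ξ' + κ)
      (ξ + κ) * K (n, ξ))) ((volume : Measure ℝ).prod volume) :=
    h1.bdd_mul (c := 1) (me.comp measurable_fst).aestronglyMeasurable
      (Filter.Eventually.of_forall fun z => (norm_echar z.1 t).le)
  have h3 : hat (duhamel Ψ Λ φ K) t n =
      ∫ ξ', ∫ ξ, echar ξ' t * (dKer Ψ Λ (ξ' + κ) (ξ + κ) * K (n, ξ)) := by
    rw [hat]
    congr 1
    funext ξ'
    rw [duhamel, ← integral_const_mul]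
  have h4 : ∀ ξ, ξ + κ ≠ 0 → ∫ ξ', echar ξ' t * (dKer Ψ Λ (ξ' + κ) (ξ + κ) * K (n, ξ)) =
      ∫ t' in (0)..t, Ψ (Λ * t) * echar (-κ) t * (echar κ t' * (echar ξ t' * K (n, ξ))) := by
    intro ξ hξ
    have h5 : ∀ ξ', echar ξ' t * (dKer Ψ Λ (ξ' + κ) (ξ + κ) * K (n, ξ)) =
        echar (-κ) t * K (n, ξ) * (echar (ξ' + κ) t * dKer Ψ Λ (ξ' + κ) (ξ + κ)) := by
      intro ξ'
      have : echar ξ' t = echar (-κ) t * echar (ξ' + κ) t := by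
        rw [← echar_add_left]
        ring_nf
      rw [this]
      ring
    simp only [h5]
    rw [integral_const_mul, integral_add_right_eq_self
      (fun x => echar x t * dKer Ψ Λ x (ξ + κ)) κ, integral_echar_mul_dKer Ψ hΛ0 t hξ,
      ← mul_assoc, ← intervalIntegral.integral_const_mul]
    refine intervalIntegral.integral_congr fun t' _ => ?_
    simp only [echar_add_left]
    ring
  have h6 : Integrable (Function.uncurry fun ξ t' : ℝ => Ψ (Λ * t) * echar (-κ) t *
      (echar κ t' * (echar ξ t' * K (n, ξ))))
      ((volume : Measure ℝ).prod (volume.restrict (Ioc 0 t))) := by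
    have h7 : Integrable (fun z : ℝ × ℝ => K (n, z.1))
        ((volume : Measure ℝ).prod (volume.restrict (Ioc 0 t))) := (hK.integrable n).comp_fst _
    have h8 : Integrable (fun z : ℝ × ℝ => (echar κ z.2 * echar z.1 z.2) * K (n, z.1))
        ((volume : Measure ℝ).prod (volume.restrict (Ioc 0 t))) := by
      refine h7.bdd_mul (c := 1) ?_ (Filter.Eventually.of_forall fun z => ?_)
      · refine Continuous.aestronglyMeasurable ?_
        unfold echar
        fun_prop
      · rw [norm_mul, norm_echar, norm_echar, one_mul]
    refine (h8.const_mul (Ψ (Λ * t) * echar (-κ) t)).congr (Filter.Eventually.of_forall fun z => ?_)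
    simp only [Function.uncurry]
    ring
  rw [h3, integral_integral_swap h2, ← mul_assoc, ← intervalIntegral.integral_const_mul]
  -- The kernel identity is available only off the zero of the modulation, a null set of ξ.
  have h9 : ∀ᵐ ξ : ℝ, ξ + κ ≠ 0 := by
    filter_upwards [Measure.ae_ne volume (-κ)] with ξ hξ h
    exact hξ (eq_neg_of_add_eq_zero_left h)
  rw [integral_congr_ae (h9.mono h4)]
  simp only [intervalIntegral.integral_of_le ht]
  rw [integral_integral_swap h6]
  refine integral_congr_ae (Filter.Eventually.of_forall fun t' => ?_)
  simp only [integral_const_mul, hat]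

/-! ### The localized free evolution -/

/-- The Fourier transform of `Ψ(Λt) exp (-iφ(n)t) c(n)`. -/
def free (Ψ : SchwartzMap ℝ ℂ) (Λ : ℝ) (φ : ℤ → ℝ) (c : ℤ → ℂ) (p : ℤ × ℝ) : ℂ :=
  gker Ψ Λ (p.2 + freqShift φ p.1) * c p.1

theorem measurable_free (Ψ : SchwartzMap ℝ ℂ) (Λ : ℝ) (φ : ℤ → ℝ) (c : ℤ → ℂ) :
    Measurable (free Ψ Λ φ c) := by
  have h1 := measurable_freqShift φ
  have h2 := (continuous_gker Ψ Λ).measurable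
  have h3 : Measurable c := measurable_of_countable _
  unfold free
  fun_prop

theorem isSliceIntegrable_free (Ψ : SchwartzMap ℝ ℂ) {Λ : ℝ} (hΛ : 0 < Λ) (φ : ℤ → ℝ)
    (c : ℤ → ℂ) : IsSliceIntegrable (free Ψ Λ φ c) :=
  ⟨measurable_free Ψ Λ φ c, fun n =>
    ((integrable_gker Ψ hΛ).comp_add_right (freqShift φ n)).mul_const (c n)⟩

theorem hat_free (Ψ : SchwartzMap ℝ ℂ) {Λ : ℝ} (hΛ : 0 < Λ) (φ : ℤ → ℝ) (c : ℤ → ℂ) (t : ℝ)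
    (n : ℤ) : hat (free Ψ Λ φ c) t n = Ψ (Λ * t) * (echar (-freqShift φ n) t * c n) := by
  rw [hat, ← integral_echar_mul_gker Ψ hΛ, ← integral_add_right_eq_self
    (fun x => echar x t * gker Ψ Λ x) (freqShift φ n), mul_comm, mul_assoc, ← integral_const_mul,
    ← integral_const_mul]
  congr 1
  funext ξ
  have : echar ξ t = echar (-freqShift φ n) t * echar (ξ + freqShift φ n) t := by
    rw [← echar_add_left]
    ring_nf
  simp only [free, this]
  ring

theorem free_add (Ψ : SchwartzMap ℝ ℂ) (Λ : ℝ) (φ : ℤ → ℝ) (c d : ℤ → ℂ) :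
    free Ψ Λ φ (c + d) = free Ψ Λ φ c + free Ψ Λ φ d := by
  funext p
  simp only [free, Pi.add_apply, mul_add]

theorem free_smul (Ψ : SchwartzMap ℝ ℂ) (Λ : ℝ) (φ : ℤ → ℝ) (a : ℂ) (c : ℤ → ℂ) :
    free Ψ Λ φ (a • c) = a • free Ψ Λ φ c := by
  funext p
  simp only [free, Pi.smul_apply, smul_eq_mul]
  ring

/-- Scaling: the kernel is Λ⁻¹ times a rapidly decaying function of x/Λ, and the weight is
Λ^b⟨2πx/Λ⟩^b. The L² norm is thus of order Λ^b Λ⁻¹ Λ^{1/2}. The bound on b only ensures that the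
remaining power 6 - 2b is integrable. -/
theorem exists_nsq_free_le (Ψ : SchwartzMap ℝ ℂ) {b : ℝ} (hb' : b ≤ 5 / 8) :
    ∃ C : ℝ≥0∞, C ≠ ⊤ ∧ ∀ (φ : ℤ → ℝ) (s Λ : ℝ), 1 ≤ Λ → ∀ c : ℤ → ℂ,
      nsq φ Λ s b (free Ψ Λ φ c) ≤ C * ENNReal.ofReal (Λ ^ (b - 1 / 2)) ^ 2 *
        ∑' n : ℤ, (ENNReal.ofReal (bracket n ^ s) * ‖c n‖ₑ) ^ 2 := by
  obtain ⟨C₁, hC₁, h1⟩ := exists_norm_dKer_le Ψ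
  have mb := measurable_bracket
  set J : ℝ≥0∞ := ∫⁻ x : ℝ, ENNReal.ofReal (bracket (2 * Real.pi * x) ^ (-(6 - 2 * b))) with hJ
  have hJt : J ≠ ⊤ := lintegral_bracket_rpow_ne_top (by linarith)
  refine ⟨ENNReal.ofReal C₁ ^ 2 * J, ENNReal.mul_ne_top (by simp) hJt, fun φ s Λ hΛ c => ?_⟩
  have hΛ0 : 0 < Λ := by linarith
  have key : ∫⁻ x, (ENNReal.ofReal ((Λ + |2 * Real.pi * x|) ^ b) * ‖gker Ψ Λ x‖ₑ) ^ 2 ≤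
      ENNReal.ofReal C₁ ^ 2 * ENNReal.ofReal (Λ ^ (b - 1 / 2)) ^ 2 * J := by
    calc _ ≤ ∫⁻ x, ENNReal.ofReal C₁ ^ 2 * ENNReal.ofReal (Λ ^ (2 * b - 2)) *
          ENNReal.ofReal (bracket (2 * Real.pi * (x / Λ)) ^ (-(6 - 2 * b))) := by
          refine lintegral_mono fun x => ?_
          have hB := bracket_pos (2 * Real.pi * (x / Λ))
          have h2 : Λ + |2 * Real.pi * x| = Λ * bracket (2 * Real.pi * (x / Λ)) := by
            rw [bracket, ← mul_div_assoc, abs_div, abs_of_pos hΛ0]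
            field_simp
          rw [← ofReal_norm, ← ENNReal.ofReal_mul (by positivity), ← ENNReal.ofReal_pow
            (by positivity), ← ENNReal.ofReal_pow hC₁, ← ENNReal.ofReal_mul (by positivity),
            ← ENNReal.ofReal_mul (by positivity), h2]
          refine ENNReal.ofReal_le_ofReal ?_
          have h3 := (h1 Λ hΛ).1 x
          generalize bracket (2 * Real.pi * (x / Λ)) = B at *
          calc ((Λ * B) ^ b * ‖gker Ψ Λ x‖) ^ 2
              ≤ ((Λ * B) ^ b * (C₁ * (Λ⁻¹ * B ^ (-3 : ℝ)))) ^ 2 := by gcongr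
            _ = _ := by
              have e1 : Λ ^ (2 * b - 2) = (Λ ^ b * Λ⁻¹) ^ 2 := by
                rw [← Real.rpow_neg_one Λ, ← Real.rpow_add hΛ0, ← Real.rpow_two,
                  ← Real.rpow_mul hΛ0.le]
                ring_nf
              have e2 : B ^ (-(6 - 2 * b)) = (B ^ b * B ^ (-3 : ℝ)) ^ 2 := by
                rw [← Real.rpow_add hB, ← Real.rpow_two, ← Real.rpow_mul hB.le]
                ring_nf
              rw [e1, e2, Real.mul_rpow hΛ0.le hB.le]
              ring
      _ = _ := by
          have e1 : ENNReal.ofReal (Λ ^ (b - 1 / 2)) ^ 2 =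
              ENNReal.ofReal (Λ ^ (2 * b - 2)) * ENNReal.ofReal Λ := by
            rw [← ENNReal.ofReal_pow (by positivity), ← ENNReal.ofReal_mul (by positivity)]
            congr 1
            rw [← Real.rpow_two, ← Real.rpow_mul hΛ0.le]
            nth_rewrite 3 [← Real.rpow_one Λ]
            rw [← Real.rpow_add hΛ0]
            ring_nf
          rw [lintegral_const_mul' _ _ (ENNReal.mul_ne_top (by simp) (by simp)),
            lintegral_bracket_div hΛ0, e1]
          ring
  rw [nsq_eq_tsum φ Λ s b (measurable_free Ψ Λ φ c), ← ENNReal.tsum_mul_left]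
  refine ENNReal.tsum_le_tsum fun n => ?_
  have h4 : ∫⁻ x, (ENNReal.ofReal ((Λ + |2 * Real.pi * x|) ^ b) *
      ‖free Ψ Λ φ c (n, x - freqShift φ n)‖ₑ) ^ 2 =
      (∫⁻ x, (ENNReal.ofReal ((Λ + |2 * Real.pi * x|) ^ b) * ‖gker Ψ Λ x‖ₑ) ^ 2) * ‖c n‖ₑ ^ 2 := by
    rw [← lintegral_mul_const' _ _ (by simp)]
    refine lintegral_congr fun x => ?_
    simp only [free, sub_add_cancel, enorm_mul]
    ring
  rw [h4]
  calc _ ≤ ENNReal.ofReal (bracket n ^ s) ^ 2 * ((ENNReal.ofReal C₁ ^ 2 *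
        ENNReal.ofReal (Λ ^ (b - 1 / 2)) ^ 2 * J) * ‖c n‖ₑ ^ 2) := by gcongr
    _ = _ := by ring

/-! ### Linearity and congruence -/

theorem ae_slice {P : ℤ × ℝ → Prop} (h : ∀ᵐ p ∂freqMeasure, P p) (n : ℤ) : ∀ᵐ ξ : ℝ, P (n, ξ) := by
  have h1 := Measure.ae_ae_of_ae_prod h
  rw [Measure.ae_count_iff] at h1
  exact h1 n

theorem ae_of_slices {P : ℤ × ℝ → Prop} (hP : MeasurableSet {p | P p})
    (h : ∀ n, ∀ᵐ ξ : ℝ, P (n, ξ)) : ∀ᵐ p ∂freqMeasure, P p :=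
  (Measure.ae_prod_iff_ae_ae hP).mpr (Measure.ae_count_iff.mpr h)

theorem duhamel_congr (Ψ : SchwartzMap ℝ ℂ) (Λ : ℝ) (φ : ℤ → ℝ) {K K' : ℤ × ℝ → ℂ}
    (h : K =ᵐ[freqMeasure] K') : duhamel Ψ Λ φ K = duhamel Ψ Λ φ K' := by
  funext p
  refine integral_congr_ae ?_
  filter_upwards [ae_slice h p.1] with ξ hξ
  rw [hξ]

theorem duhamel_smul (Ψ : SchwartzMap ℝ ℂ) (Λ : ℝ) (φ : ℤ → ℝ) (c : ℂ) (K : ℤ × ℝ → ℂ) :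
    duhamel Ψ Λ φ (c • K) = c • duhamel Ψ Λ φ K := by
  funext p
  simp only [duhamel, Pi.smul_apply, smul_eq_mul]
  rw [← integral_const_mul]
  congr 1
  funext ξ
  ring

theorem exists_norm_dKer_le_const (Ψ : SchwartzMap ℝ ℂ) {Λ : ℝ} (hΛ : 1 ≤ Λ) :
    ∃ C : ℝ, ∀ x' x, ‖dKer Ψ Λ x' x‖ ≤ C := by
  obtain ⟨C₁, hC₁, h1⟩ := exists_norm_dKer_le Ψ
  refine ⟨C₁ * (Λ⁻¹ * (1 + 1)), fun x' x => ((h1 Λ hΛ).2 x' x).trans ?_⟩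
  have h0 : 0 ≤ Λ⁻¹ := by positivity
  have h2 : ∀ y, bracket y ^ (-3 : ℝ) ≤ 1 := fun y =>
    Real.rpow_le_one_of_one_le_of_nonpos (one_le_bracket y) (by norm_num)
  gcongr
  exact (kerBound_le hΛ x' x).trans (by gcongr <;> exact h2 _)

theorem integrable_dKer_mul (Ψ : SchwartzMap ℝ ℂ) {Λ : ℝ} (hΛ : 1 ≤ Λ) (φ : ℤ → ℝ)
    {K : ℤ × ℝ → ℂ} (hK : IsSliceIntegrable K) (p : ℤ × ℝ) : Integrable fun ξ =>
      dKer Ψ Λ (p.2 + freqShift φ p.1) (ξ + freqShift φ p.1) * K (p.1, ξ) := by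
  obtain ⟨C, hC⟩ := exists_norm_dKer_le_const Ψ hΛ
  refine (hK.integrable p.1).bdd_mul (c := C) ?_ (Filter.Eventually.of_forall fun ξ => hC _ _)
  exact ((measurable_dKer Ψ Λ).comp (by fun_prop : Measurable fun ξ : ℝ =>
    (p.2 + freqShift φ p.1, ξ + freqShift φ p.1))).aestronglyMeasurable

theorem duhamel_add (Ψ : SchwartzMap ℝ ℂ) {Λ : ℝ} (hΛ : 1 ≤ Λ) (φ : ℤ → ℝ) {K K' : ℤ × ℝ → ℂ}
    (hK : IsSliceIntegrable K) (hK' : IsSliceIntegrable K') :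
    duhamel Ψ Λ φ (K + K') = duhamel Ψ Λ φ K + duhamel Ψ Λ φ K' := by
  funext p
  simp only [duhamel, Pi.add_apply]
  rw [← integral_add (integrable_dKer_mul Ψ hΛ φ hK p) (integrable_dKer_mul Ψ hΛ φ hK' p)]
  congr 1
  funext ξ
  ring

theorem conv_congr {G G' F F' : ℤ × ℝ → ℂ} (hG : G =ᵐ[freqMeasure] G')
    (hF : F =ᵐ[freqMeasure] F') : conv G F = conv G' F' := by
  funext p
  refine integral_congr_ae ?_
  have h := (quasiMeasurePreserving_sub_left freqMeasure p).ae_eq_comp hG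
  filter_upwards [h, hF] with q h1 h2
  simp only [Function.comp_apply] at h1
  rw [h1, h2]

theorem conv_smul_left (c : ℂ) (G F : ℤ × ℝ → ℂ) : conv (c • G) F = c • conv G F := by
  funext p
  simp only [conv, Pi.smul_apply, smul_eq_mul]
  rw [← integral_const_mul]
  congr 1
  funext q
  ring

theorem conv_smul_right (c : ℂ) (G F : ℤ × ℝ → ℂ) : conv G (c • F) = c • conv G F := by
  funext p
  simp only [conv, Pi.smul_apply, smul_eq_mul]
  rw [← integral_const_mul]
  congr 1
  funext q
  ring

theorem ae_integrable_conv {G F : ℤ × ℝ → ℂ} (hG : IsWiener G) (hF : IsWiener F) :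
    ∀ᵐ p ∂freqMeasure, Integrable (fun q => G (p - q) * F q) freqMeasure := by
  have mG := hG.measurable
  have mF := hF.measurable
  have hm : Measurable fun z : (ℤ × ℝ) × (ℤ × ℝ) => ‖G (z.1 - z.2)‖ₑ * ‖F z.2‖ₑ := by fun_prop
  have hm' : Measurable fun p => ∫⁻ q, ‖G (p - q)‖ₑ * ‖F q‖ₑ ∂freqMeasure :=
    hm.lintegral_prod_right'
  have h : ∀ᵐ p ∂freqMeasure, ∫⁻ q, ‖G (p - q)‖ₑ * ‖F q‖ₑ ∂freqMeasure < ⊤ := by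
    refine ae_of_slices (measurableSet_lt hm' measurable_const) fun n => ?_
    refine ae_lt_top (hm'.comp (by fun_prop : Measurable fun ξ : ℝ => (n, ξ))) ?_
    rw [lintegral_lintegral_conv hG hF]
    exact tsum_l1_mul_l1_ne_top hG hF n
  filter_upwards [h] with p hp
  refine ⟨by fun_prop, ?_⟩
  simpa only [hasFiniteIntegral_iff_enorm, enorm_mul] using hp

theorem conv_add_left {G G' F : ℤ × ℝ → ℂ} (hG : IsWiener G) (hG' : IsWiener G')
    (hF : IsWiener F) : conv (G + G') F =ᵐ[freqMeasure] conv G F + conv G' F := by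
  filter_upwards [ae_integrable_conv hG hF, ae_integrable_conv hG' hF] with p h1 h2
  simp only [conv, Pi.add_apply, add_mul]
  exact integral_add h1 h2

theorem conv_add_right {G F F' : ℤ × ℝ → ℂ} (hG : IsWiener G) (hF : IsWiener F)
    (hF' : IsWiener F') : conv G (F + F') =ᵐ[freqMeasure] conv G F + conv G F' := by
  filter_upwards [ae_integrable_conv hG hF, ae_integrable_conv hG hF'] with p h1 h2
  simp only [conv, Pi.add_apply, mul_add]
  exact integral_add h1 h2

theorem cnj_congr {F F' : ℤ × ℝ → ℂ} (h : F =ᵐ[freqMeasure] F') :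
    cnj F =ᵐ[freqMeasure] cnj F' := by
  have h := (Measure.measurePreserving_neg freqMeasure).quasiMeasurePreserving.ae_eq_comp h
  filter_upwards [h] with p hp
  simp only [Function.comp_apply] at hp
  rw [cnj, cnj, hp]

theorem cnj_add (F F' : ℤ × ℝ → ℂ) : cnj (F + F') = cnj F + cnj F' := by
  funext p
  simp [cnj]

theorem cnj_smul (c : ℂ) (F : ℤ × ℝ → ℂ) : cnj (c • F) = starRingEnd ℂ c • cnj F := by
  funext p
  simp [cnj]

theorem dx_congr (L : ℝ) {F F' : ℤ × ℝ → ℂ} (h : F =ᵐ[freqMeasure] F') :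
    dx L F =ᵐ[freqMeasure] dx L F' := by
  filter_upwards [h] with p hp
  rw [dx, dx, hp]

theorem dx_add (L : ℝ) (F F' : ℤ × ℝ → ℂ) : dx L (F + F') = dx L F + dx L F' := by
  funext p
  simp only [dx, Pi.add_apply, mul_add]

theorem dx_smul (L : ℝ) (c : ℂ) (F : ℤ × ℝ → ℂ) : dx L (c • F) = c • dx L F := by
  funext p
  simp only [dx, Pi.smul_apply, smul_eq_mul]
  ring

section

/-! ### The Fourier transform of integrable functions in `L²(ℝ)` -/

/-- The inverse transform on L² is an abstract extension, so it is identified through its action on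
test functions: as a tempered distribution it moves onto the test function, and Fubini returns the
absolutely convergent integral. -/
theorem fourierInv_Lp_ae_eq (h : Lp ℂ 2 (volume : Measure ℝ)) (hi : Integrable h) :
    (𝓕⁻ h : Lp ℂ 2 (volume : Measure ℝ)) =ᵐ[volume] fun t => ∫ ξ, echar ξ t * h ξ := by
  have hc : Continuous fun t => ∫ ξ, echar ξ t * h ξ := by
    refine continuous_of_dominated (bound := fun ξ => ‖h ξ‖) (fun t => ?_) (fun t => ?_) hi.norm
      (Filter.Eventually.of_forall fun ξ => (continuous_echar_right ξ).mul continuous_const)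
    · exact (measurable_echar t).aestronglyMeasurable.mul hi.1
    · refine Filter.Eventually.of_forall fun ξ => ?_
      rw [norm_mul, norm_echar, one_mul]
  refine ae_eq_of_integral_contDiff_smul_eq ((Lp.memLp _).locallyIntegrable (by norm_num))
    hc.locallyIntegrable fun g g_smooth g_cpt => ?_
  have hg₁ : HasCompactSupport (Complex.ofRealCLM ∘ g) := g_cpt.comp_left rfl
  have hg₂ : ContDiff ℝ ∞ (Complex.ofRealCLM ∘ g) := by fun_prop
  set G := hg₁.toSchwartzMap hg₂ with hG
  have hGi : Integrable G := G.integrable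
  have e1 : ∫ x, g x • (𝓕⁻ h : Lp ℂ 2 (volume : Measure ℝ)) x =
      Lp.toTemperedDistribution (𝓕⁻ h : Lp ℂ 2 (volume : Measure ℝ)) G := by
    rw [Lp.toTemperedDistribution_apply]
    rfl
  rw [e1, ← Lp.fourierInv_toTemperedDistribution_eq, TemperedDistribution.fourierInv_apply,
    Lp.toTemperedDistribution_apply]
  have e2 : ∀ ξ, (𝓕⁻ G) ξ • h ξ = ∫ t, echar ξ t * (G t * h ξ) := by
    intro ξ
    rw [SchwartzMap.fourierInv_coe, fourierInv_eq_echar, smul_eq_mul, ← integral_mul_const]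
    congr 1
    funext t
    rw [show echar t ξ = echar ξ t by rw [echar, echar]; ring_nf]
    ring
  simp only [e2]
  rw [integral_integral_swap]
  · congr 1
    funext t
    rw [← integral_smul]
    congr 1
    funext ξ
    have : G t = (g t : ℂ) := rfl
    rw [this, Complex.real_smul]
    ring
  · have h1 : Integrable (fun z : ℝ × ℝ => G z.2 * h z.1) (volume.prod volume) :=
      ((hi.mul_prod hGi).congr (Filter.Eventually.of_forall fun z => mul_comm _ _))
    refine h1.bdd_mul (c := 1) ?_ (Filter.Eventually.of_forall fun z => (norm_echar z.1 z.2).le)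
    refine Continuous.aestronglyMeasurable ?_
    unfold echar
    fun_prop

/-! ### Fourier series in `L²(𝕋)` -/

variable {L : ℝ} [Fact (0 < L)]

theorem L2T_ext {f g : L2T L} (h : ∀ n, fourierCoeff f n = fourierCoeff g n) : f = g := by
  rw [← sub_eq_zero]
  refine eq_zero_of_coeffL fun n => ?_
  rw [map_sub, coeffL_apply, coeffL_apply, h n, sub_self]

/-- The function with the given square-summable Fourier coefficients. -/
def ofCoeff (L : ℝ) [Fact (0 < L)] : lp (fun _ : ℤ => ℂ) 2 ≃ₗᵢ[ℂ] L2T L :=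
  (fourierBasis (T := L)).repr.symm

theorem fourierCoeff_ofCoeff (c : lp (fun _ : ℤ => ℂ) 2) (n : ℤ) :
    fourierCoeff (ofCoeff L c) n = c n := by
  rw [ofCoeff, ← fourierBasis_repr, LinearIsometryEquiv.apply_symm_apply]

theorem fourierCoeff_star (f : L2T L) (n : ℤ) :
    fourierCoeff (star f : L2T L) n = starRingEnd ℂ (fourierCoeff f (-n)) := by
  rw [fourierCoeff, fourierCoeff, ← integral_conj]
  refine integral_congr_ae ?_
  filter_upwards [Lp.coeFn_star f] with x hx
  rw [hx]
  simp

theorem isRealValued_iff_star {f : L2T L} : IsRealValued f ↔ star f = f := by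
  rw [Lp.ext_iff]
  constructor
  · intro h
    filter_upwards [h, Lp.coeFn_star f] with x h1 h2
    rw [h2]
    exact Complex.conj_eq_iff_im.mpr h1
  · intro h
    unfold IsRealValued
    filter_upwards [h, Lp.coeFn_star f] with x h1 h2
    rw [h2] at h1
    exact Complex.conj_eq_iff_im.mp h1

theorem isRealValued_iff_fourierCoeff {f : L2T L} :
    IsRealValued f ↔ ∀ n, fourierCoeff f (-n) = starRingEnd ℂ (fourierCoeff f n) := by
  rw [isRealValued_iff_star]
  constructor
  · intro h n
    conv_lhs => rw [← h]
    rw [fourierCoeff_star, neg_neg]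
  · intro h
    refine L2T_ext fun n => ?_
    rw [fourierCoeff_star, h n, Complex.conj_conj]

/-- The product is only integrable, but its n-th coefficient is the L² inner product of e_n ḡ with
f, to which Parseval applies. -/
theorem fourierCoeff_mul_eq_tsum (g f : L2T L) (n : ℤ) :
    fourierCoeff (fun x => g x * f x) n = ∑' m, fourierCoeff f m * fourierCoeff g (n - m) := by
  have hm : MemLp (fun x => fourier n x * starRingEnd ℂ (g x)) 2
      (AddCircle.haarAddCircle : Measure (AddCircle L)) := by
    refine (Lp.memLp g).of_le ?_ (Filter.Eventually.of_forall fun x => ?_)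
    · exact ((fourier n).continuous.aestronglyMeasurable).mul
        (Complex.continuous_conj.comp_aestronglyMeasurable (Lp.aestronglyMeasurable g))
    · rw [norm_mul, fourier_apply, Circle.norm_coe, one_mul, RCLike.norm_conj]
  set h : L2T L := hm.toLp _ with hh
  have hae := hm.coeFn_toLp
  have e1 : fourierCoeff (fun x => g x * f x) n = inner ℂ h f := by
    rw [L2.inner_def, fourierCoeff]
    refine integral_congr_ae ?_
    filter_upwards [hae] with x hx
    rw [hh, hx]
    simp
    ring
  have e2 : ∀ m, inner ℂ h (fourierBasis (T := L) m) = fourierCoeff g (n - m) := by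
    intro m
    rw [L2.inner_def, fourierCoeff, coe_fourierBasis]
    refine integral_congr_ae ?_
    filter_upwards [hae, coeFn_fourierLp (T := L) 2 m] with x hx hx'
    rw [hh, hx, hx', show -(n - m) = m + -n by ring, fourier_add]
    simp
    ring
  rw [e1, ← (fourierBasis (T := L)).tsum_inner_mul_inner]
  congr 1
  funext m
  rw [e2, ← HilbertBasis.repr_apply_apply, fourierBasis_repr]
  ring

theorem fourierCoeff_norm_sq_eq_tsum (f : L2T L) (n : ℤ) :
    fourierCoeff (fun x => ((‖f x‖ ^ 2 : ℝ) : ℂ)) n =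
      ∑' m, fourierCoeff f m * starRingEnd ℂ (fourierCoeff f (m - n)) := by
  have h : fourierCoeff (fun x => ((‖f x‖ ^ 2 : ℝ) : ℂ)) n =
      fourierCoeff (fun x => (star f : L2T L) x * f x) n := by
    rw [fourierCoeff, fourierCoeff]
    refine integral_congr_ae ?_
    filter_upwards [Lp.coeFn_star f] with x hx
    rw [hx]
    simp only [Pi.star_apply, RCLike.star_def]
    rw [mul_comm ((starRingEnd ℂ) (f x)), Complex.mul_conj, Complex.normSq_eq_norm_sq]
  rw [h, fourierCoeff_mul_eq_tsum]
  congr 1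
  funext m
  rw [fourierCoeff_star, neg_sub]

end

section

/-! ### Sobolev norms of sequences -/

/-- The square of the `H^s` norm of the function with Fourier coefficients `c`, up to constants. -/
def sobSq (s : ℝ) (c : ℤ → ℂ) : ℝ≥0∞ := ∑' n : ℤ, (ENNReal.ofReal (bracket n ^ s) * ‖c n‖ₑ) ^ 2

theorem enorm_sq_lp (x : lp (fun _ : ℤ => ℂ) 2) : ‖x‖ₑ ^ 2 = ∑' n, ‖x n‖ₑ ^ 2 := by
  have h := lp.norm_rpow_eq_tsum (p := 2) (by norm_num) x
  have h2 := (lp.memℓp x).summable (by norm_num)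
  norm_num at h h2
  rw [← ofReal_norm, ← ENNReal.ofReal_pow (norm_nonneg _), h,
    ENNReal.ofReal_tsum_of_nonneg (fun n => by positivity) h2]
  congr 1
  funext n
  rw [ENNReal.ofReal_pow (norm_nonneg _), ofReal_norm]

theorem memℓp_of_tsum_enorm {c : ℤ → ℂ} (h : ∑' n, ‖c n‖ₑ ^ 2 ≠ ⊤) : Memℓp c 2 := by
  rw [memℓp_gen_iff (by norm_num)]
  have h1 := ENNReal.summable_toReal h
  refine h1.congr fun n => ?_
  simp

variable {L : ℝ} [Fact (0 < L)]

theorem enorm_sq_L2T (f : L2T L) : ‖f‖ₑ ^ 2 = ∑' n, ‖fourierCoeff f n‖ₑ ^ 2 := by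
  have h := enorm_sq_lp ((fourierBasis (T := L)).repr f)
  have h2 : ‖(fourierBasis (T := L)).repr f‖ₑ = ‖f‖ₑ := by
    rw [← ofReal_norm, ← ofReal_norm, LinearIsometryEquiv.norm_map]
  simpa only [h2, fourierBasis_repr] using h

theorem one_add_sq_rpow_le {s : ℝ} (hs : 0 ≤ s) (n : ℤ) :
    (1 + (n : ℝ) ^ 2) ^ (s / 2) ≤ bracket n ^ s := by
  have h1 : 1 + (n : ℝ) ^ 2 ≤ bracket n ^ 2 := by
    rw [bracket, ← sq_abs (n : ℝ)]
    nlinarith [abs_nonneg (n : ℝ)]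
  calc (1 + (n : ℝ) ^ 2) ^ (s / 2) ≤ (bracket n ^ 2) ^ (s / 2) :=
        Real.rpow_le_rpow (by positivity) h1 (by linarith)
    _ = bracket n ^ s := by
        rw [← Real.rpow_natCast, ← Real.rpow_mul (bracket_pos _).le]
        congr 1
        push_cast
        ring

theorem bracket_rpow_le {s : ℝ} (hs : 0 ≤ s) (n : ℤ) :
    bracket n ^ s ≤ 2 ^ (s / 2) * (1 + (n : ℝ) ^ 2) ^ (s / 2) := by
  have h1 : bracket n ^ 2 ≤ 2 * (1 + (n : ℝ) ^ 2) := by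
    rw [bracket, ← sq_abs (n : ℝ)]
    nlinarith [sq_nonneg (1 - |(n : ℝ)|)]
  calc bracket n ^ s = (bracket n ^ 2) ^ (s / 2) := by
        rw [← Real.rpow_natCast, ← Real.rpow_mul (bracket_pos _).le]
        congr 1
        push_cast
        ring
    _ ≤ (2 * (1 + (n : ℝ) ^ 2)) ^ (s / 2) :=
        Real.rpow_le_rpow (by positivity) h1 (by linarith)
    _ = _ := Real.mul_rpow (by norm_num) (by positivity)

theorem enorm_sobolevSeq (s : ℝ) (f : L2T L) (n : ℤ) : ‖sobolevSeq L s f n‖ₑ =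
    ENNReal.ofReal (Real.sqrt L) * (ENNReal.ofReal ((1 + (n : ℝ) ^ 2) ^ (s / 2)) *
      ‖fourierCoeff f n‖ₑ) := by
  rw [sobolevSeq, enorm_mul, ← ofReal_norm, Complex.norm_real, Real.norm_of_nonneg
    (by positivity), ENNReal.ofReal_mul (Real.sqrt_nonneg _), mul_assoc]

theorem tsum_sobolevSeq_le {s : ℝ} (hs : 0 ≤ s) (f : L2T L) :
    ∑' n, ‖sobolevSeq L s f n‖ₑ ^ 2 ≤ ENNReal.ofReal (Real.sqrt L) ^ 2 *
      sobSq s (fourierCoeff f) := by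
  rw [sobSq, ← ENNReal.tsum_mul_left]
  refine ENNReal.tsum_le_tsum fun n => ?_
  rw [enorm_sobolevSeq, mul_pow]
  gcongr
  exact one_add_sq_rpow_le hs n

theorem Hs.enorm_sq {s : ℝ} (f : Hs L s) : ‖f‖ₑ ^ 2 = ∑' n, ‖sobolevSeq L s f.toL2 n‖ₑ ^ 2 :=
  enorm_sq_lp (Hs.toSeq f)

theorem Hs.enorm_sq_le {s : ℝ} (hs : 0 ≤ s) (f : Hs L s) :
    ‖f‖ₑ ^ 2 ≤ ENNReal.ofReal (Real.sqrt L) ^ 2 * sobSq s (fourierCoeff f.toL2) :=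
  (Hs.enorm_sq f).trans_le (tsum_sobolevSeq_le hs _)

theorem Hs.sobSq_le {s : ℝ} (hs : 0 ≤ s) (f : Hs L s) :
    sobSq s (fourierCoeff f.toL2) ≤
      ENNReal.ofReal (2 ^ (s / 2) / Real.sqrt L) ^ 2 * ‖f‖ₑ ^ 2 := by
  have hL : 0 < L := Fact.out
  rw [Hs.enorm_sq, sobSq, ← ENNReal.tsum_mul_left]
  refine ENNReal.tsum_le_tsum fun n => ?_
  rw [enorm_sobolevSeq, ← mul_pow, ← mul_assoc, ← mul_assoc, ← ENNReal.ofReal_mul (by positivity),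
    ← ENNReal.ofReal_mul (by positivity)]
  gcongr
  refine (bracket_rpow_le hs n).trans (le_of_eq ?_)
  have := Real.sqrt_pos.mpr hL
  field_simp

theorem tsum_enorm_sq_le_sobSq {s : ℝ} (hs : 0 ≤ s) (c : ℤ → ℂ) :
    ∑' n, ‖c n‖ₑ ^ 2 ≤ sobSq s c := by
  refine ENNReal.tsum_le_tsum fun n => ?_
  gcongr
  refine le_mul_of_one_le_left zero_le ?_
  rw [ENNReal.one_le_ofReal]
  exact Real.one_le_rpow (one_le_bracket _) hs

theorem exists_Hs_fourierCoeff_eq {s : ℝ} (hs : 0 ≤ s) {c : ℤ → ℂ} (hc : sobSq s c ≠ ⊤) :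
    ∃ f : Hs L s, ∀ n, fourierCoeff f.toL2 n = c n := by
  have h1 : Memℓp c 2 :=
    memℓp_of_tsum_enorm (ne_top_of_le_ne_top hc (tsum_enorm_sq_le_sobSq hs c))
  set g : L2T L := ofCoeff L ⟨c, h1⟩ with hg
  have h2 : ∀ n, fourierCoeff g n = c n := fun n => fourierCoeff_ofCoeff _ n
  have h3 : Memℓp (sobolevSeq L s g) 2 := by
    refine memℓp_of_tsum_enorm (ne_top_of_le_ne_top ?_ (tsum_sobolevSeq_le hs g))
    rw [show fourierCoeff g = c from funext h2]
    exact ENNReal.mul_ne_top (by simp) hc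
  exact ⟨⟨g, h3⟩, h2⟩

theorem Hs.ext {s : ℝ} {f g : Hs L s}
    (h : ∀ n, fourierCoeff f.toL2 n = fourierCoeff g.toL2 n) : f = g :=
  Subtype.ext (L2T_ext h)

theorem fourierCoeff_add_L2T (f g : L2T L) (n : ℤ) :
    fourierCoeff (f + g : L2T L) n = fourierCoeff f n + fourierCoeff g n := by
  simp only [← coeffL_apply, map_add]

theorem fourierCoeff_sub_L2T (f g : L2T L) (n : ℤ) :
    fourierCoeff (f - g : L2T L) n = fourierCoeff f n - fourierCoeff g n := by
  simp only [← coeffL_apply, map_sub]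

theorem fourierCoeff_smul_L2T (c : ℂ) (f : L2T L) (n : ℤ) :
    fourierCoeff (c • f : L2T L) n = c * fourierCoeff f n := by
  simp only [← coeffL_apply, map_smul, smul_eq_mul]

theorem Hs.continuous_toL2 {s : ℝ} (hs : 0 ≤ s) : Continuous (Hs.toL2 : Hs L s → L2T L) := by
  have hL : 0 < L := Fact.out
  refine AddMonoidHomClass.continuous_of_bound (Hs.toL2 : Hs L s →ₗ[ℂ] L2T L)
    (2 ^ (s / 2) / Real.sqrt L) fun f => ?_
  have h : ‖f.toL2‖ₑ ^ 2 ≤ (ENNReal.ofReal (2 ^ (s / 2) / Real.sqrt L) * ‖f‖ₑ) ^ 2 := by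
    rw [enorm_sq_L2T, mul_pow]
    exact (tsum_enorm_sq_le_sobSq hs _).trans (Hs.sobSq_le hs f)
  have h2 := (ENNReal.pow_le_pow_left_iff two_ne_zero).mp h
  rw [← ofReal_norm, ← ofReal_norm, ← ENNReal.ofReal_mul (by positivity)] at h2
  exact (ENNReal.ofReal_le_ofReal_iff (by positivity)).mp h2

theorem sobSq_hat_le (s : ℝ) (F : ℤ × ℝ → ℂ) (t : ℝ) :
    sobSq s (hat F t) ≤ ∑' n : ℤ, (ENNReal.ofReal (bracket n ^ s) * l1 F n) ^ 2 := by
  refine ENNReal.tsum_le_tsum fun n => ?_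
  gcongr
  exact enorm_hat_le F t n

/-- Each coefficient is continuous in time, and the squared weighted differences are dominated by 4
times the summable squares of the slice L¹ norms. Dominated convergence over n gives convergence in
the Sobolev norm. -/
theorem Hs.continuous_of_hat {s : ℝ} (hs : 0 ≤ s) {F : ℤ × ℝ → ℂ} (hF : IsSliceIntegrable F)
    (h : ∑' n : ℤ, (ENNReal.ofReal (bracket n ^ s) * l1 F n) ^ 2 ≠ ⊤) {f : ℝ → Hs L s}
    (hf : ∀ t n, fourierCoeff (f t).toL2 n = hat F t n) : Continuous f := by
  rw [continuous_iff_continuousAt]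
  intro t₀
  have key : Filter.Tendsto (fun t => sobSq s fun n => hat F t n - hat F t₀ n) (nhds t₀)
      (nhds 0) := by
    simp only [sobSq, ← lintegral_count]
    have h0 : (0 : ℝ≥0∞) = ∫⁻ _ : ℤ, 0 ∂Measure.count := by simp
    rw [h0]
    refine tendsto_lintegral_filter_of_dominated_convergence
      (fun n : ℤ => 2 ^ 2 * (ENNReal.ofReal (bracket n ^ s) * l1 F n) ^ 2)
      (Filter.Eventually.of_forall fun t => measurable_of_countable _) ?_ ?_ ?_
    · refine Filter.Eventually.of_forall fun t => Filter.Eventually.of_forall fun n => ?_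
      rw [← mul_pow, mul_left_comm]
      gcongr
      refine (enorm_sub_le).trans ?_
      rw [two_mul]
      exact add_le_add (enorm_hat_le F t n) (enorm_hat_le F t₀ n)
    · rw [lintegral_const_mul' _ _ (by simp), lintegral_count]
      exact ENNReal.mul_ne_top (by simp) h
    · refine Filter.Eventually.of_forall fun n => ?_
      have h1 : Continuous fun t => (ENNReal.ofReal (bracket n ^ s) *
          ‖hat F t n - hat F t₀ n‖ₑ) ^ 2 := by
        have := hF.continuous_hat n
        refine (ENNReal.continuous_pow 2).comp ((ENNReal.continuous_const_mul (by simp)).comp ?_)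
        fun_prop
      have h2 := h1.tendsto t₀
      simpa using h2
  rw [ContinuousAt, tendsto_iff_edist_tendsto_0]
  have key2 : Filter.Tendsto (fun t => edist (f t) (f t₀) ^ 2) (nhds t₀) (nhds 0) := by
    have h1 := ENNReal.Tendsto.const_mul (a := ENNReal.ofReal (Real.sqrt L) ^ 2) key
      (Or.inr (by simp))
    rw [mul_zero] at h1
    refine tendsto_of_tendsto_of_tendsto_of_le_of_le tendsto_const_nhds h1
      (fun t => zero_le) fun t => ?_
    simp only [edist_eq_enorm_sub]
    refine (Hs.enorm_sq_le hs _).trans (le_of_eq ?_)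
    congr 2
    funext n
    rw [map_sub, fourierCoeff_sub_L2T, hf, hf]
  have h3 := (ENNReal.continuous_rpow_const (y := 1 / 2)).tendsto 0 |>.comp key2
  rw [ENNReal.zero_rpow_of_pos (by norm_num)] at h3
  refine h3.congr fun t => ?_
  simp only [Function.comp_apply]
  rw [← ENNReal.rpow_two, ← ENNReal.rpow_mul]
  norm_num

end

section

variable {L : ℝ} [Fact (0 < L)]

/-! ### Analysis and synthesis in Bourgain spaces -/

/-- The space-time Fourier transform of `u` as a function on `ℤ × ℝ`. -/
def stf (u : L2RT L) (p : ℤ × ℝ) : ℂ := spaceTimeFourier u p.1 p.2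

theorem measurable_stf (u : L2RT L) : Measurable (stf u) := measurable_spaceTimeFourier u

theorem bourgainFun_eq (φ : ℤ → ℝ) (s b : ℝ) (u : L2RT L) (p : ℤ × ℝ) :
    bourgainFun φ s b u p = (wt φ 1 s b p : ℂ) * stf u p := rfl

theorem eLpNorm_two_sq {α E : Type*} [MeasurableSpace α] [NormedAddCommGroup E] (μ : Measure α)
    (f : α → E) : eLpNorm f 2 μ ^ 2 = ∫⁻ x, ‖f x‖ₑ ^ 2 ∂μ := by
  rw [eLpNorm_eq_lintegral_rpow_enorm_toReal (by norm_num) (by norm_num)]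
  norm_num
  rw [← ENNReal.rpow_natCast, ← ENNReal.rpow_mul]
  norm_num

theorem enorm_sq_Lp (f : Lp ℂ 2 freqMeasure) : ‖f‖ₑ ^ 2 = ∫⁻ p, ‖f p‖ₑ ^ 2 ∂freqMeasure := by
  rw [Lp.enorm_def, eLpNorm_two_sq]

theorem memLp_two_of_lintegral {α E : Type*} [MeasurableSpace α] [NormedAddCommGroup E]
    {μ : Measure α} {f : α → E} (hf : AEStronglyMeasurable f μ)
    (h : ∫⁻ x, ‖f x‖ₑ ^ 2 ∂μ ≠ ⊤) : MemLp f 2 μ := by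
  refine ⟨hf, ?_⟩
  rw [← eLpNorm_two_sq] at h
  rw [lt_top_iff_ne_top]
  rintro h1
  simp [h1] at h

theorem enorm_wt_mul {φ : ℤ → ℝ} {Λ s b : ℝ} (hΛ : 1 ≤ Λ) (F : ℤ × ℝ → ℂ) (p : ℤ × ℝ) :
    ‖(wt φ Λ s b p : ℂ) * F p‖ₑ = ENNReal.ofReal (wt φ Λ s b p) * ‖F p‖ₑ := by
  rw [enorm_mul, ← ofReal_norm, Complex.norm_real, Real.norm_of_nonneg (wt_pos hΛ p).le]

theorem Bourgain.enorm_sq {φ : ℤ → ℝ} {s b : ℝ} (u : Bourgain L φ s b) :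
    ‖u‖ₑ ^ 2 = nsq φ 1 s b (stf u.toL2) := by
  have h : ‖u‖ₑ = eLpNorm (bourgainFun φ s b u.toL2) 2 freqMeasure := by
    rw [← ofReal_norm, Bourgain.norm_eq, ENNReal.ofReal_toReal u.memLp.2.ne]
  rw [h, eLpNorm_two_sq, nsq]
  refine lintegral_congr fun p => ?_
  rw [bourgainFun_eq, enorm_wt_mul le_rfl]

theorem Bourgain.nsq_ne_top {φ : ℤ → ℝ} {s b : ℝ} (u : Bourgain L φ s b) :
    nsq φ 1 s b (stf u.toL2) ≠ ⊤ := by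
  rw [← Bourgain.enorm_sq]
  simp

theorem Bourgain.ae_fourierCoeff_eq_hat {φ : ℤ → ℝ} {s b : ℝ} (hs : 0 ≤ s) (hb : 1 / 2 < b)
    (u : Bourgain L φ s b) : ∀ᵐ t, ∀ n, fourierCoeff (u.toL2 t) n = hat (stf u.toL2) t n := by
  have hW := isWiener_of_nsq hs hb (measurable_stf u.toL2) u.nsq_ne_top
  rw [ae_all_iff]
  intro n
  have h1 := fourierInv_Lp_ae_eq (spaceTimeFourier u.toL2 n) (hW.isSliceIntegrable.integrable n)
  rw [spaceTimeFourier, FourierTransform.fourierInv_fourier_eq] at h1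
  filter_upwards [h1, (coeffL L n).coeFn_compLp u.toL2] with t h2 h3
  rw [← coeffL_apply, ← h3, h2]
  rfl

theorem hat_congr {F F' : ℤ × ℝ → ℂ} (h : F =ᵐ[freqMeasure] F') (t : ℝ) (n : ℤ) :
    hat F t n = hat F' t n := by
  refine integral_congr_ae ?_
  filter_upwards [ae_slice h n] with ξ hξ
  rw [hξ]

theorem nsq_congr (φ : ℤ → ℝ) (Λ s b : ℝ) {F F' : ℤ × ℝ → ℂ} (h : F =ᵐ[freqMeasure] F') :
    nsq φ Λ s b F = nsq φ Λ s b F' := by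
  refine lintegral_congr_ae ?_
  filter_upwards [h] with p hp
  rw [hp]

theorem one_le_wt {φ : ℤ → ℝ} {Λ s b : ℝ} (hΛ : 1 ≤ Λ) (hs : 0 ≤ s) (hb : 0 ≤ b) (p : ℤ × ℝ) :
    1 ≤ wt φ Λ s b p := by
  unfold wt
  have h1 : 1 ≤ (Λ + |modulation φ p|) ^ b :=
    Real.one_le_rpow (by linarith [abs_nonneg (modulation φ p)]) hb
  have h2 : 1 ≤ bracket (p.1 : ℝ) ^ s := Real.one_le_rpow (one_le_bracket _) hs
  exact one_le_mul_of_one_le_of_one_le h1 h2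

/-- Surjectivity of the space-time Fourier transform onto the weighted L² space. The slices are
integrable, so `hat F t` defines a continuous curve in L²(𝕋). Plancherel slice by slice shows that
this curve is square integrable in time, and Fourier inversion identifies its transform with F. -/
theorem exists_bourgain_stf_eq (L : ℝ) [Fact (0 < L)] {φ : ℤ → ℝ} {s b : ℝ} (hs : 0 ≤ s)
    (hb : 1 / 2 < b) {F : ℤ × ℝ → ℂ} (hF : Measurable F) (h : nsq φ 1 s b F ≠ ⊤) :
    ∃ u : Bourgain L φ s b, stf u.toL2 =ᵐ[freqMeasure] F := by
  have hW := isWiener_of_nsq hs hb hF h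
  have hS := hW.isSliceIntegrable
  have hl : ∑' n : ℤ, (ENNReal.ofReal (bracket n ^ (0 : ℝ)) * l1 F n) ^ 2 ≠ ⊤ := by
    simpa using hW.summable
  choose f hf using fun t => exists_Hs_fourierCoeff_eq (L := L) le_rfl
    (ne_top_of_le_ne_top hl (sobSq_hat_le 0 F t))
  have hc : Continuous fun t => (f t).toL2 :=
    (Hs.continuous_toL2 le_rfl).comp (Hs.continuous_of_hat le_rfl hS hl hf)
  have hsq : ∑' n, ∫⁻ ξ, ‖F (n, ξ)‖ₑ ^ 2 ≠ ⊤ := by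
    rw [← lintegral_freqMeasure (f := fun p => ‖F p‖ₑ ^ 2) (by fun_prop)]
    refine ne_top_of_le_ne_top h (lintegral_mono fun p => ?_)
    gcongr
    refine le_mul_of_one_le_left zero_le ?_
    rw [ENNReal.one_le_ofReal]
    exact one_le_wt le_rfl hs (by linarith) p
  have hFn : ∀ n, MemLp (fun ξ => F (n, ξ)) 2 volume := fun n =>
    memLp_two_of_lintegral (measurable_slice hF n).aestronglyMeasurable
      (ENNReal.ne_top_of_tsum_ne_top hsq n)
  have hinv : ∀ n, (𝓕⁻ ((hFn n).toLp) : Lp ℂ 2 (volume : Measure ℝ)) =ᵐ[volume]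
      fun t => hat F t n := by
    intro n
    have hae := (hFn n).coeFn_toLp
    refine (fourierInv_Lp_ae_eq _ ((hS.integrable n).congr hae.symm)).trans
      (Filter.Eventually.of_forall fun t => ?_)
    refine integral_congr_ae ?_
    filter_upwards [hae] with ξ hξ
    rw [hξ]
  have hpl : ∀ n, ∫⁻ t, ‖hat F t n‖ₑ ^ 2 = ∫⁻ ξ, ‖F (n, ξ)‖ₑ ^ 2 := by
    intro n
    rw [← eLpNorm_two_sq, ← eLpNorm_two_sq, ← eLpNorm_congr_ae (hinv n),
      ← eLpNorm_congr_ae (hFn n).coeFn_toLp, ← Lp.enorm_def, ← Lp.enorm_def, ← ofReal_norm,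
      ← ofReal_norm, ← Lp.norm_fourier_eq, FourierTransform.fourier_fourierInv_eq]
  have hmem : MemLp (fun t => (f t).toL2) 2 volume := by
    refine memLp_two_of_lintegral hc.aestronglyMeasurable ?_
    have h1 : ∀ t, ‖(f t).toL2‖ₑ ^ 2 = ∑' n, ‖hat F t n‖ₑ ^ 2 := fun t => by
      rw [enorm_sq_L2T]
      simp only [hf]
    simp only [h1]
    rw [lintegral_tsum fun n => by
      have := (hS.continuous_hat n).measurable
      fun_prop]
    simpa only [hpl] using hsq
  have hst : ∀ n, spaceTimeFourier (hmem.toLp) n = (hFn n).toLp := by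
    intro n
    rw [spaceTimeFourier]
    have h1 : (coeffL L n).compLp (hmem.toLp) = 𝓕⁻ ((hFn n).toLp) := by
      ext1
      filter_upwards [(coeffL L n).coeFn_compLp hmem.toLp, hinv n, hmem.coeFn_toLp] with t h1 h2 h3
      rw [h1, h2, h3, coeffL_apply, hf]
    rw [h1, FourierTransform.fourier_fourierInv_eq]
  have hae : stf (hmem.toLp) =ᵐ[freqMeasure] F := by
    refine ae_of_slices (measurableSet_eq_fun (measurable_stf _) hF) fun n => ?_
    simp only [stf, hst]
    exact (hFn n).coeFn_toLp
  have hB : MemLp (bourgainFun φ s b hmem.toLp) 2 freqMeasure := by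
    refine memLp_two_of_lintegral ?_ ?_
    · refine Measurable.aestronglyMeasurable ?_
      have := measurable_wt φ 1 s b
      have := measurable_stf (hmem.toLp)
      simp only [funext (bourgainFun_eq φ s b hmem.toLp)]
      fun_prop
    · rw [← nsq_congr φ 1 s b hae] at h
      simpa only [nsq, bourgainFun_eq, enorm_wt_mul le_rfl] using h
  exact ⟨⟨hmem.toLp, hB⟩, hae⟩

theorem Bourgain.ext_stf {φ : ℤ → ℝ} {s b : ℝ} {u v : Bourgain L φ s b}
    (h : stf u.toL2 =ᵐ[freqMeasure] stf v.toL2) : u = v := by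
  refine Bourgain.toFreq_injective (MemLp.toLp_congr u.memLp v.memLp ?_)
  filter_upwards [h] with p hp
  rw [bourgainFun_eq, bourgainFun_eq, hp]

theorem stf_add (u v : L2RT L) : stf (u + v) =ᵐ[freqMeasure] stf u + stf v := by
  refine ae_of_slices (measurableSet_eq_fun (measurable_stf _)
    ((measurable_stf u).add (measurable_stf v))) fun n => ?_
  simp only [stf, spaceTimeFourier_add, Pi.add_apply]
  exact Lp.coeFn_add _ _

theorem stf_smul (c : ℂ) (u : L2RT L) : stf (c • u) =ᵐ[freqMeasure] c • stf u := by
  refine ae_of_slices (measurableSet_eq_fun (measurable_stf _)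
    ((measurable_stf u).const_smul c)) fun n => ?_
  simp only [stf, spaceTimeFourier_smul, Pi.smul_apply]
  exact Lp.coeFn_smul _ _

end

section

/-! ### Bounded linear maps given by frequency functions -/

theorem norm_le_of_enorm_sq_le {E E' : Type*} [NormedAddCommGroup E] [NormedAddCommGroup E']
    {x : E} {y : E'} {C : ℝ≥0} (h : ‖x‖ₑ ^ 2 ≤ (C : ℝ≥0∞) ^ 2 * ‖y‖ₑ ^ 2) : ‖x‖ ≤ C * ‖y‖ := by
  rw [← mul_pow] at h
  have h2 := (ENNReal.pow_le_pow_left_iff two_ne_zero).mp h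
  rw [enorm_eq_nnnorm, enorm_eq_nnnorm, ← ENNReal.coe_mul, ENNReal.coe_le_coe] at h2
  exact_mod_cast h2

/-- `F = f / wt`, for `f` in `L²(ℤ × ℝ)`. -/
def unweight (φ : ℤ → ℝ) (Λ s b : ℝ) (f : Lp ℂ 2 freqMeasure) (p : ℤ × ℝ) : ℂ :=
  f p / (wt φ Λ s b p : ℂ)

theorem measurable_unweight (φ : ℤ → ℝ) (Λ s b : ℝ) (f : Lp ℂ 2 freqMeasure) :
    Measurable (unweight φ Λ s b f) := by
  have := measurable_wt φ Λ s b
  have := (Lp.stronglyMeasurable f).measurable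
  unfold unweight
  fun_prop

theorem unweight_add (φ : ℤ → ℝ) (Λ s b : ℝ) (f g : Lp ℂ 2 freqMeasure) :
    unweight φ Λ s b (f + g) =ᵐ[freqMeasure] unweight φ Λ s b f + unweight φ Λ s b g := by
  filter_upwards [Lp.coeFn_add f g] with p hp
  simp only [unweight, Pi.add_apply, hp, add_div]

theorem unweight_smul (φ : ℤ → ℝ) (Λ s b : ℝ) (c : ℂ) (f : Lp ℂ 2 freqMeasure) :
    unweight φ Λ s b (c • f) =ᵐ[freqMeasure] c • unweight φ Λ s b f := by
  filter_upwards [Lp.coeFn_smul c f] with p hp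
  simp only [unweight, Pi.smul_apply, hp, smul_eq_mul, mul_div_assoc]

theorem wt_mul_unweight {φ : ℤ → ℝ} {Λ s b : ℝ} (hΛ : 1 ≤ Λ) (f : Lp ℂ 2 freqMeasure)
    (p : ℤ × ℝ) : (wt φ Λ s b p : ℂ) * unweight φ Λ s b f p = f p := by
  rw [unweight, mul_div_cancel₀]
  exact_mod_cast (wt_pos hΛ p).ne'

theorem nsq_unweight {φ : ℤ → ℝ} {Λ s b : ℝ} (hΛ : 1 ≤ Λ) (f : Lp ℂ 2 freqMeasure) :
    nsq φ Λ s b (unweight φ Λ s b f) = ‖f‖ₑ ^ 2 := by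
  rw [enorm_sq_Lp, nsq]
  refine lintegral_congr fun p => ?_
  rw [← enorm_wt_mul hΛ, wt_mul_unweight hΛ]

variable {D : Type*} [NormedAddCommGroup D] [NormedSpace ℝ D]

/-- `A` represents a bounded real-linear map from `D` to the weighted space with norm `nsq`. -/
structure IsBddLin (φ : ℤ → ℝ) (Λ s b : ℝ) (C : ℝ≥0) (A : D → ℤ × ℝ → ℂ) : Prop where
  measurable : ∀ d, Measurable (A d)
  add : ∀ d e, A (d + e) =ᵐ[freqMeasure] A d + A e
  smul : ∀ (c : ℝ) d, A (c • d) =ᵐ[freqMeasure] (c : ℂ) • A d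
  bound : ∀ d, nsq φ Λ s b (A d) ≤ (C : ℝ≥0∞) ^ 2 * ‖d‖ₑ ^ 2

theorem isBddLin_unweight {φ : ℤ → ℝ} {Λ s b : ℝ} (hΛ : 1 ≤ Λ) :
    IsBddLin φ Λ s b 1 (unweight φ Λ s b) where
  measurable := measurable_unweight φ Λ s b
  add := unweight_add φ Λ s b
  smul c f := by
    rw [show c • f = (c : ℂ) • f from (RCLike.real_smul_eq_coe_smul c f)]
    exact unweight_smul φ Λ s b c f
  bound f := by rw [nsq_unweight hΛ]; simp

namespace IsBddLin

variable {φ : ℤ → ℝ} {Λ s b : ℝ} {C : ℝ≥0} {A : D → ℤ × ℝ → ℂ}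

theorem nsq_ne_top (hA : IsBddLin φ Λ s b C A) (d : D) : nsq φ Λ s b (A d) ≠ ⊤ :=
  ne_top_of_le_ne_top (ENNReal.mul_ne_top (by simp) (by simp)) (hA.bound d)

theorem one (hA : IsBddLin φ Λ s b C A) (hΛ : 1 ≤ Λ) (hb : 0 ≤ b) : IsBddLin φ 1 s b C A :=
  ⟨hA.measurable, hA.add, hA.smul, fun d => (nsq_one_le hΛ hb _).trans (hA.bound d)⟩

theorem memLp (hA : IsBddLin φ Λ s b C A) (hΛ : 1 ≤ Λ) (d : D) :
    MemLp (fun p => (wt φ Λ s b p : ℂ) * A d p) 2 freqMeasure := by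
  have := measurable_wt φ Λ s b
  have := hA.measurable d
  refine memLp_two_of_lintegral (by fun_prop) ?_
  simpa only [nsq, enorm_wt_mul hΛ] using hA.nsq_ne_top d

/-- The map to `L²(ℤ × ℝ)` given by `wt * A d`. -/
def toLp (hA : IsBddLin φ Λ s b C A) (hΛ : 1 ≤ Λ) : D →L[ℝ] Lp ℂ 2 freqMeasure :=
  LinearMap.mkContinuous
    { toFun := fun d => (hA.memLp hΛ d).toLp _
      map_add' := fun d e => by
        rw [← MemLp.toLp_add]
        refine MemLp.toLp_congr _ _ ?_
        filter_upwards [hA.add d e] with p hp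
        simp only [hp, Pi.add_apply, mul_add]
      map_smul' := fun c d => by
        rw [RingHom.id_apply, ← MemLp.toLp_const_smul]
        refine MemLp.toLp_congr _ _ ?_
        filter_upwards [hA.smul c d] with p hp
        simp only [hp, Pi.smul_apply, smul_eq_mul, Complex.real_smul]
        ring }
    C fun d => by
      refine norm_le_of_enorm_sq_le ((le_of_eq ?_).trans (hA.bound d))
      rw [enorm_sq_Lp, nsq]
      refine lintegral_congr_ae ?_
      filter_upwards [(hA.memLp hΛ d).coeFn_toLp] with p hp
      rw [← enorm_wt_mul hΛ]
      exact congrArg (fun z : ℂ => ‖z‖ₑ ^ 2) hp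

theorem unweight_toLp (hA : IsBddLin φ Λ s b C A) (hΛ : 1 ≤ Λ) (d : D) :
    unweight φ Λ s b (hA.toLp hΛ d) =ᵐ[freqMeasure] A d := by
  filter_upwards [(hA.memLp hΛ d).coeFn_toLp] with p hp
  have h : (wt φ Λ s b p : ℂ) ≠ 0 := by exact_mod_cast (wt_pos hΛ p).ne'
  rw [unweight, show (hA.toLp hΛ d) p = _ from hp, mul_div_cancel_left₀ _ h]

theorem norm_toLp_le (hA : IsBddLin φ Λ s b C A) (hΛ : 1 ≤ Λ) : ‖hA.toLp hΛ‖ ≤ C :=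
  LinearMap.mkContinuous_norm_le _ C.2 _

variable (L : ℝ) [Fact (0 < L)]

/-- The function in the Bourgain space whose space-time Fourier transform is `A d`. -/
def synth (hA : IsBddLin φ 1 s b C A) (hs : 0 ≤ s) (hb : 1 / 2 < b) : D →L[ℝ] Bourgain L φ s b :=
  LinearMap.mkContinuous
    { toFun := fun d =>
        (exists_bourgain_stf_eq L hs hb (hA.measurable d) (hA.nsq_ne_top d)).choose
      map_add' := fun d e => by
        have h := fun d => (exists_bourgain_stf_eq L hs hb (hA.measurable d)
          (hA.nsq_ne_top d)).choose_spec
        refine Bourgain.ext_stf ((h _).trans ((hA.add d e).trans ?_))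
        rw [map_add]
        exact (((stf_add _ _).trans ((h d).add (h e)))).symm
      map_smul' := fun c d => by
        have h := fun d => (exists_bourgain_stf_eq L hs hb (hA.measurable d)
          (hA.nsq_ne_top d)).choose_spec
        refine Bourgain.ext_stf ((h _).trans ((hA.smul c d).trans ?_))
        rw [RingHom.id_apply, RCLike.real_smul_eq_coe_smul (K := ℂ), map_smul]
        exact ((stf_smul _ _).trans ((h d).const_smul (c : ℂ))).symm }
    C fun d => by
      refine norm_le_of_enorm_sq_le ((le_of_eq ?_).trans (hA.bound d))
      rw [Bourgain.enorm_sq]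
      exact nsq_congr _ _ _ _ (exists_bourgain_stf_eq L hs hb (hA.measurable d)
        (hA.nsq_ne_top d)).choose_spec

theorem stf_synth (hA : IsBddLin φ 1 s b C A) (hs : 0 ≤ s) (hb : 1 / 2 < b) (d : D) :
    stf (hA.synth L hs hb d).toL2 =ᵐ[freqMeasure] A d :=
  (exists_bourgain_stf_eq L hs hb (hA.measurable d) (hA.nsq_ne_top d)).choose_spec

theorem fourierCoeff_synth (hA : IsBddLin φ 1 s b C A) (hs : 0 ≤ s) (hb : 1 / 2 < b) (d : D) :
    ∀ᵐ t, ∀ n, fourierCoeff ((hA.synth L hs hb d).toL2 t) n = hat (A d) t n := by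
  filter_upwards [(hA.synth L hs hb d).ae_fourierCoeff_eq_hat hs hb] with t ht n
  rw [ht, hat_congr (hA.stf_synth L hs hb d)]

theorem tsum_l1_ne_top (hA : IsBddLin φ 1 s b C A) (hb : 1 / 2 < b) (d : D) :
    ∑' n : ℤ, (ENNReal.ofReal (bracket n ^ s) * l1 (A d) n) ^ 2 ≠ ⊤ :=
  ne_top_of_le_ne_top (ENNReal.mul_ne_top (embC_ne_top hb) (hA.nsq_ne_top d))
    (tsum_sq_l1_le (hA.measurable d))

theorem isWiener (hA : IsBddLin φ 1 s b C A) (hs : 0 ≤ s) (hb : 1 / 2 < b) (d : D) :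
    IsWiener (A d) := isWiener_of_nsq hs hb (hA.measurable d) (hA.nsq_ne_top d)

theorem hat_add' (hA : IsBddLin φ 1 s b C A) (hs : 0 ≤ s) (hb : 1 / 2 < b) (d e : D) (t : ℝ)
    (n : ℤ) : hat (A (d + e)) t n = hat (A d) t n + hat (A e) t n := by
  rw [hat_congr (hA.add d e), hat_add (hA.isWiener hs hb d).isSliceIntegrable
    (hA.isWiener hs hb e).isSliceIntegrable]

theorem hat_smul' (hA : IsBddLin φ 1 s b C A) (c : ℝ) (d : D) (t : ℝ) (n : ℤ) :
    hat (A (c • d)) t n = c * hat (A d) t n := by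
  rw [hat_congr (hA.smul c d), hat_smul]

/-- The value at time `t` of the function with space-time Fourier transform `A d`. -/
def value (hA : IsBddLin φ 1 s b C A) (hs : 0 ≤ s) (hb : 1 / 2 < b) (d : D) (t : ℝ) : Hs L s :=
  (exists_Hs_fourierCoeff_eq (L := L) hs
    (ne_top_of_le_ne_top (hA.tsum_l1_ne_top hb d) (sobSq_hat_le s (A d) t))).choose

theorem fourierCoeff_value (hA : IsBddLin φ 1 s b C A) (hs : 0 ≤ s) (hb : 1 / 2 < b) (d : D)
    (t : ℝ) (n : ℤ) : fourierCoeff (hA.value L hs hb d t).toL2 n = hat (A d) t n :=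
  (exists_Hs_fourierCoeff_eq (L := L) hs
    (ne_top_of_le_ne_top (hA.tsum_l1_ne_top hb d) (sobSq_hat_le s (A d) t))).choose_spec n

theorem continuous_value (hA : IsBddLin φ 1 s b C A) (hs : 0 ≤ s) (hb : 1 / 2 < b) (d : D) :
    Continuous (hA.value L hs hb d) :=
  Hs.continuous_of_hat hs (hA.isWiener hs hb d).isSliceIntegrable (hA.tsum_l1_ne_top hb d)
    (hA.fourierCoeff_value L hs hb d)

theorem value_add (hA : IsBddLin φ 1 s b C A) (hs : 0 ≤ s) (hb : 1 / 2 < b) (d e : D) (t : ℝ) :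
    hA.value L hs hb (d + e) t = hA.value L hs hb d t + hA.value L hs hb e t := by
  refine Hs.ext fun n => ?_
  rw [map_add, fourierCoeff_add_L2T]
  simp only [fourierCoeff_value]
  exact hA.hat_add' hs hb d e t n

theorem value_smul (hA : IsBddLin φ 1 s b C A) (hs : 0 ≤ s) (hb : 1 / 2 < b) (c : ℝ) (d : D)
    (t : ℝ) : hA.value L hs hb (c • d) t = c • hA.value L hs hb d t := by
  refine Hs.ext fun n => ?_
  rw [show c • hA.value L hs hb d t = (c : ℂ) • hA.value L hs hb d t from rfl, map_smul,
    fourierCoeff_smul_L2T]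
  simp only [fourierCoeff_value]
  exact hA.hat_smul' c d t n

/-- The constant in the embedding in `C(ℝ; H^s)`. -/
def valueConst (L b : ℝ) (C : ℝ≥0) : ℝ≥0 :=
  (ENNReal.ofReal (Real.sqrt L)).toNNReal * NNReal.sqrt (embC b).toNNReal * C

theorem norm_value_le (hA : IsBddLin φ 1 s b C A) (hs : 0 ≤ s) (hb : 1 / 2 < b) (d : D) (t : ℝ) :
    ‖hA.value L hs hb d t‖ ≤ valueConst L b C * ‖d‖ := by
  refine norm_le_of_enorm_sq_le ((Hs.enorm_sq_le hs _).trans ?_)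
  rw [funext (hA.fourierCoeff_value L hs hb d t)]
  have h1 := ((sobSq_hat_le s (A d) t).trans (tsum_sq_l1_le (hA.measurable d))).trans
    (mul_le_mul_right (hA.bound d) (embC b))
  refine (mul_le_mul_right h1 _).trans (le_of_eq ?_)
  rw [valueConst, ENNReal.coe_mul, ENNReal.coe_mul, mul_pow, mul_pow,
    ← ENNReal.coe_pow (NNReal.sqrt _),
    NNReal.sq_sqrt, ENNReal.coe_toNNReal (embC_ne_top hb), ENNReal.coe_toNNReal (by simp)]
  ring

/-- The restriction to `[0, T]` of the function with space-time Fourier transform `A d`. -/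
def trace (hA : IsBddLin φ 1 s b C A) (hs : 0 ≤ s) (hb : 1 / 2 < b) (T : ℝ) :
    D →L[ℝ] C(Icc (0 : ℝ) T, Hs L s) :=
  LinearMap.mkContinuous
    { toFun := fun d => ⟨fun t => hA.value L hs hb d t,
        (hA.continuous_value L hs hb d).comp continuous_subtype_val⟩
      map_add' := fun d e => by
        ext t : 1
        exact hA.value_add L hs hb d e t
      map_smul' := fun c d => by
        ext t : 1
        exact hA.value_smul L hs hb c d t }
    (valueConst L b C) fun d => by
      rw [ContinuousMap.norm_le _ (by positivity)]
      exact fun t => hA.norm_value_le L hs hb d t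

/-- `trace` for real-valued functions. -/
def traceReal (hA : IsBddLin φ 1 s b C A) (hs : 0 ≤ s) (hb : 1 / 2 < b) (T : ℝ)
    (hr : ∀ d t, IsRealValued (hA.value L hs hb d t).toL2) :
    D →L[ℝ] C(Icc (0 : ℝ) T, HsReal L s) :=
  LinearMap.mkContinuous
    { toFun := fun d => ⟨fun t => ⟨hA.value L hs hb d t, hr d t⟩,
        ((hA.continuous_value L hs hb d).comp continuous_subtype_val).subtype_mk _⟩
      map_add' := fun d e => by
        ext t : 1
        exact Subtype.ext (hA.value_add L hs hb d e t)
      map_smul' := fun c d => by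
        ext t : 1
        exact Subtype.ext (hA.value_smul L hs hb c d t) }
    (valueConst L b C) fun d => by
      rw [ContinuousMap.norm_le _ (by positivity)]
      exact fun t => hA.norm_value_le L hs hb d t

end IsBddLin

end

section

/-! ### Real parts -/

/-- For an odd phase the modulation is odd, so the weight is even. This makes conjugation an
isometry of the Benjamin–Ono space. -/
theorem wt_neg {φ : ℤ → ℝ} (hφ : ∀ n, φ (-n) = -φ n) (Λ s b : ℝ) (p : ℤ × ℝ) :
    wt φ Λ s b (-p) = wt φ Λ s b p := by
  simp only [wt, modulation, Prod.fst_neg, Prod.snd_neg, hφ]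
  rw [show 2 * Real.pi * -p.2 + -φ p.1 = -(2 * Real.pi * p.2 + φ p.1) by ring, abs_neg]
  push_cast
  rw [bracket_neg]

theorem nsq_cnj {φ : ℤ → ℝ} (hφ : ∀ n, φ (-n) = -φ n) (Λ s b : ℝ) (F : ℤ × ℝ → ℂ) :
    nsq φ Λ s b (cnj F) = nsq φ Λ s b F := by
  rw [nsq, nsq, ← lintegral_neg_eq_self]
  refine lintegral_congr fun p => ?_
  rw [wt_neg hφ, cnj, neg_neg, ← ofReal_norm, RCLike.norm_conj, ofReal_norm]

/-- The space-time Fourier transform of the real part. -/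
def realPart (F : ℤ × ℝ → ℂ) : ℤ × ℝ → ℂ := (1 / 2 : ℂ) • (F + cnj F)

theorem cnj_cnj (F : ℤ × ℝ → ℂ) : cnj (cnj F) = F := by
  funext p
  simp [cnj]

theorem cnj_realPart (F : ℤ × ℝ → ℂ) : cnj (realPart F) = realPart F := by
  rw [realPart, cnj_smul, cnj_add, cnj_cnj, add_comm]
  simp [Complex.conj_ofNat]

theorem measurable_realPart {F : ℤ × ℝ → ℂ} (hF : Measurable F) : Measurable (realPart F) :=
  (hF.add (measurable_cnj hF)).const_smul _

theorem nsq_realPart_le {φ : ℤ → ℝ} (hφ : ∀ n, φ (-n) = -φ n) (Λ s b : ℝ) {F : ℤ × ℝ → ℂ}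
    (hF : Measurable F) : nsq φ Λ s b (realPart F) ≤ nsq φ Λ s b F := by
  rw [realPart, nsq_smul]
  have h1 := nsq_add_le φ Λ s b (G := cnj F) hF
  rw [nsq_cnj hφ, ← two_mul, ← mul_assoc] at h1
  have h2 : ‖(1 / 2 : ℂ)‖ₑ = 2⁻¹ := by
    rw [← ofReal_norm]
    rw [norm_div, norm_one, Complex.norm_ofNat, one_div, ENNReal.ofReal_inv_of_pos (by norm_num),
      ENNReal.ofReal_ofNat]
  rw [h2]
  refine (mul_le_mul_right h1 _).trans (le_of_eq ?_)
  rw [← mul_assoc, ← sq, ← mul_pow, ENNReal.inv_mul_cancel (by norm_num) (by norm_num), one_pow,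
    one_mul]

theorem realPart_congr {F F' : ℤ × ℝ → ℂ} (h : F =ᵐ[freqMeasure] F') :
    realPart F =ᵐ[freqMeasure] realPart F' := (h.add (cnj_congr h)).const_smul _

theorem hat_realPart {F : ℤ × ℝ → ℂ} (hF : IsWiener F) (t : ℝ) (n : ℤ) :
    hat (realPart F) t n = (1 / 2 : ℂ) * (hat F t n + starRingEnd ℂ (hat F t (-n))) := by
  rw [realPart, hat_smul, hat_add hF.isSliceIntegrable hF.cnj.isSliceIntegrable, hat_cnj]

theorem hat_neg_of_cnj_eq {F : ℤ × ℝ → ℂ} (h : cnj F = F) (t : ℝ) (n : ℤ) :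
    hat F t (-n) = starRingEnd ℂ (hat F t n) := by
  conv_lhs => rw [← h]
  rw [hat_cnj, neg_neg]

variable {D D' : Type*} [NormedAddCommGroup D] [NormedSpace ℝ D] [NormedAddCommGroup D']
  [NormedSpace ℝ D']

theorem IsBddLin.realPart {φ : ℤ → ℝ} (hφ : ∀ n, φ (-n) = -φ n) {Λ s b : ℝ} {C : ℝ≥0}
    {A : D → ℤ × ℝ → ℂ} (hA : IsBddLin φ Λ s b C A) :
    IsBddLin φ Λ s b C fun d => realPart (A d) where
  measurable d := measurable_realPart (hA.measurable d)
  add d e := by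
    refine (realPart_congr (hA.add d e)).trans (Filter.Eventually.of_forall fun p => ?_)
    simp only [SBO.realPart, cnj_add, Pi.smul_apply, Pi.add_apply, smul_eq_mul]
    ring
  smul c d := by
    refine (realPart_congr (hA.smul c d)).trans (Filter.Eventually.of_forall fun p => ?_)
    simp only [SBO.realPart, cnj_smul, Pi.smul_apply, Pi.add_apply, smul_eq_mul,
      Complex.conj_ofReal]
    ring
  bound d := (nsq_realPart_le hφ Λ s b (hA.measurable d)).trans (hA.bound d)

theorem IsBddLin.isRealValued_value (L : ℝ) [Fact (0 < L)] {φ : ℤ → ℝ} {s b : ℝ} {C : ℝ≥0}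
    {A : D → ℤ × ℝ → ℂ} (hA : IsBddLin φ 1 s b C A) (hs : 0 ≤ s) (hb : 1 / 2 < b)
    (hr : ∀ d, cnj (A d) = A d) (d : D) (t : ℝ) : IsRealValued (hA.value L hs hb d t).toL2 := by
  rw [isRealValued_iff_fourierCoeff]
  intro n
  rw [fourierCoeff_value, fourierCoeff_value, hat_neg_of_cnj_eq (hr d)]

theorem IsBddLin.isRealValued_synth (L : ℝ) [Fact (0 < L)] {φ : ℤ → ℝ} {s b : ℝ} {C : ℝ≥0}
    {A : D → ℤ × ℝ → ℂ} (hA : IsBddLin φ 1 s b C A) (hs : 0 ≤ s) (hb : 1 / 2 < b)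
    (hr : ∀ d, cnj (A d) = A d) (d : D) :
    ∀ᵐ t, IsRealValued ((hA.synth L hs hb d).toL2 t) := by
  filter_upwards [hA.fourierCoeff_synth L hs hb d] with t ht
  rw [isRealValued_iff_fourierCoeff]
  intro n
  rw [ht, ht, hat_neg_of_cnj_eq (hr d)]

/-! ### Bounded bilinear maps given by frequency functions -/

/-- `B` represents a bounded real-bilinear map to the weighted space with norm `nsq`. -/
structure IsBddBilin (φ : ℤ → ℝ) (Λ s b : ℝ) (C : ℝ≥0) (B : D → D' → ℤ × ℝ → ℂ) : Prop where
  measurable : ∀ d e, Measurable (B d e)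
  add_left : ∀ d d' e, B (d + d') e =ᵐ[freqMeasure] B d e + B d' e
  smul_left : ∀ (c : ℝ) d e, B (c • d) e =ᵐ[freqMeasure] (c : ℂ) • B d e
  add_right : ∀ d e e', B d (e + e') =ᵐ[freqMeasure] B d e + B d e'
  smul_right : ∀ (c : ℝ) d e, B d (c • e) =ᵐ[freqMeasure] (c : ℂ) • B d e
  bound : ∀ d e, nsq φ Λ s b (B d e) ≤ (C : ℝ≥0∞) ^ 2 * (‖d‖ₑ ^ 2 * ‖e‖ₑ ^ 2)

namespace IsBddBilin

variable {φ : ℤ → ℝ} {Λ s b : ℝ} {C : ℝ≥0} {B : D → D' → ℤ × ℝ → ℂ}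

theorem isBddLin (hB : IsBddBilin φ Λ s b C B) (d : D) :
    IsBddLin φ Λ s b (C * ‖d‖₊) (B d) where
  measurable := hB.measurable d
  add := hB.add_right d
  smul c e := hB.smul_right c d e
  bound e := (hB.bound d e).trans (le_of_eq (by rw [ENNReal.coe_mul, enorm_eq_nnnorm]; ring))

theorem unweight_injective {φ : ℤ → ℝ} {Λ s b : ℝ} (hΛ : 1 ≤ Λ) {f g : Lp ℂ 2 freqMeasure}
    (h : unweight φ Λ s b f =ᵐ[freqMeasure] unweight φ Λ s b g) : f = g := by
  ext1
  filter_upwards [h] with p hp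
  rw [← wt_mul_unweight (φ := φ) (s := s) (b := b) hΛ f p, hp, wt_mul_unweight hΛ]

/-- The bilinear map to `L²(ℤ × ℝ)` given by `wt * B d e`. -/
def toLp (hB : IsBddBilin φ Λ s b C B) (hΛ : 1 ≤ Λ) : D →L[ℝ] D' →L[ℝ] Lp ℂ 2 freqMeasure :=
  LinearMap.mkContinuous
    { toFun := fun d => (hB.isBddLin d).toLp hΛ
      map_add' := fun d d' => by
        ext1 e
        refine unweight_injective (φ := φ) (s := s) (b := b) hΛ ?_
        refine ((hB.isBddLin (d + d')).unweight_toLp hΛ e).trans ((hB.add_left d d' e).trans ?_)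
        exact ((unweight_add φ Λ s b _ _).trans (((hB.isBddLin d).unweight_toLp hΛ e).add
          ((hB.isBddLin d').unweight_toLp hΛ e))).symm
      map_smul' := fun c d => by
        ext1 e
        refine unweight_injective (φ := φ) (s := s) (b := b) hΛ ?_
        refine ((hB.isBddLin (c • d)).unweight_toLp hΛ e).trans ((hB.smul_left c d e).trans ?_)
        exact (((isBddLin_unweight hΛ).smul c _).trans
          (((hB.isBddLin d).unweight_toLp hΛ e).const_smul (c : ℂ))).symm }
    C fun d => by
      refine ((hB.isBddLin d).norm_toLp_le hΛ).trans (le_of_eq ?_)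
      simp

theorem unweight_toLp (hB : IsBddBilin φ Λ s b C B) (hΛ : 1 ≤ Λ) (d : D) (e : D') :
    unweight φ Λ s b (hB.toLp hΛ d e) =ᵐ[freqMeasure] B d e :=
  (hB.isBddLin d).unweight_toLp hΛ e

theorem norm_toLp_le (hB : IsBddBilin φ Λ s b C B) (hΛ : 1 ≤ Λ) : ‖hB.toLp hΛ‖ ≤ C :=
  LinearMap.mkContinuous_norm_le _ C.2 _

end IsBddBilin

/-! ### The operators of the integral equation -/

theorem coe_toNNReal_sqrt_sq {x : ℝ≥0∞} (hx : x ≠ ⊤) :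
    ((NNReal.sqrt x.toNNReal : ℝ≥0) : ℝ≥0∞) ^ 2 = x := by
  rw [← ENNReal.coe_pow, NNReal.sq_sqrt, ENNReal.coe_toNNReal hx]

theorem exists_isBddLin_free (Ψ : SchwartzMap ℝ ℂ) (L : ℝ) [Fact (0 < L)] {s b : ℝ} (hs : 0 ≤ s)
    (hb' : b ≤ 5 / 8) : ∃ C : ℝ≥0, ∀ (φ : ℤ → ℝ) (Λ : ℝ), 1 ≤ Λ →
      IsBddLin φ Λ s b (C * (Λ ^ (b - 1 / 2)).toNNReal)
        fun u : Hs L s => free Ψ Λ φ (fourierCoeff u.toL2) := by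
  obtain ⟨C, hC, h⟩ := exists_nsq_free_le Ψ hb'
  refine ⟨NNReal.sqrt C.toNNReal * (2 ^ (s / 2) / Real.sqrt L).toNNReal, fun φ Λ hΛ => ?_⟩
  refine ⟨fun u => measurable_free _ _ _ _, fun u v => ?_, fun c u => ?_, fun u => ?_⟩
  · rw [← free_add]
    refine Filter.EventuallyEq.of_eq (congrArg _ (funext fun n => ?_))
    rw [map_add, fourierCoeff_add_L2T, Pi.add_apply]
  · rw [← free_smul]
    refine Filter.EventuallyEq.of_eq (congrArg _ (funext fun n => ?_))
    rw [show c • u = (c : ℂ) • u from rfl, map_smul, fourierCoeff_smul_L2T, Pi.smul_apply,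
      smul_eq_mul]
  · refine (h φ s Λ hΛ _).trans ((mul_le_mul_right (Hs.sobSq_le hs u) _).trans (le_of_eq ?_))
    simp only [ENNReal.coe_mul, mul_pow, coe_toNNReal_sqrt_sq hC, ENNReal.ofReal]
    ring

theorem IsBddLin.restrict_real {L : ℝ} [Fact (0 < L)] {φ : ℤ → ℝ} {Λ s b : ℝ} {C : ℝ≥0}
    {A : Hs L s → ℤ × ℝ → ℂ} (hA : IsBddLin φ Λ s b C A) :
    IsBddLin φ Λ s b C fun u : HsReal L s => A u.1 where
  measurable u := hA.measurable u.1
  add u v := hA.add u.1 v.1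
  smul c u := hA.smul c u.1
  bound u := hA.bound u.1

/-- The right-hand side `-iα ∫₀ᵗ exp (-ik²(t-r)) (vu)(r) dr`, localized. -/
def nonlinX (Ψ : SchwartzMap ℝ ℂ) (L α Λ : ℝ) (G F : ℤ × ℝ → ℂ) : ℤ × ℝ → ℂ :=
  (-(Complex.I * α) : ℂ) • duhamel Ψ Λ (phiX L) (conv G F)

/-- The right-hand side `β ∫₀ᵗ exp (-iγ|k|k(t-r)) (u ū')ₓ(r) dr`, localized. -/
def nonlinY (Ψ : SchwartzMap ℝ ℂ) (L β γ Λ : ℝ) (F F' : ℤ × ℝ → ℂ) : ℤ × ℝ → ℂ :=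
  (β : ℂ) • duhamel Ψ Λ (phiY L γ) (dx L (conv (cnj F') F))

theorem exists_nsq_nonlinX_le (Ψ : SchwartzMap ℝ ℂ) (L : ℝ) [Fact (0 < L)] (α : ℝ) {γ s b : ℝ}
    (hγ : |γ| ≠ 1) (hs : 1 / 2 ≤ s) (hb : 1 / 2 < b) (hb' : b ≤ 5 / 8) :
    ∃ C : ℝ≥0, ∀ Λ : ℝ, 1 ≤ Λ → ∀ G F : ℤ × ℝ → ℂ, Measurable G → Measurable F →
      nsq (phiX L) Λ s b (nonlinX Ψ L α Λ G F) ≤ ((C * (Λ ^ (b - 5 / 8)).toNNReal : ℝ≥0) : ℝ≥0∞) ^ 2 *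
        (nsq (phiY L γ) 1 (s - 1 / 2) b G * nsq (phiX L) 1 s b F) := by
  obtain ⟨C₁, hC₁, h₁⟩ := nsq_conv_le L hγ hs hb
  obtain ⟨C₂, hC₂, h₂⟩ := exists_nsq_duhamel_le Ψ (by linarith : 0 ≤ b) hb'
  refine ⟨NNReal.sqrt C₁.toNNReal * NNReal.sqrt C₂.toNNReal * ‖(-(Complex.I * α) : ℂ)‖₊,
    fun Λ hΛ G F hG hF => ?_⟩
  rw [nonlinX, nsq_smul]
  have h3 := h₂ (phiX L) s Λ hΛ _ (measurable_conv hG hF)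
  have h4 := h3.trans (mul_le_mul_right (h₁ G F hG hF) _)
  refine (mul_le_mul_right h4 _).trans (le_of_eq ?_)
  simp only [ENNReal.coe_mul, mul_pow, coe_toNNReal_sqrt_sq hC₁, coe_toNNReal_sqrt_sq hC₂,
    ENNReal.ofReal, enorm_eq_nnnorm]
  ring

theorem exists_nsq_nonlinY_le (Ψ : SchwartzMap ℝ ℂ) (L : ℝ) [Fact (0 < L)] (β : ℝ) {γ s b : ℝ}
    (hγ : |γ| ≠ 1) (hs : 1 / 2 ≤ s) (hb : 1 / 2 < b) (hb' : b ≤ 5 / 8) :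
    ∃ C : ℝ≥0, ∀ Λ : ℝ, 1 ≤ Λ → ∀ F F' : ℤ × ℝ → ℂ, Measurable F → Measurable F' →
      nsq (phiY L γ) Λ (s - 1 / 2) b (nonlinY Ψ L β γ Λ F F') ≤
        ((C * (Λ ^ (b - 5 / 8)).toNNReal : ℝ≥0) : ℝ≥0∞) ^ 2 *
          (nsq (phiX L) 1 s b F * nsq (phiX L) 1 s b F') := by
  obtain ⟨C₁, hC₁, h₁⟩ := nsq_dx_conv_cnj_le L hγ hs hb
  obtain ⟨C₂, hC₂, h₂⟩ := exists_nsq_duhamel_le Ψ (by linarith : 0 ≤ b) hb'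
  refine ⟨NNReal.sqrt C₁.toNNReal * NNReal.sqrt C₂.toNNReal * ‖(β : ℂ)‖₊,
    fun Λ hΛ F F' hF hF' => ?_⟩
  rw [nonlinY, nsq_smul]
  have h3 := h₂ (phiY L γ) (s - 1 / 2) Λ hΛ _ (measurable_dx L (measurable_conv
    (measurable_cnj hF') hF))
  have h4 := h3.trans (mul_le_mul_right (h₁ F F' hF hF') _)
  refine (mul_le_mul_right h4 _).trans (le_of_eq ?_)
  simp only [ENNReal.coe_mul, mul_pow, coe_toNNReal_sqrt_sq hC₁, coe_toNNReal_sqrt_sq hC₂,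
    ENNReal.ofReal, enorm_eq_nnnorm]
  ring

theorem measurable_nonlinX (Ψ : SchwartzMap ℝ ℂ) (L α Λ : ℝ) {G F : ℤ × ℝ → ℂ}
    (hG : Measurable G) (hF : Measurable F) : Measurable (nonlinX Ψ L α Λ G F) :=
  (measurable_duhamel Ψ Λ _ (measurable_conv hG hF)).const_smul _

theorem measurable_nonlinY (Ψ : SchwartzMap ℝ ℂ) (L β γ Λ : ℝ) {F F' : ℤ × ℝ → ℂ}
    (hF : Measurable F) (hF' : Measurable F') : Measurable (nonlinY Ψ L β γ Λ F F') :=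
  (measurable_duhamel Ψ Λ _ (measurable_dx L (measurable_conv
    (measurable_cnj hF') hF))).const_smul _

theorem nonlinX_congr (Ψ : SchwartzMap ℝ ℂ) (L α Λ : ℝ) {G G' F F' : ℤ × ℝ → ℂ}
    (hG : G =ᵐ[freqMeasure] G') (hF : F =ᵐ[freqMeasure] F') :
    nonlinX Ψ L α Λ G F = nonlinX Ψ L α Λ G' F' := by
  rw [nonlinX, nonlinX, conv_congr hG hF]

theorem nonlinY_congr (Ψ : SchwartzMap ℝ ℂ) (L β γ Λ : ℝ) {E E' F F' : ℤ × ℝ → ℂ}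
    (hE : E =ᵐ[freqMeasure] E') (hF : F =ᵐ[freqMeasure] F') :
    nonlinY Ψ L β γ Λ E F = nonlinY Ψ L β γ Λ E' F' := by
  rw [nonlinY, nonlinY, conv_congr (cnj_congr hF) hE]

theorem nonlinX_add_left (Ψ : SchwartzMap ℝ ℂ) (L α : ℝ) {Λ : ℝ} (hΛ : 1 ≤ Λ)
    {G G' F : ℤ × ℝ → ℂ} (hG : IsWiener G) (hG' : IsWiener G') (hF : IsWiener F) :
    nonlinX Ψ L α Λ (G + G') F = nonlinX Ψ L α Λ G F + nonlinX Ψ L α Λ G' F := by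
  rw [nonlinX, duhamel_congr Ψ Λ _ (conv_add_left hG hG' hF), duhamel_add Ψ hΛ _
    (isSliceIntegrable_conv hG hF) (isSliceIntegrable_conv hG' hF), smul_add]
  rfl

theorem nonlinX_add_right (Ψ : SchwartzMap ℝ ℂ) (L α : ℝ) {Λ : ℝ} (hΛ : 1 ≤ Λ)
    {G F F' : ℤ × ℝ → ℂ} (hG : IsWiener G) (hF : IsWiener F) (hF' : IsWiener F') :
    nonlinX Ψ L α Λ G (F + F') = nonlinX Ψ L α Λ G F + nonlinX Ψ L α Λ G F' := by
  rw [nonlinX, duhamel_congr Ψ Λ _ (conv_add_right hG hF hF'), duhamel_add Ψ hΛ _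
    (isSliceIntegrable_conv hG hF) (isSliceIntegrable_conv hG hF'), smul_add]
  rfl

theorem nonlinY_add_left (Ψ : SchwartzMap ℝ ℂ) (L β γ : ℝ) {Λ : ℝ} (hΛ : 1 ≤ Λ)
    {E F G : ℤ × ℝ → ℂ} (hE : IsWiener E) (hF : IsWiener F) (hG : IsWiener G) :
    nonlinY Ψ L β γ Λ (E + F) G = nonlinY Ψ L β γ Λ E G + nonlinY Ψ L β γ Λ F G := by
  rw [nonlinY, duhamel_congr Ψ Λ _ (dx_congr L (conv_add_right hG.cnj hE hF)), dx_add,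
    duhamel_add Ψ hΛ _ ((isSliceIntegrable_conv hG.cnj hE).dx L)
      ((isSliceIntegrable_conv hG.cnj hF).dx L), smul_add]
  rfl

theorem nonlinY_add_right (Ψ : SchwartzMap ℝ ℂ) (L β γ : ℝ) {Λ : ℝ} (hΛ : 1 ≤ Λ)
    {E F G : ℤ × ℝ → ℂ} (hE : IsWiener E) (hF : IsWiener F) (hG : IsWiener G) :
    nonlinY Ψ L β γ Λ E (F + G) = nonlinY Ψ L β γ Λ E F + nonlinY Ψ L β γ Λ E G := by
  rw [nonlinY, cnj_add, duhamel_congr Ψ Λ _ (dx_congr L (conv_add_left hF.cnj hG.cnj hE)), dx_add,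
    duhamel_add Ψ hΛ _ ((isSliceIntegrable_conv hF.cnj hE).dx L)
      ((isSliceIntegrable_conv hG.cnj hE).dx L), smul_add]
  rfl

/-- The inputs live in the Λ-weighted space, whose norm dominates the one with Λ = 1 used in the
bilinear estimate. No power of Λ is lost on the inputs, and the whole gain of the Duhamel operator
is kept. -/
theorem exists_isBddBilin_nonlinX (Ψ : SchwartzMap ℝ ℂ) (L : ℝ) [Fact (0 < L)] (α : ℝ)
    {γ s b : ℝ} (hγ : |γ| ≠ 1) (hs : 1 / 2 ≤ s) (hb : 1 / 2 < b) (hb' : b ≤ 5 / 8) :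
    ∃ C : ℝ≥0, ∀ Λ : ℝ, 1 ≤ Λ → IsBddBilin (phiX L) Λ s b (C * (Λ ^ (b - 5 / 8)).toNNReal)
      fun g f : Lp ℂ 2 freqMeasure => nonlinX Ψ L α Λ (unweight (phiY L γ) Λ (s - 1 / 2) b g)
        (unweight (phiX L) Λ s b f) := by
  obtain ⟨C, h⟩ := exists_nsq_nonlinX_le Ψ L α hγ hs hb hb'
  refine ⟨C, fun Λ hΛ => ?_⟩
  have hY := isBddLin_unweight (φ := phiY L γ) (s := s - 1 / 2) (b := b) hΛ
  have hX := isBddLin_unweight (φ := phiX L) (s := s) (b := b) hΛ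
  have wY := (hY.one hΛ (by linarith)).isWiener (by linarith) hb
  have wX := (hX.one hΛ (by linarith)).isWiener (by linarith) hb
  refine ⟨fun g f => measurable_nonlinX Ψ L α Λ (hY.measurable g) (hX.measurable f),
    fun g g' f => ?_, fun c g f => ?_, fun g f f' => ?_, fun c g f => ?_, fun g f => ?_⟩
  · rw [nonlinX_congr Ψ L α Λ (hY.add g g') (ae_eq_refl _),
      nonlinX_add_left Ψ L α hΛ (wY g) (wY g') (wX f)]
  · rw [nonlinX_congr Ψ L α Λ (hY.smul c g) (ae_eq_refl _), nonlinX, conv_smul_left, duhamel_smul,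
      smul_comm]
    rfl
  · rw [nonlinX_congr Ψ L α Λ (ae_eq_refl _) (hX.add f f'),
      nonlinX_add_right Ψ L α hΛ (wY g) (wX f) (wX f')]
  · rw [nonlinX_congr Ψ L α Λ (ae_eq_refl _) (hX.smul c f), nonlinX, conv_smul_right,
      duhamel_smul, smul_comm]
    rfl
  · refine (h Λ hΛ _ _ (hY.measurable g) (hX.measurable f)).trans ?_
    gcongr
    · exact (nsq_one_le hΛ (by linarith) _).trans (nsq_unweight hΛ g).le
    · exact (nsq_one_le hΛ (by linarith) _).trans (nsq_unweight hΛ f).le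

theorem exists_isBddBilin_nonlinY (Ψ : SchwartzMap ℝ ℂ) (L : ℝ) [Fact (0 < L)] (β : ℝ)
    {γ s b : ℝ} (hγ : |γ| ≠ 1) (hs : 1 / 2 ≤ s) (hb : 1 / 2 < b) (hb' : b ≤ 5 / 8) :
    ∃ C : ℝ≥0, ∀ Λ : ℝ, 1 ≤ Λ → IsBddBilin (phiY L γ) Λ (s - 1 / 2) b
      (C * (Λ ^ (b - 5 / 8)).toNNReal) fun f f' : Lp ℂ 2 freqMeasure =>
        nonlinY Ψ L β γ Λ (unweight (phiX L) Λ s b f) (unweight (phiX L) Λ s b f') := by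
  obtain ⟨C, h⟩ := exists_nsq_nonlinY_le Ψ L β hγ hs hb hb'
  refine ⟨C, fun Λ hΛ => ?_⟩
  have hX := isBddLin_unweight (φ := phiX L) (s := s) (b := b) hΛ
  have wX := (hX.one hΛ (by linarith)).isWiener (by linarith) hb
  refine ⟨fun g f => measurable_nonlinY Ψ L β γ Λ (hX.measurable g) (hX.measurable f),
    fun g g' f => ?_, fun c g f => ?_, fun g f f' => ?_, fun c g f => ?_, fun g f => ?_⟩
  · rw [nonlinY_congr Ψ L β γ Λ (hX.add g g') (ae_eq_refl _),
      nonlinY_add_left Ψ L β γ hΛ (wX g) (wX g') (wX f)]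
  · rw [nonlinY_congr Ψ L β γ Λ (hX.smul c g) (ae_eq_refl _), nonlinY, conv_smul_right, dx_smul,
      duhamel_smul, smul_comm]
    rfl
  · rw [nonlinY_congr Ψ L β γ Λ (ae_eq_refl _) (hX.add f f'),
      nonlinY_add_right Ψ L β γ hΛ (wX g) (wX f) (wX f')]
  · rw [nonlinY_congr Ψ L β γ Λ (ae_eq_refl _) (hX.smul c f), nonlinY, cnj_smul,
      Complex.conj_ofReal, conv_smul_left, dx_smul, duhamel_smul, smul_comm]
    rfl
  · refine (h Λ hΛ _ _ (hX.measurable g) (hX.measurable f)).trans ?_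
    gcongr
    · exact (nsq_one_le hΛ (by linarith) _).trans (nsq_unweight hΛ g).le
    · exact (nsq_one_le hΛ (by linarith) _).trans (nsq_unweight hΛ f).le

end

/-! ### Smooth solution of a quadratic equation -/

section Quadratic

variable {X : Type*} [NormedAddCommGroup X] [NormedSpace ℝ X]

theorem norm_quadratic_sub_le (Q : X →L[ℝ] X →L[ℝ] X) (x y : X) :
    ‖Q x x - Q y y‖ ≤ ‖Q‖ * (‖x‖ + ‖y‖) * ‖x - y‖ := by
  have h : Q x x - Q y y = Q x (x - y) + Q (x - y) y := by
    simp only [map_sub, sub_apply]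
    abel
  rw [h]
  refine (norm_add_le _ _).trans ((add_le_add (Q.le_opNorm₂ _ _) (Q.le_opNorm₂ _ _)).trans ?_)
  exact le_of_eq (by ring)

/-- On the ball of radius 2ρ the quadratic map has Lipschitz constant at most 4ρ‖Q‖, which is less
than 1/2. -/
theorem approximatesLinearOn_sub_quadratic (Q : X →L[ℝ] X →L[ℝ] X) {ρ : ℝ}
    (h : 8 * ‖Q‖ * ρ < 1) : ApproximatesLinearOn (fun x => x - Q x x)
      ((ContinuousLinearEquiv.refl ℝ X : X ≃L[ℝ] X) : X →L[ℝ] X) (Metric.ball 0 (2 * ρ))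
      (1 / 2 : ℝ≥0) := by
  intro x hx y hy
  rw [mem_ball_zero_iff] at hx hy
  have h1 : x - Q x x - (y - Q y y) - ((ContinuousLinearEquiv.refl ℝ X : X ≃L[ℝ] X) : X →L[ℝ] X)
      (x - y) = -(Q x x - Q y y) := by
    simp only [ContinuousLinearEquiv.coe_refl, ContinuousLinearMap.id_apply]
    abel
  rw [h1, norm_neg]
  refine (norm_quadratic_sub_le Q x y).trans ?_
  have h2 : ‖Q‖ * (‖x‖ + ‖y‖) ≤ ‖Q‖ * (2 * ρ + 2 * ρ) := by gcongr
  have h3 : ((1 / 2 : ℝ≥0) : ℝ) = 1 / 2 := by norm_num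
  rw [h3]
  gcongr
  linarith

/-- The map x ↦ x - Q(x, x) is a perturbation of the identity with Lipschitz constant 1/2 on the
ball of radius 2ρ, hence a homeomorphism onto an open set containing the ball of radius ρ. Its
inverse is the solution map. Smoothness of the inverse follows from the inverse function theorem,
the derivative being invertible throughout the larger ball. -/
theorem exists_contDiffOn_fixedPoint [CompleteSpace X] (Q : X →L[ℝ] X →L[ℝ] X) {ρ : ℝ}
    (h : 8 * ‖Q‖ * ρ < 1) : ∃ σ : X → X, ContDiffOn ℝ ∞ σ (Metric.ball 0 ρ) ∧
      ∀ y ∈ Metric.ball (0 : X) ρ, σ y = y + Q (σ y) (σ y) := by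
  have hf := approximatesLinearOn_sub_quadratic Q h
  have hc : Subsingleton X ∨ (1 / 2 : ℝ≥0) <
      ‖((ContinuousLinearEquiv.refl ℝ X).symm : X →L[ℝ] X)‖₊⁻¹ := by
    rcases subsingleton_or_nontrivial X with h1 | h1
    · exact Or.inl h1
    · right
      have h2 : ‖((ContinuousLinearEquiv.refl ℝ X).symm : X →L[ℝ] X)‖₊ = 1 := by
        simp
      rw [h2]
      norm_num
  set e := hf.toOpenPartialHomeomorph _ _ hc Metric.isOpen_ball with he
  have hsurj : Metric.ball (0 : X) ρ ⊆ e.target := by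
    intro y hy
    rw [mem_ball_zero_iff] at hy
    -- The image of the closed ball of radius ε contains the closed ball of radius (1 - 1/2)ε about
    -- 0, so ε = 2‖y‖ is just enough to reach y.
    have h1 := hf.surjOn_closedBall_of_nonlinearRightInverse
      { toFun := id, nnnorm := 1, bound' := fun y => by simp, right_inv' := fun y => by simp }
      (ε := 2 * ‖y‖) (b := 0) (by positivity) (by
        intro z hz
        rw [mem_closedBall_zero_iff] at hz
        rw [mem_ball_zero_iff]
        linarith)
    obtain ⟨x, hx, hxy⟩ := h1 (show y ∈ _ by
      simp only [map_zero, sub_zero, mem_closedBall_zero_iff]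
      norm_num
      linarith)
    refine ⟨x, ?_, hxy⟩
    rw [mem_closedBall_zero_iff] at hx
    rw [mem_ball_zero_iff]
    linarith
  refine ⟨e.symm, fun y hy => ContDiffAt.contDiffWithinAt ?_, fun y hy => ?_⟩
  · have hy' := hsurj hy
    have hx : e.symm y ∈ Metric.ball (0 : X) (2 * ρ) := e.map_target hy'
    rw [mem_ball_zero_iff] at hx
    set x := e.symm y with hxdef
    -- P is the derivative of x ↦ Q(x, x). As ‖P‖ ≤ 2‖Q‖‖x‖ ≤ 4‖Q‖ρ < 1, the operator 1 - P is
    -- invertible by the Neumann series.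
    set P : X →L[ℝ] X := Q x + Q.flip x with hP
    have hPn : ‖P‖ < 1 := by
      have h1 : ‖Q.flip x‖ ≤ ‖Q‖ * ‖x‖ := by
        have := Q.flip.le_opNorm x
        rwa [ContinuousLinearMap.opNorm_flip] at this
      have h2 : ‖Q‖ * ‖x‖ ≤ ‖Q‖ * (2 * ρ) := by gcongr
      have h3 := norm_add_le (Q x) (Q.flip x)
      have h4 := Q.le_opNorm x
      linarith
    have hd : HasFDerivAt (fun x => x - Q x x) (ContinuousLinearMap.id ℝ X - P) x := by
      have h1 := (Q.hasFDerivAt (x := x)).clm_apply (hasFDerivAt_id x)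
      refine ((hasFDerivAt_id x).sub h1).congr_fderiv ?_
      ext z
      simp [hP, add_comm]
    refine e.contDiffAt_symm (f₀' := ContinuousLinearEquiv.unitsEquiv ℝ X (Units.oneSub P hPn))
      hy' ?_ ?_
    · exact hd
    · have h1 : ContDiff ℝ ∞ fun x => x - Q x x :=
        contDiff_id.sub (Q.contDiff.clm_apply contDiff_id)
      exact h1.contDiffAt
  · have h1 : e (e.symm y) = y := e.right_inv (hsurj hy)
    have h2 : e.symm y - Q (e.symm y) (e.symm y) = y := h1
    exact sub_eq_iff_eq_add.mp h2

end Quadratic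

section

/-! ### Mild solutions -/

theorem hasDerivAt_echar (ξ t : ℝ) :
    HasDerivAt (fun t => echar ξ t) (2 * Real.pi * ξ * Complex.I * echar ξ t) t := by
  have h1 : HasDerivAt (fun t : ℝ => (2 * Real.pi * ξ * t * Complex.I : ℂ))
      (2 * Real.pi * ξ * Complex.I) t := by
    have h2 := ((Complex.ofRealCLM.hasDerivAt (x := t)).const_mul
      (2 * Real.pi * ξ : ℂ)).mul_const Complex.I
    simpa using h2
  have h3 := h1.cexp
  unfold echar
  convert h3 using 1
  ring

theorem two_pi_mul_freqShift (φ : ℤ → ℝ) (n : ℤ) :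
    (2 * Real.pi * (freqShift φ n : ℝ) : ℂ) = φ n := by
  have hπ := Real.pi_ne_zero
  rw [freqShift]
  push_cast
  field_simp

theorem echar_neg_mul_echar (κ t : ℝ) : echar (-κ) t * echar κ t = 1 := by
  rw [← echar_add_left, neg_add_cancel, echar]
  simp

/-- The solution formula of Duhamel for the `n`-th Fourier coefficient. -/
def duhamelFormula (φ : ℤ → ℝ) (n : ℤ) (c₀ : ℂ) (h : ℝ → ℂ) (t : ℝ) : ℂ :=
  echar (-freqShift φ n) t * (c₀ + ∫ t' in (0)..t, echar (freqShift φ n) t' * h t')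

theorem hasDerivAt_duhamelFormula (φ : ℤ → ℝ) (n : ℤ) (c₀ : ℂ) {h : ℝ → ℂ} (hh : Continuous h)
    (t : ℝ) : HasDerivAt (duhamelFormula φ n c₀ h)
      (-(Complex.I * φ n) * duhamelFormula φ n c₀ h t + h t) t := by
  have hc : Continuous fun t' => echar (freqShift φ n) t' * h t' :=
    (continuous_echar_right _).mul hh
  have h1 := (intervalIntegral.integral_hasDerivAt_right (hc.intervalIntegrable 0 t)
    hc.stronglyMeasurable.stronglyMeasurableAtFilter hc.continuousAt).const_add c₀
  have h2 := (hasDerivAt_echar (-freqShift φ n) t).mul h1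
  refine h2.congr_deriv ?_
  simp only [duhamelFormula]
  rw [← mul_assoc (echar _ t) (echar _ t), echar_neg_mul_echar, ← two_pi_mul_freqShift]
  push_cast
  ring

/-- Multiplication by the integrating factor `echar κ t` removes the linear term; the fundamental
theorem of calculus does the rest. -/
theorem eq_duhamelFormula (φ : ℤ → ℝ) (n : ℤ) {c h : ℝ → ℂ} (hh : Continuous h) {T : ℝ}
    (hc : ∀ t ∈ Icc 0 T, HasDerivWithinAt c (-(Complex.I * φ n) * c t + h t) (Icc 0 T) t)
    {t : ℝ} (ht : t ∈ Icc 0 T) : c t = duhamelFormula φ n (c 0) h t := by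
  set κ := freqShift φ n with hκ
  have hc' : Continuous fun t' => echar κ t' * h t' := (continuous_echar_right _).mul hh
  have h1 : ∀ t ∈ Icc 0 T, HasDerivWithinAt (fun t => echar κ t * c t) (echar κ t * h t)
      (Icc 0 T) t := by
    intro t ht
    have h2 := (hasDerivAt_echar κ t).hasDerivWithinAt.mul (hc t ht)
    refine h2.congr_deriv ?_
    rw [← two_pi_mul_freqShift φ n, ← hκ]
    ring
  have h3 := intervalIntegral.integral_eq_sub_of_hasDerivAt_of_le ht.1
    (f := fun t => echar κ t * c t) (f' := fun t => echar κ t * h t)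
    (fun x hx => (h1 x ⟨hx.1, hx.2.trans ht.2⟩).continuousWithinAt.mono
      (Icc_subset_Icc le_rfl ht.2))
    (fun x hx => (h1 x ⟨hx.1.le, hx.2.le.trans ht.2⟩).hasDerivAt
      (Icc_mem_nhds hx.1 (hx.2.trans_le ht.2)))
    (hc'.intervalIntegrable 0 t)
  have h4 : echar κ 0 = 1 := by simp [echar]
  rw [duhamelFormula, ← hκ, h3, h4, one_mul, add_sub_cancel, ← mul_assoc, echar_neg_mul_echar,
    one_mul]

theorem duhamelFormula_zero (φ : ℤ → ℝ) (n : ℤ) (c₀ : ℂ) (h : ℝ → ℂ) :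
    duhamelFormula φ n c₀ h 0 = c₀ := by
  simp [duhamelFormula, echar]

variable {L : ℝ} [Fact (0 < L)]

theorem fourierCoeff_mul_eq_hat_conv {F G : ℤ × ℝ → ℂ} (hF : IsWiener F) (hG : IsWiener G)
    {t : ℝ} {u v : L2T L} (hu : ∀ n, fourierCoeff u n = hat F t n)
    (hv : ∀ n, fourierCoeff v n = hat G t n) (n : ℤ) :
    fourierCoeff (fun x => v x * u x) n = hat (conv G F) t n := by
  rw [hat_conv hG hF, fourierCoeff_mul_eq_tsum]
  simp only [hu, hv]

theorem fourierCoeff_norm_sq_eq_hat_conv {F : ℤ × ℝ → ℂ} (hF : IsWiener F)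
    {t : ℝ} {u : L2T L} (hu : ∀ n, fourierCoeff u n = hat F t n) (n : ℤ) :
    fourierCoeff (fun x => ((‖u x‖ ^ 2 : ℝ) : ℂ)) n = hat (conv (cnj F) F) t n := by
  rw [hat_conv hF.cnj hF, fourierCoeff_norm_sq_eq_tsum]
  simp only [hu, hat_cnj, neg_sub]

/-- The pair with space-time Fourier transform `(F, G)` solves the integral equations on
`[0, T]`. -/
structure IsMild (L α β γ T : ℝ) (c d : ℤ → ℂ) (F G : ℤ × ℝ → ℂ) : Prop where
  eq_u : ∀ t ∈ Icc 0 T, ∀ n, hat F t n =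
    duhamelFormula (phiX L) n (c n) (fun t => -(Complex.I * α) * hat (conv G F) t n) t
  eq_v : ∀ t ∈ Icc 0 T, ∀ n, hat G t n = duhamelFormula (phiY L γ) n (d n)
    (fun t => β * (Complex.I * waveNumber L n * hat (conv (cnj F) F) t n)) t

theorem IsMild.isSolution {α β γ T : ℝ} (hT : 0 ≤ T) {u₀ v₀ : L2T L} {F G : ℤ × ℝ → ℂ}
    (hF : IsWiener F) (hG : IsWiener G)
    (h : IsMild L α β γ T (fourierCoeff u₀) (fourierCoeff v₀) F G) {u v : ℝ → L2T L}
    (cu : Continuous u) (cv : Continuous v) (rv : ∀ t, IsRealValued (v t))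
    (hu : ∀ t ∈ Icc 0 T, ∀ n, fourierCoeff (u t) n = hat F t n)
    (hv : ∀ t ∈ Icc 0 T, ∀ n, fourierCoeff (v t) n = hat G t n) :
    IsSolution α β γ T u₀ v₀ u v := by
  have h0 : (0 : ℝ) ∈ Icc 0 T := ⟨le_rfl, hT⟩
  refine ⟨cu.continuousOn, cv.continuousOn, fun t _ => rv t, L2T_ext fun n => ?_,
    L2T_ext fun n => ?_, fun t ht n => ?_, fun t ht n => ?_⟩
  · rw [hu 0 h0, h.eq_u 0 h0, duhamelFormula_zero]
  · rw [hv 0 h0, h.eq_v 0 h0, duhamelFormula_zero]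
  · have hc := (isSliceIntegrable_conv hG hF).continuous_hat n
    have hd := (hasDerivAt_duhamelFormula (phiX L) n (fourierCoeff u₀ n)
      (h := fun t => -(Complex.I * α) * hat (conv G F) t n) (by fun_prop) t).hasDerivWithinAt
      (s := Icc 0 T)
    refine ⟨_, hd.congr (fun t' ht' => ?_) ?_, ?_⟩
    · rw [hu t' ht', h.eq_u t' ht']
    · rw [hu t ht, h.eq_u t ht]
    · rw [fourierCoeff_mul_eq_hat_conv hF hG (hu t ht) (hv t ht), hu t ht, ← h.eq_u t ht, phiX]
      push_cast
      ring_nf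
      simp only [Complex.I_sq]
      ring
  · have hc := (isSliceIntegrable_conv hF.cnj hF).continuous_hat n
    have hd := (hasDerivAt_duhamelFormula (phiY L γ) n (fourierCoeff v₀ n)
      (h := fun t => β * (Complex.I * waveNumber L n * hat (conv (cnj F) F) t n))
      (by fun_prop) t).hasDerivWithinAt (s := Icc 0 T)
    refine ⟨_, hd.congr (fun t' ht' => ?_) ?_, ?_⟩
    · rw [hv t' ht', h.eq_v t' ht']
    · rw [hv t ht, h.eq_v t ht]
    · rw [fourierCoeff_norm_sq_eq_hat_conv hF (hu t ht), hv t ht, ← h.eq_v t ht, phiY]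
      push_cast
      ring

/-- For frequency functions in the Wiener class, the coefficients of the nonlinear terms extend to
continuous functions on the whole line, so the coefficientwise differential equations can be
integrated exactly. -/
theorem IsSolution.isMild {α β γ T : ℝ} {u₀ v₀ : L2T L} {F G : ℤ × ℝ → ℂ}
    (hF : IsWiener F) (hG : IsWiener G) {u v : ℝ → L2T L}
    (h : IsSolution α β γ T u₀ v₀ u v)
    (hu : ∀ t ∈ Icc 0 T, ∀ n, fourierCoeff (u t) n = hat F t n)
    (hv : ∀ t ∈ Icc 0 T, ∀ n, fourierCoeff (v t) n = hat G t n) :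
    IsMild L α β γ T (fourierCoeff u₀) (fourierCoeff v₀) F G := by
  refine ⟨fun t ht n => ?_, fun t ht n => ?_⟩
  · have hc := (isSliceIntegrable_conv hG hF).continuous_hat n
    rw [← hu t ht, ← h.init_u]
    refine eq_duhamelFormula (phiX L) n (c := fun t => fourierCoeff (u t) n) (T := T)
      (by fun_prop) (fun t ht => ?_) ht
    obtain ⟨d, hd, he⟩ := h.eq_u t ht n
    convert hd using 1
    rw [fourierCoeff_mul_eq_hat_conv hF hG (hu t ht) (hv t ht)] at he
    have : d = -Complex.I * (Complex.I * d) := by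
      rw [← mul_assoc, neg_mul, Complex.I_mul_I, neg_neg, one_mul]
    rw [this, eq_sub_of_add_eq he, phiX, mul_pow, Complex.I_sq]
    push_cast
    ring
  · have hc := (isSliceIntegrable_conv hF.cnj hF).continuous_hat n
    rw [← hv t ht, ← h.init_v]
    refine eq_duhamelFormula (phiY L γ) n (c := fun t => fourierCoeff (v t) n) (T := T)
      (by fun_prop) (fun t ht => ?_) ht
    obtain ⟨d, hd, he⟩ := h.eq_v t ht n
    convert hd using 1
    rw [fourierCoeff_norm_sq_eq_hat_conv hF (hu t ht)] at he
    rw [eq_sub_of_add_eq he, phiY]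
    push_cast
    ring

end

section

/-! ### Existence -/

theorem hat_nonlinX (Ψ : SchwartzMap ℝ ℂ) (L α : ℝ) {Λ : ℝ} (hΛ : 1 ≤ Λ) {G F : ℤ × ℝ → ℂ}
    (hG : IsWiener G) (hF : IsWiener F) {t : ℝ} (ht : 0 ≤ t) (n : ℤ) :
    hat (nonlinX Ψ L α Λ G F) t n = Ψ (Λ * t) * duhamelFormula (phiX L) n 0
      (fun t => -(Complex.I * α) * hat (conv G F) t n) t := by
  rw [nonlinX, hat_smul, hat_duhamel Ψ hΛ _ (isSliceIntegrable_conv hG hF) ht, duhamelFormula,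
    zero_add, mul_left_comm, mul_left_comm _ (echar _ t), ← intervalIntegral.integral_const_mul]
  congr 3
  funext t'
  ring

theorem hat_nonlinY (Ψ : SchwartzMap ℝ ℂ) (L β γ : ℝ) {Λ : ℝ} (hΛ : 1 ≤ Λ) {F F' : ℤ × ℝ → ℂ}
    (hF : IsWiener F) (hF' : IsWiener F') {t : ℝ} (ht : 0 ≤ t) (n : ℤ) :
    hat (nonlinY Ψ L β γ Λ F F') t n = Ψ (Λ * t) * duhamelFormula (phiY L γ) n 0
      (fun t => β * (Complex.I * waveNumber L n * hat (conv (cnj F') F) t n)) t := by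
  rw [nonlinY, hat_smul, hat_duhamel Ψ hΛ _ ((isSliceIntegrable_conv hF'.cnj hF).dx L) ht,
    duhamelFormula, zero_add, mul_left_comm, mul_left_comm _ (echar _ t),
    ← intervalIntegral.integral_const_mul]
  congr 3
  funext t'
  rw [hat_dx]
  ring

theorem echar_mul_add_duhamelFormula (φ : ℤ → ℝ) (n : ℤ) (c : ℂ) (h : ℝ → ℂ) (t : ℝ) :
    echar (-freqShift φ n) t * c + duhamelFormula φ n 0 h t = duhamelFormula φ n c h t := by
  simp only [duhamelFormula]
  ring

theorem isSliceIntegrable_nonlinX (Ψ : SchwartzMap ℝ ℂ) (L α : ℝ) {Λ : ℝ} (hΛ : 1 ≤ Λ)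
    {G F : ℤ × ℝ → ℂ} (hG : IsWiener G) (hF : IsWiener F) :
    IsSliceIntegrable (nonlinX Ψ L α Λ G F) :=
  (isSliceIntegrable_duhamel Ψ hΛ _ (isSliceIntegrable_conv hG hF)).smul _

theorem isSliceIntegrable_nonlinY (Ψ : SchwartzMap ℝ ℂ) (L β γ : ℝ) {Λ : ℝ} (hΛ : 1 ≤ Λ)
    {F F' : ℤ × ℝ → ℂ} (hF : IsWiener F) (hF' : IsWiener F') :
    IsSliceIntegrable (nonlinY Ψ L β γ Λ F F') :=
  (isSliceIntegrable_duhamel Ψ hΛ _ ((isSliceIntegrable_conv hF'.cnj hF).dx L)).smul _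

/-- The localized equation agrees with the true one wherever the cutoff equals 1, in particular on
[0, T]. -/
theorem isMild_of_fixedPoint {Ψ : SchwartzMap ℝ ℂ} {L α β γ T Λ : ℝ} (hΛ : 1 ≤ Λ)
    (hΨ : ∀ t ∈ Icc 0 T, Ψ (Λ * t) = 1) {c d : ℤ → ℂ} {F G : ℤ × ℝ → ℂ}
    (wF : IsWiener F) (wG : IsWiener G)
    (hF : F =ᵐ[freqMeasure] free Ψ Λ (phiX L) c + nonlinX Ψ L α Λ G F)
    (hG : G =ᵐ[freqMeasure] free Ψ Λ (phiY L γ) d + nonlinY Ψ L β γ Λ F F) :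
    IsMild L α β γ T c d F G := by
  have hΛ0 : 0 < Λ := by linarith
  refine ⟨fun t ht n => ?_, fun t ht n => ?_⟩
  · rw [hat_congr hF, hat_add (isSliceIntegrable_free Ψ hΛ0 _ _)
      (isSliceIntegrable_nonlinX Ψ L α hΛ wG wF), hat_free Ψ hΛ0, hat_nonlinX Ψ L α hΛ wG wF ht.1,
      hΨ t ht, one_mul, one_mul, echar_mul_add_duhamelFormula]
  · rw [hat_congr hG, hat_add (isSliceIntegrable_free Ψ hΛ0 _ _)
      (isSliceIntegrable_nonlinY Ψ L β γ hΛ wF wF), hat_free Ψ hΛ0,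
      hat_nonlinY Ψ L β γ hΛ wF wF ht.1, hΨ t ht, one_mul, one_mul, echar_mul_add_duhamelFormula]

/-- The Fourier form of the fact that |u|² is real. -/
theorem cnj_conv_cnj (F : ℤ × ℝ → ℂ) : cnj (conv (cnj F) F) = conv (cnj F) F := by
  funext p
  rw [cnj, conv, conv, ← integral_conj, ← integral_sub_right_eq_self _ p]
  refine integral_congr_ae (Filter.Eventually.of_forall fun q => ?_)
  simp only [cnj, map_mul, Complex.conj_conj]
  rw [show -(-p - (q - p)) = q by abel, show -(p - q) = q - p by abel, mul_comm]

theorem conj_duhamelFormula {φ : ℤ → ℝ} (hφ : ∀ n, φ (-n) = -φ n) (n : ℤ) (c : ℂ) (h : ℝ → ℂ)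
    (t : ℝ) : starRingEnd ℂ (duhamelFormula φ n c h t) =
      duhamelFormula φ (-n) (starRingEnd ℂ c) (fun t => starRingEnd ℂ (h t)) t := by
  have h1 : freqShift φ (-n) = -freqShift φ n := by rw [freqShift, freqShift, hφ, neg_div]
  simp only [duhamelFormula, intervalIntegral, map_mul, map_add, map_sub, ← integral_conj,
    conj_echar, h1, neg_neg]

/-- The fixed point is sought among complex-valued v. On [0, T], however, v is given by the Duhamel
formula with real data, an odd phase and the real forcing (|u|²)ₓ, and is therefore real there. -/
theorem IsMild.hat_neg {L α β γ T : ℝ} {c d : ℤ → ℂ} {F G : ℤ × ℝ → ℂ}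
    (h : IsMild L α β γ T c d F G) (hd : ∀ n, d (-n) = starRingEnd ℂ (d n)) {t : ℝ}
    (ht : t ∈ Icc 0 T) (n : ℤ) : hat G t (-n) = starRingEnd ℂ (hat G t n) := by
  rw [h.eq_v t ht, h.eq_v t ht, conj_duhamelFormula (phiY_neg L γ), hd]
  congr 1
  funext t'
  rw [hat_neg_of_cnj_eq (cnj_conv_cnj F)]
  have : waveNumber L (-n) = -waveNumber L n := by
    simp only [waveNumber]
    push_cast
    ring
  rw [this]
  simp

/-- The complexified cutoff. -/
def IsCutoff.schwartz {ψ : ℝ → ℝ} (hψ : IsCutoff ψ) : SchwartzMap ℝ ℂ :=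
  HasCompactSupport.toSchwartzMap (f := fun t => (ψ t : ℂ))
    ((HasCompactSupport.of_support_subset_isCompact isCompact_Icc
      ((subset_tsupport ψ).trans hψ.support)).comp_left (g := Complex.ofReal) rfl)
    (Complex.ofRealCLM.contDiff.comp hψ.smooth)

theorem IsCutoff.schwartz_apply {ψ : ℝ → ℝ} (hψ : IsCutoff ψ) (t : ℝ) :
    hψ.schwartz t = (ψ t : ℂ) := rfl

theorem IsCutoff.schwartz_eq_one {ψ : ℝ → ℝ} (hψ : IsCutoff ψ) {Λ : ℝ} (hΛ : 0 < Λ) :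
    ∀ t ∈ Icc 0 Λ⁻¹, hψ.schwartz (Λ * t) = 1 := by
  intro t ht
  have h1 : Λ * t ≤ 1 := by
    have := mul_le_mul_of_nonneg_left ht.2 hΛ.le
    rwa [mul_inv_cancel₀ hΛ.ne'] at this
  have h2 : 0 ≤ Λ * t := mul_nonneg hΛ.le ht.1
  rw [hψ.schwartz_apply, hψ.eq_one _ ⟨by linarith, h1⟩, Complex.ofReal_one]

theorem exists_large (M e : ℝ) (he : e < 0) : ∃ Λ : ℝ, 1 ≤ Λ ∧ M * Λ ^ e < 1 := by
  have h := (tendsto_rpow_neg_atTop (y := -e) (by linarith)).const_mul M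
  rw [mul_zero, neg_neg] at h
  obtain ⟨Λ, h1, h2⟩ := ((h.eventually_lt_const one_pos).and
    (Filter.eventually_ge_atTop (1 : ℝ))).exists
  exact ⟨Λ, h2, h1⟩

/-! ### The coupled quadratic system as one fixed-point equation -/

section Fixed

variable {E D D' : Type*} [NormedAddCommGroup E] [NormedSpace ℝ E]
  [NormedAddCommGroup D] [NormedSpace ℝ D] [NormedAddCommGroup D'] [NormedSpace ℝ D']

/-- The quadratic part of the system. -/
def systemBilin (B₁ B₂ : E →L[ℝ] E →L[ℝ] E) : (E × E) →L[ℝ] (E × E) →L[ℝ] (E × E) :=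
  LinearMap.mkContinuous₂
    (LinearMap.mk₂ ℝ (fun x y : E × E => (B₁ x.2 y.1, B₂ x.1 y.1))
      (fun x x' y => by simp) (fun c x y => by simp) (fun x y y' => by simp)
      (fun c x y => by simp))
    (‖B₁‖ + ‖B₂‖) fun x y => by
      rw [LinearMap.mk₂_apply, Prod.norm_def]
      have h1 := norm_fst_le x
      have h2 := norm_snd_le x
      have h3 := norm_fst_le y
      refine max_le ?_ ?_
      · calc ‖B₁ x.2 y.1‖ ≤ ‖B₁‖ * ‖x.2‖ * ‖y.1‖ := B₁.le_opNorm₂ _ _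
          _ ≤ (‖B₁‖ + ‖B₂‖) * ‖x‖ * ‖y‖ := by
            gcongr
            linarith [norm_nonneg B₂]
      · calc ‖B₂ x.1 y.1‖ ≤ ‖B₂‖ * ‖x.1‖ * ‖y.1‖ := B₂.le_opNorm₂ _ _
          _ ≤ (‖B₁‖ + ‖B₂‖) * ‖x‖ * ‖y‖ := by
            gcongr
            linarith [norm_nonneg B₁]

theorem norm_systemBilin_le (B₁ B₂ : E →L[ℝ] E →L[ℝ] E) : ‖systemBilin B₁ B₂‖ ≤ ‖B₁‖ + ‖B₂‖ :=
  LinearMap.mkContinuous₂_norm_le _ (by positivity) _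

theorem exists_contDiffOn_system_solution [CompleteSpace E] (B₁ B₂ : E →L[ℝ] E →L[ℝ] E)
    (l₁ : D →L[ℝ] E) (l₂ : D' →L[ℝ] E) {R : ℝ} (hR : 0 < R)
    (h : 8 * (‖B₁‖ + ‖B₂‖) * ((‖l₁‖ + ‖l₂‖ + 1) * R) < 1) :
    ∃ x : D × D' → E × E, ContDiffOn ℝ ∞ x {d | ‖d.1‖ < R ∧ ‖d.2‖ < R} ∧
      ∀ d, ‖d.1‖ < R → ‖d.2‖ < R → (x d).1 = l₁ d.1 + B₁ (x d).2 (x d).1 ∧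
        (x d).2 = l₂ d.2 + B₂ (x d).1 (x d).1 := by
  have hQ : 8 * ‖systemBilin B₁ B₂‖ * ((‖l₁‖ + ‖l₂‖ + 1) * R) < 1 := by
    refine lt_of_le_of_lt ?_ h
    gcongr
    exact norm_systemBilin_le B₁ B₂
  obtain ⟨σ, hσ, hσ'⟩ := exists_contDiffOn_fixedPoint (systemBilin B₁ B₂) hQ
  -- The summand 1 in the radius keeps the inequality strict even when the linear maps vanish.
  have hl : ∀ d : D × D', ‖d.1‖ < R → ‖d.2‖ < R →
      l₁.prodMap l₂ d ∈ Metric.ball (0 : E × E) ((‖l₁‖ + ‖l₂‖ + 1) * R) := by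
    intro d h1 h2
    rw [mem_ball_zero_iff, Prod.norm_def]
    have h3 := norm_nonneg l₁
    have h4 := norm_nonneg l₂
    refine max_lt ?_ ?_
    · refine lt_of_le_of_lt (l₁.le_opNorm d.1) ?_
      nlinarith [norm_nonneg d.1]
    · refine lt_of_le_of_lt (l₂.le_opNorm d.2) ?_
      nlinarith [norm_nonneg d.2]
  refine ⟨fun d => σ (l₁.prodMap l₂ d), hσ.comp (l₁.prodMap l₂).contDiff.contDiffOn
    fun d hd => hl d hd.1 hd.2, fun d h1 h2 => ?_⟩
  have h3 := hσ' _ (hl d h1 h2)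
  exact ⟨congrArg Prod.fst h3, congrArg Prod.snd h3⟩

end Fixed

end

/-- The fixed point is found in L²(ℤ × ℝ) × L²(ℤ × ℝ), the frequency functions multiplied by their
Λ-weights, and T = 1/Λ. Both solution maps are this smooth fixed-point map followed by bounded
real-linear maps: synthesis of a space-time function, and restriction to [0, T]. -/
theorem exists_solution_map (L : ℝ) [Fact (0 < L)] (α β : ℝ) {γ s b : ℝ} (hγ : |γ| ≠ 1)
    (hs : 1 / 2 ≤ s) {ψ : ℝ → ℝ} (hψ : IsCutoff ψ) (hb : 1 / 2 < b) (hb' : b < 9 / 16) {R : ℝ}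
    (hR : 0 < R) : ∃ T : ℝ, 0 < T ∧
      ∃ (S : Hs L s × HsReal L (s - 1 / 2) → XPer L s b × YPer L γ (s - 1 / 2) b)
        (Sc : Hs L s × HsReal L (s - 1 / 2) →
          C(Icc (0 : ℝ) T, Hs L s) × C(Icc (0 : ℝ) T, HsReal L (s - 1 / 2))),
        (∀ (u₀ : Hs L s) (v₀ : HsReal L (s - 1 / 2)), ‖u₀‖ < R → ‖v₀‖ < R →
          ∃ u v : ℝ → L2T L, IsSolution α β γ T u₀.toL2 v₀.1.toL2 u v ∧
            Represents ψ T u (S (u₀, v₀)).1.toL2 ∧ Represents ψ T v (S (u₀, v₀)).2.1.toL2 ∧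
            ∀ t : Icc (0 : ℝ) T,
              ((Sc (u₀, v₀)).1 t).toL2 = u t ∧ ((Sc (u₀, v₀)).2 t).1.toL2 = v t) ∧
        ContDiffOn ℝ ∞ S {d | ‖d.1‖ < R ∧ ‖d.2‖ < R} ∧
        ContDiffOn ℝ ∞ Sc {d | ‖d.1‖ < R ∧ ‖d.2‖ < R} := by
  have hb58 : b ≤ 5 / 8 := by linarith
  have hb0 : 0 ≤ b := by linarith
  have hs0 : 0 ≤ s := by linarith
  have hs1 : 0 ≤ s - 1 / 2 := by linarith
  set Ψ := hψ.schwartz with hΨ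
  obtain ⟨K₁, hK₁⟩ := exists_isBddLin_free Ψ L hs0 hb58
  obtain ⟨K₂, hK₂⟩ := exists_isBddLin_free Ψ L hs1 hb58
  obtain ⟨C₁, hC₁⟩ := exists_isBddBilin_nonlinX Ψ L α hγ hs hb hb58
  obtain ⟨C₂, hC₂⟩ := exists_isBddBilin_nonlinY Ψ L β hγ hs hb hb58
  -- The exponent is (b - 5/8) + (b - 1/2), from the quadratic part and from the free evolution of
  -- data of size R. It is negative exactly for b < 9/16.
  obtain ⟨Λ, hΛ, hsmall⟩ := exists_large (8 * (C₁ + C₂) * ((K₁ + K₂ + 1) * R)) (2 * b - 9 / 8)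
    (by linarith)
  have hΛ0 : 0 < Λ := by linarith
  have lX := hK₁ (phiX L) Λ hΛ
  have lY := (hK₂ (phiY L γ) Λ hΛ).restrict_real
  have bX := hC₁ Λ hΛ
  have bY := hC₂ Λ hΛ
  have hsm : 8 * (‖bX.toLp hΛ‖ + ‖bY.toLp hΛ‖) * ((‖lX.toLp hΛ‖ + ‖lY.toLp hΛ‖ + 1) * R) < 1 := by
    refine lt_of_le_of_lt ?_ hsmall
    have e1 := bX.norm_toLp_le hΛ
    have e2 := bY.norm_toLp_le hΛ
    have e3 := lX.norm_toLp_le hΛ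
    have e4 := lY.norm_toLp_le hΛ
    rw [NNReal.coe_mul, Real.coe_toNNReal _ (by positivity)] at e1 e2 e3 e4
    have e5 : 1 ≤ Λ ^ (b - 1 / 2) := Real.one_le_rpow hΛ (by linarith)
    calc _ ≤ 8 * (C₁ * Λ ^ (b - 5 / 8) + C₂ * Λ ^ (b - 5 / 8)) *
          ((K₁ * Λ ^ (b - 1 / 2) + K₂ * Λ ^ (b - 1 / 2) + Λ ^ (b - 1 / 2)) * R) := by gcongr
      _ = 8 * (C₁ + C₂) * ((K₁ + K₂ + 1) * R) * (Λ ^ (b - 5 / 8) * Λ ^ (b - 1 / 2)) := by ring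
      _ = _ := by
        rw [← Real.rpow_add hΛ0]
        ring_nf
  obtain ⟨x, hx, hfix⟩ := exists_contDiffOn_system_solution (bX.toLp hΛ) (bY.toLp hΛ)
    (lX.toLp hΛ) (lY.toLp hΛ) hR hsm
  have uX := (isBddLin_unweight (φ := phiX L) (s := s) (b := b) hΛ).one hΛ hb0
  have uY := (isBddLin_unweight (φ := phiY L γ) (s := s - 1 / 2) (b := b) hΛ).one hΛ hb0
  -- The second component may fail to be real outside [0, T]. Taking its real part puts it into the
  -- real space for all times and leaves it unchanged on [0, T].
  have uR := uY.realPart (phiY_neg L γ)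
  have hreal : ∀ g, cnj (realPart (unweight (phiY L γ) Λ (s - 1 / 2) b g)) =
    realPart (unweight (phiY L γ) Λ (s - 1 / 2) b g) := fun g => cnj_realPart _
  have hvr := uR.isRealValued_value L hs1 hb hreal
  have hsr := uR.isRealValued_synth L hs1 hb hreal
  let SX : Lp ℂ 2 freqMeasure →L[ℝ] XPer L s b := uX.synth L hs0 hb
  let SY : Lp ℂ 2 freqMeasure →L[ℝ] YPer L γ (s - 1 / 2) b :=
    (uR.synth L hs1 hb).codRestrict (YPer L γ (s - 1 / 2) b) hsr
  have hT : 0 < Λ⁻¹ := inv_pos.mpr hΛ0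
  refine ⟨Λ⁻¹, hT, fun d => SX.prodMap SY (x d), fun d =>
    (uX.trace L hs0 hb Λ⁻¹).prodMap (uR.traceReal L hs1 hb Λ⁻¹ hvr) (x d), ?_,
    (SX.prodMap SY).contDiff.comp_contDiffOn hx,
    ((uX.trace L hs0 hb Λ⁻¹).prodMap (uR.traceReal L hs1 hb Λ⁻¹ hvr)).contDiff.comp_contDiffOn hx⟩
  intro u₀ v₀ hu₀ hv₀
  obtain ⟨e1, e2⟩ := hfix (u₀, v₀) hu₀ hv₀
  set f := (x (u₀, v₀)).1 with hf
  set g := (x (u₀, v₀)).2 with hg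
  set F := unweight (phiX L) Λ s b f with hF
  set G := unweight (phiY L γ) Λ (s - 1 / 2) b g with hG
  have wF : IsWiener F := uX.isWiener hs0 hb f
  have wG : IsWiener G := uY.isWiener hs1 hb g
  have aF : F =ᵐ[freqMeasure] free Ψ Λ (phiX L) (fourierCoeff u₀.toL2) + nonlinX Ψ L α Λ G F := by
    refine (Filter.EventuallyEq.of_eq (congrArg (unweight (phiX L) Λ s b) e1)).trans ?_
    exact (unweight_add _ _ _ _ _ _).trans ((lX.unweight_toLp hΛ u₀).add
      (bX.unweight_toLp hΛ g f))
  have aG : G =ᵐ[freqMeasure] free Ψ Λ (phiY L γ) (fourierCoeff v₀.1.toL2) +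
      nonlinY Ψ L β γ Λ F F := by
    refine (Filter.EventuallyEq.of_eq
      (congrArg (unweight (phiY L γ) Λ (s - 1 / 2) b) e2)).trans ?_
    exact (unweight_add _ _ _ _ _ _).trans ((lY.unweight_toLp hΛ v₀).add
      (bY.unweight_toLp hΛ f f))
  have hΨ1 := hψ.schwartz_eq_one hΛ0
  have mild := isMild_of_fixedPoint (β := β) (γ := γ) hΛ hΨ1 wF wG aF aG
  have hu : ∀ t n, fourierCoeff (uX.value L hs0 hb f t).toL2 n = hat F t n :=
    uX.fourierCoeff_value L hs0 hb f
  have hv' : ∀ t ∈ Icc 0 Λ⁻¹, ∀ n, hat (realPart G) t n = hat G t n := by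
    intro t ht n
    rw [hat_realPart wG, mild.hat_neg (isRealValued_iff_fourierCoeff.mp v₀.2) ht,
      Complex.conj_conj]
    ring
  have hv : ∀ t ∈ Icc 0 Λ⁻¹, ∀ n, fourierCoeff (uR.value L hs1 hb g t).toL2 n = hat G t n := by
    intro t ht n
    rw [uR.fourierCoeff_value L hs1 hb g t n]
    exact hv' t ht n
  have hrep : ∀ t ∈ Icc 0 Λ⁻¹, ψ (t / Λ⁻¹) = 1 := by
    intro t ht
    have h1 := hΨ1 t ht
    rw [hψ.schwartz_apply] at h1
    rw [div_inv_eq_mul, mul_comm]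
    exact_mod_cast h1
  refine ⟨fun t => (uX.value L hs0 hb f t).toL2, fun t => (uR.value L hs1 hb g t).toL2,
    mild.isSolution hT.le wF wG
      ((Hs.continuous_toL2 hs0).comp (uX.continuous_value L hs0 hb f))
      ((Hs.continuous_toL2 hs1).comp (uR.continuous_value L hs1 hb g)) (hvr g)
      (fun t _ => hu t) hv, ?_, ?_, fun t => ⟨rfl, rfl⟩⟩
  · have h1 := uX.fourierCoeff_synth L hs0 hb f
    rw [Represents, ae_restrict_iff' measurableSet_Icc]
    filter_upwards [h1] with t h2 ht
    rw [hrep t ht, one_smul]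
    exact L2T_ext fun n => (hu t n).trans (h2 n).symm
  · have h1 := uR.fourierCoeff_synth L hs1 hb g
    rw [Represents, ae_restrict_iff' measurableSet_Icc]
    filter_upwards [h1] with t h2 ht
    rw [hrep t ht, one_smul]
    exact L2T_ext fun n => (uR.fourierCoeff_value L hs1 hb g t n).trans (h2 n).symm

/-! ### Uniqueness -/

/-- Both sides solve the same linear equation in τ with the same value at τ = 0. -/
theorem duhamelFormula_add_time (φ : ℤ → ℝ) (n : ℤ) (c₀ : ℂ) {h : ℝ → ℂ} (hh : Continuous h)
    (t₀ : ℝ) {τ : ℝ} (hτ : 0 ≤ τ) : duhamelFormula φ n c₀ h (t₀ + τ) =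
      duhamelFormula φ n (duhamelFormula φ n c₀ h t₀) (fun t => h (t₀ + t)) τ := by
  have h1 := eq_duhamelFormula φ n (c := fun τ => duhamelFormula φ n c₀ h (t₀ + τ))
    (h := fun t => h (t₀ + t)) (by fun_prop) (T := τ) (fun t _ =>
      ((hasDerivAt_duhamelFormula φ n c₀ hh (t₀ + t)).comp_const_add t₀ t).hasDerivWithinAt)
    (t := τ) ⟨hτ, le_rfl⟩
  simpa only [add_zero] using h1

theorem hat_conv_shift {G F : ℤ × ℝ → ℂ} (hG : IsWiener G) (hF : IsWiener F) (t₀ t : ℝ) (n : ℤ) :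
    hat (conv (shift t₀ G) (shift t₀ F)) t n = hat (conv G F) (t₀ + t) n := by
  rw [hat_conv (hG.shift t₀) (hF.shift t₀), hat_conv hG hF]
  simp only [hat_shift]

theorem IsMild.shift {L α β γ T : ℝ} {c d : ℤ → ℂ} {F G : ℤ × ℝ → ℂ}
    (h : IsMild L α β γ T c d F G) (hF : IsWiener F) (hG : IsWiener G) {t₀ : ℝ}
    (ht₀ : t₀ ∈ Icc 0 T) :
    IsMild L α β γ (T - t₀) (hat F t₀) (hat G t₀) (SBO.shift t₀ F) (SBO.shift t₀ G) := by
  have hm : ∀ t ∈ Icc 0 (T - t₀), t₀ + t ∈ Icc 0 T := fun t ht =>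
    ⟨by linarith [ht.1, ht₀.1], by linarith [ht.2]⟩
  refine ⟨fun t ht n => ?_, fun t ht n => ?_⟩
  · have hc := (isSliceIntegrable_conv hG hF).continuous_hat n
    rw [hat_shift, h.eq_u _ (hm t ht), duhamelFormula_add_time _ _ _ (by fun_prop) _ ht.1,
      ← h.eq_u t₀ ht₀]
    simp only [hat_conv_shift hG hF]
  · have hc := (isSliceIntegrable_conv hF.cnj hF).continuous_hat n
    rw [hat_shift, h.eq_v _ (hm t ht), duhamelFormula_add_time _ _ _ (by fun_prop) _ ht.1,
      ← h.eq_v t₀ ht₀]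
    have h1 : ∀ t', hat (conv (cnj (SBO.shift t₀ F)) (SBO.shift t₀ F)) t' n =
        hat (conv (cnj F) F) (t₀ + t') n := by
      intro t'
      rw [hat_conv (hF.shift t₀).cnj (hF.shift t₀), hat_conv hF.cnj hF]
      simp only [hat_shift, hat_cnj]
    simp only [h1]

/-! ### Contraction for the difference of two solutions -/

/-- The sum of the squared norms of a pair in `X^{s,b} × Y^{s-1/2,b}`. -/
def pairSq (L γ s b : ℝ) (W Z : ℤ × ℝ → ℂ) : ℝ≥0∞ :=
  nsq (phiX L) 1 s b W + nsq (phiY L γ) 1 (s - 1 / 2) b Z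

theorem enorm_hat_sq_le {φ : ℤ → ℝ} {s b : ℝ} (hs : 0 ≤ s) {F : ℤ × ℝ → ℂ} (hF : Measurable F)
    (t : ℝ) (n : ℤ) : ‖hat F t n‖ₑ ^ 2 ≤ embC b * nsq φ 1 s b F := by
  refine le_trans ?_ (tsum_sq_l1_le hF)
  refine le_trans ?_ (ENNReal.le_tsum n)
  gcongr
  refine (enorm_hat_le F t n).trans (le_mul_of_one_le_left zero_le ?_)
  rw [ENNReal.one_le_ofReal]
  exact Real.one_le_rpow (one_le_bracket _) hs

/-- One step of the iteration for the difference of two solutions. -/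
structure DiffStep (Ψ : SchwartzMap ℝ ℂ) (L α β γ μ : ℝ) (F₁ G₁ F₂ : ℤ × ℝ → ℂ)
    (W Z W' Z' : ℤ × ℝ → ℂ) : Prop where
  eq_W : W' = nonlinX Ψ L α μ G₁ W + nonlinX Ψ L α μ Z F₂
  eq_Z : Z' = nonlinY Ψ L β γ μ W F₁ + nonlinY Ψ L β γ μ F₂ W

/-- Equal data leave no free part in the difference, so nothing is lost to the free evolution and b
< 5/8 suffices. Since F₁, G₁ and F₂ have bounded norms, the step is linear in (W, Z) with small
coefficients once μ is large. -/
theorem exists_pairSq_diffStep_le (Ψ : SchwartzMap ℝ ℂ) (L : ℝ) [Fact (0 < L)] (α β : ℝ)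
    {γ s b : ℝ} (hγ : |γ| ≠ 1) (hs : 1 / 2 ≤ s) (hb : 1 / 2 < b) (hb' : b < 5 / 8) (M : ℝ≥0) :
    ∃ μ : ℝ, 1 ≤ μ ∧ ∀ F₁ G₁ F₂ W Z W' Z' : ℤ × ℝ → ℂ, Measurable F₁ → Measurable G₁ →
      Measurable F₂ → Measurable W → Measurable Z → nsq (phiX L) 1 s b F₁ ≤ M →
      nsq (phiY L γ) 1 (s - 1 / 2) b G₁ ≤ M → nsq (phiX L) 1 s b F₂ ≤ M →
      DiffStep Ψ L α β γ μ F₁ G₁ F₂ W Z W' Z' →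
      pairSq L γ s b W' Z' ≤ 2⁻¹ * pairSq L γ s b W Z := by
  obtain ⟨C₁, h₁⟩ := exists_nsq_nonlinX_le Ψ L α hγ hs hb hb'.le
  obtain ⟨C₂, h₂⟩ := exists_nsq_nonlinY_le Ψ L β hγ hs hb hb'.le
  -- The norms are squared here, so the gain is μ^{2(b - 5/8)}. The constant 8 makes the factor
  -- 4(C₁² + C₂²)M μ^{2b-5/4} at most 1/2.
  obtain ⟨μ, hμ, hsmall⟩ := exists_large (8 * (C₁ ^ 2 + C₂ ^ 2) * M) (2 * b - 5 / 4) (by linarith)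
  have hμ0 : 0 < μ := by linarith
  have hb0 : 0 ≤ b := by linarith
  refine ⟨μ, hμ, fun F₁ G₁ F₂ W Z W' Z' mF₁ mG₁ mF₂ mW mZ bF₁ bG₁ bF₂ hst => ?_⟩
  set e : ℝ≥0 := (μ ^ (b - 5 / 8)).toNNReal with he
  set x := nsq (phiX L) 1 s b W with hx
  set y := nsq (phiY L γ) 1 (s - 1 / 2) b Z with hy
  have e1 : nsq (phiX L) 1 s b W' ≤ 2 * (((C₁ * e : ℝ≥0) : ℝ≥0∞) ^ 2 * (M * x) +
      ((C₁ * e : ℝ≥0) : ℝ≥0∞) ^ 2 * (y * M)) := by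
    rw [hst.eq_W]
    refine (nsq_one_le hμ hb0 _).trans ((nsq_add_le _ _ _ _
      (measurable_nonlinX Ψ L α μ mG₁ mW)).trans ?_)
    gcongr
    · exact (h₁ μ hμ G₁ W mG₁ mW).trans (by gcongr)
    · exact (h₁ μ hμ Z F₂ mZ mF₂).trans (by gcongr)
  have e2 : nsq (phiY L γ) 1 (s - 1 / 2) b Z' ≤ 2 * (((C₂ * e : ℝ≥0) : ℝ≥0∞) ^ 2 * (x * M) +
      ((C₂ * e : ℝ≥0) : ℝ≥0∞) ^ 2 * (M * x)) := by
    rw [hst.eq_Z]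
    refine (nsq_one_le hμ hb0 _).trans ((nsq_add_le _ _ _ _
      (measurable_nonlinY Ψ L β γ μ mW mF₁)).trans ?_)
    gcongr
    · exact (h₂ μ hμ W F₁ mW mF₁).trans (by gcongr)
    · exact (h₂ μ hμ F₂ W mF₂ mW).trans (by gcongr)
  have hsm : (4 * (C₁ ^ 2 + C₂ ^ 2) * M * e ^ 2 : ℝ≥0) ≤ 2⁻¹ := by
    rw [← NNReal.coe_le_coe]
    push_cast
    have h1 : (μ ^ (b - 5 / 8)) ^ 2 = μ ^ (2 * b - 5 / 4) := by
      rw [← Real.rpow_two, ← Real.rpow_mul hμ0.le]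
      ring_nf
    rw [he, Real.coe_toNNReal _ (by positivity), h1]
    linarith
  have hsm' : ((4 * (C₁ ^ 2 + C₂ ^ 2) * M * e ^ 2 : ℝ≥0) : ℝ≥0∞) ≤ 2⁻¹ := by
    have := ENNReal.coe_le_coe.mpr hsm
    rwa [ENNReal.coe_inv two_ne_zero] at this
  calc pairSq L γ s b W' Z' ≤ 2 * (((C₁ * e : ℝ≥0) : ℝ≥0∞) ^ 2 * (M * x) +
        ((C₁ * e : ℝ≥0) : ℝ≥0∞) ^ 2 * (y * M)) + 2 * (((C₂ * e : ℝ≥0) : ℝ≥0∞) ^ 2 * (x * M) +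
        ((C₂ * e : ℝ≥0) : ℝ≥0∞) ^ 2 * (M * x)) := add_le_add e1 e2
    _ ≤ ((4 * (C₁ ^ 2 + C₂ ^ 2) * M * e ^ 2 : ℝ≥0) : ℝ≥0∞) * (x + y) := by
        push_cast
        have : (4 * (C₁ ^ 2 + C₂ ^ 2) * M * e ^ 2 : ℝ≥0∞) * (x + y) =
          (2 * ((C₁ * e) ^ 2 * (M * x) + (C₁ * e) ^ 2 * (y * M)) +
            2 * ((C₂ * e) ^ 2 * (x * M) + (C₂ * e) ^ 2 * (M * x))) +
            (2 * (C₁ * e) ^ 2 * M * (x + y) + 4 * (C₂ * e) ^ 2 * M * y) := by ring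
        rw [this]
        exact le_self_add
    _ ≤ 2⁻¹ * pairSq L γ s b W Z := mul_le_mul_left hsm' _

theorem isWiener_of_pairSq {L γ s b : ℝ} (hs : 1 / 2 ≤ s) (hb : 1 / 2 < b) {W Z : ℤ × ℝ → ℂ}
    (mW : Measurable W) (mZ : Measurable Z) (h : pairSq L γ s b W Z ≠ ⊤) :
    IsWiener W ∧ IsWiener Z := by
  rw [pairSq, ENNReal.add_ne_top] at h
  exact ⟨isWiener_of_nsq (by linarith) hb mW h.1, isWiener_of_nsq (by linarith) hb mZ h.2⟩

/-- The Fourier coefficients after one step of the iteration, if those of `(W, Z)` are the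
differences of those of the solutions `(F₁, G₁)` and `(F₂, G₂)`. -/
theorem DiffStep.hat_eq {Ψ : SchwartzMap ℝ ℂ} {L α β γ μ T : ℝ} (hμ : 1 ≤ μ) {c d : ℤ → ℂ}
    {F₁ G₁ F₂ G₂ W Z W' Z' : ℤ × ℝ → ℂ} (wF₁ : IsWiener F₁) (wG₁ : IsWiener G₁)
    (wF₂ : IsWiener F₂) (wG₂ : IsWiener G₂) (wW : IsWiener W) (wZ : IsWiener Z)
    (h₁ : IsMild L α β γ T c d F₁ G₁) (h₂ : IsMild L α β γ T c d F₂ G₂)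
    (hst : DiffStep Ψ L α β γ μ F₁ G₁ F₂ W Z W' Z') {t : ℝ} (ht : t ∈ Icc 0 T)
    (hΨ : Ψ (μ * t) = 1)
    (hW : ∀ t' ∈ Icc 0 t, ∀ n, hat W t' n = hat F₁ t' n - hat F₂ t' n)
    (hZ : ∀ t' ∈ Icc 0 t, ∀ n, hat Z t' n = hat G₁ t' n - hat G₂ t' n) (n : ℤ) :
    hat W' t n = hat F₁ t n - hat F₂ t n ∧ hat Z' t n = hat G₁ t n - hat G₂ t n := by
  -- In the difference of two Duhamel formulas the common initial value cancels, and only the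
  -- forcing on [0, t] matters.
  have key : ∀ (φ : ℤ → ℝ) (c₀ : ℂ) (k₁ k₂ k₃ k₄ : ℝ → ℂ), Continuous k₁ → Continuous k₂ →
      Continuous k₃ → Continuous k₄ → (∀ t' ∈ Icc 0 t, k₁ t' + k₂ t' = k₃ t' - k₄ t') →
      duhamelFormula φ n 0 k₁ t + duhamelFormula φ n 0 k₂ t =
        duhamelFormula φ n c₀ k₃ t - duhamelFormula φ n c₀ k₄ t := by
    intro φ c₀ k₁ k₂ k₃ k₄ c₁ c₂ c₃ c₄ hk
    have ce : ∀ {k : ℝ → ℂ}, Continuous k → IntervalIntegrable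
        (fun t' => echar (freqShift φ n) t' * k t') volume 0 t := fun hk =>
      ((continuous_echar_right (freqShift φ n)).mul hk).intervalIntegrable _ _
    simp only [duhamelFormula]
    rw [← mul_sub, ← mul_add, zero_add, zero_add, add_sub_add_left_eq_sub,
      ← intervalIntegral.integral_add (ce c₁) (ce c₂),
      ← intervalIntegral.integral_sub (ce c₃) (ce c₄)]
    congr 1
    refine intervalIntegral.integral_congr fun t' ht' => ?_
    rw [uIcc_of_le ht.1] at ht'
    simp only [← mul_add, ← mul_sub, hk t' ht']
  have cc : ∀ {G F : ℤ × ℝ → ℂ}, IsWiener G → IsWiener F → Continuous fun t => hat (conv G F) t n :=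
    fun hG hF => (isSliceIntegrable_conv hG hF).continuous_hat n
  have tw : ∀ {G F : ℤ × ℝ → ℂ}, IsWiener G → IsWiener F → ∀ t', Summable fun m =>
      hat F t' m * hat G t' (n - m) := by
    intro G F hG hF t'
    refine Summable.of_enorm ?_
    refine ne_top_of_le_ne_top (tsum_l1_mul_l1_ne_top hG hF n) (ENNReal.tsum_le_tsum fun m => ?_)
    rw [enorm_mul]
    gcongr
    · exact enorm_hat_le _ _ _
    · exact enorm_hat_le _ _ _
  constructor
  · rw [hst.eq_W, hat_add (isSliceIntegrable_nonlinX Ψ L α hμ wG₁ wW)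
      (isSliceIntegrable_nonlinX Ψ L α hμ wZ wF₂), hat_nonlinX Ψ L α hμ wG₁ wW ht.1,
      hat_nonlinX Ψ L α hμ wZ wF₂ ht.1, hΨ, one_mul, one_mul, h₁.eq_u t ht, h₂.eq_u t ht]
    refine key _ _ _ _ _ _ (continuous_const.mul (cc wG₁ wW)) (continuous_const.mul (cc wZ wF₂))
      (continuous_const.mul (cc wG₁ wF₁)) (continuous_const.mul (cc wG₂ wF₂)) fun t' ht' => ?_
    rw [← mul_add, ← mul_sub]
    congr 1
    -- This is G₁(F₁ - F₂) + (G₁ - G₂)F₂ = G₁F₁ - G₂F₂, compared term by term in the convolution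
    -- sums.
    rw [hat_conv wG₁ wW, hat_conv wZ wF₂, hat_conv wG₁ wF₁, hat_conv wG₂ wF₂,
      ← (tw wG₁ wW t').tsum_add (tw wZ wF₂ t'), ← (tw wG₁ wF₁ t').tsum_sub (tw wG₂ wF₂ t')]
    congr 1
    funext m
    rw [hW t' ht', hZ t' ht']
    ring
  · rw [hst.eq_Z, hat_add (isSliceIntegrable_nonlinY Ψ L β γ hμ wW wF₁)
      (isSliceIntegrable_nonlinY Ψ L β γ hμ wF₂ wW), hat_nonlinY Ψ L β γ hμ wW wF₁ ht.1,
      hat_nonlinY Ψ L β γ hμ wF₂ wW ht.1, hΨ, one_mul, one_mul, h₁.eq_v t ht, h₂.eq_v t ht]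
    refine key _ _ _ _ _ _
      (continuous_const.mul (continuous_const.mul (cc wF₁.cnj wW)))
      (continuous_const.mul (continuous_const.mul (cc wW.cnj wF₂)))
      (continuous_const.mul (continuous_const.mul (cc wF₁.cnj wF₁)))
      (continuous_const.mul (continuous_const.mul (cc wF₂.cnj wF₂))) fun t' ht' => ?_
    rw [← mul_add, ← mul_sub, ← mul_add, ← mul_sub]
    congr 2
    -- This is (F₁ - F₂)F̄₁ + F₂(F̄₁ - F̄₂) = |F₁|² - |F₂|², again term by term.
    rw [hat_conv wF₁.cnj wW, hat_conv wW.cnj wF₂, hat_conv wF₁.cnj wF₁, hat_conv wF₂.cnj wF₂,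
      ← (tw wF₁.cnj wW t').tsum_add (tw wW.cnj wF₂ t'),
      ← (tw wF₁.cnj wF₁ t').tsum_sub (tw wF₂.cnj wF₂ t')]
    congr 1
    funext m
    simp only [hat_cnj, hW t' ht', map_sub]
    ring

/-- Starting from the global difference, the localized difference equation is iterated. On [0, t]
with t ≤ δ = 1/μ the cutoff is 1, so every iterate takes the values of the difference there. The
squared norm of the iterates is at least halved in each step. As it controls the coefficients at
time t, the difference vanishes; no restriction norms on time intervals are needed. -/
theorem exists_local_uniqueness (L : ℝ) [Fact (0 < L)] (α β : ℝ) {γ s b : ℝ} (hγ : |γ| ≠ 1)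
    (hs : 1 / 2 ≤ s) {ψ : ℝ → ℝ} (hψ : IsCutoff ψ) (hb : 1 / 2 < b) (hb' : b < 5 / 8) (M : ℝ≥0) :
    ∃ δ : ℝ, 0 < δ ∧ ∀ (T : ℝ) (c d : ℤ → ℂ) (F₁ G₁ F₂ G₂ : ℤ × ℝ → ℂ), Measurable F₁ →
      Measurable G₁ → Measurable F₂ → Measurable G₂ → nsq (phiX L) 1 s b F₁ ≤ M →
      nsq (phiY L γ) 1 (s - 1 / 2) b G₁ ≤ M → nsq (phiX L) 1 s b F₂ ≤ M →
      nsq (phiY L γ) 1 (s - 1 / 2) b G₂ ≤ M → IsMild L α β γ T c d F₁ G₁ →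
      IsMild L α β γ T c d F₂ G₂ → ∀ t ∈ Icc 0 T, t ≤ δ → ∀ n,
        hat F₁ t n = hat F₂ t n ∧ hat G₁ t n = hat G₂ t n := by
  obtain ⟨μ, hμ, hstep⟩ := exists_pairSq_diffStep_le hψ.schwartz L α β hγ hs hb hb' M
  have hμ0 : 0 < μ := by linarith
  have hs0 : 0 ≤ s := by linarith
  have hs1 : 0 ≤ s - 1 / 2 := by linarith
  refine ⟨μ⁻¹, inv_pos.mpr hμ0, fun T c d F₁ G₁ F₂ G₂ mF₁ mG₁ mF₂ mG₂ bF₁ bG₁ bF₂ bG₂ h₁ h₂ t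
    ht htδ n => ?_⟩
  have wF₁ : IsWiener F₁ := isWiener_of_nsq hs0 hb mF₁ (ne_top_of_le_ne_top (by simp) bF₁)
  have wF₂ : IsWiener F₂ := isWiener_of_nsq hs0 hb mF₂ (ne_top_of_le_ne_top (by simp) bF₂)
  have wG₁ : IsWiener G₁ := isWiener_of_nsq hs1 hb mG₁ (ne_top_of_le_ne_top (by simp) bG₁)
  have wG₂ : IsWiener G₂ := isWiener_of_nsq hs1 hb mG₂ (ne_top_of_le_ne_top (by simp) bG₂)
  set W₀ := F₁ + (-1 : ℂ) • F₂ with hW₀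
  set Z₀ := G₁ + (-1 : ℂ) • G₂ with hZ₀
  have mW₀ : Measurable W₀ := mF₁.add (mF₂.const_smul _)
  have mZ₀ : Measurable Z₀ := mG₁.add (mG₂.const_smul _)
  have hfin : pairSq L γ s b W₀ Z₀ ≠ ⊤ := by
    have e1 := nsq_add_le (phiX L) 1 s b (G := (-1 : ℂ) • F₂) mF₁
    have e2 := nsq_add_le (phiY L γ) 1 (s - 1 / 2) b (G := (-1 : ℂ) • G₂) mG₁
    simp only [nsq_smul, enorm_neg, enorm_one, one_pow, one_mul] at e1 e2
    have hfin2 : (2 * (M + M) : ℝ≥0∞) ≠ ⊤ := ENNReal.mul_ne_top (by simp) (by simp)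
    rw [pairSq, ENNReal.add_ne_top]
    exact ⟨ne_top_of_le_ne_top hfin2 (e1.trans (by gcongr)),
      ne_top_of_le_ne_top hfin2 (e2.trans (by gcongr))⟩
  have iter : ∀ j : ℕ, ∃ W Z : ℤ × ℝ → ℂ, Measurable W ∧ Measurable Z ∧
      pairSq L γ s b W Z ≤ 2⁻¹ ^ j * pairSq L γ s b W₀ Z₀ ∧ ∀ t' ∈ Icc 0 t, ∀ n,
        hat W t' n = hat F₁ t' n - hat F₂ t' n ∧ hat Z t' n = hat G₁ t' n - hat G₂ t' n := by
    intro j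
    induction j with
    | zero =>
      refine ⟨W₀, Z₀, mW₀, mZ₀, by simp, fun t' _ n => ⟨?_, ?_⟩⟩
      · rw [hat_add wF₁.isSliceIntegrable (wF₂.isSliceIntegrable.smul _), hat_smul]
        ring
      · rw [hat_add wG₁.isSliceIntegrable (wG₂.isSliceIntegrable.smul _), hat_smul]
        ring
    | succ j ih =>
      obtain ⟨W, Z, mW, mZ, hN, hh⟩ := ih
      have hNt : pairSq L γ s b W Z ≠ ⊤ :=
        ne_top_of_le_ne_top (ENNReal.mul_ne_top (by simp) hfin) hN
      obtain ⟨wW, wZ⟩ := isWiener_of_pairSq hs hb mW mZ hNt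
      obtain ⟨W', Z', hst⟩ : ∃ W' Z', DiffStep hψ.schwartz L α β γ μ F₁ G₁ F₂ W Z W' Z' :=
        ⟨_, _, rfl, rfl⟩
      refine ⟨W', Z', ?_, ?_, ?_, fun t' ht' n => ?_⟩
      · rw [hst.eq_W]
        exact (measurable_nonlinX _ L α μ mG₁ mW).add (measurable_nonlinX _ L α μ mZ mF₂)
      · rw [hst.eq_Z]
        exact (measurable_nonlinY _ L β γ μ mW mF₁).add (measurable_nonlinY _ L β γ μ mF₂ mW)
      · refine (hstep _ _ _ _ _ _ _ mF₁ mG₁ mF₂ mW mZ bF₁ bG₁ bF₂ hst).trans ?_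
        rw [pow_succ', mul_assoc]
        gcongr
      · refine hst.hat_eq hμ wF₁ wG₁ wF₂ wG₂ wW wZ h₁ h₂ ⟨ht'.1, ht'.2.trans ht.2⟩
          (hψ.schwartz_eq_one hμ0 t' ⟨ht'.1, ht'.2.trans htδ⟩)
          (fun t'' ht'' n => (hh t'' ⟨ht''.1, ht''.2.trans ht'.2⟩ n).1)
          (fun t'' ht'' n => (hh t'' ⟨ht''.1, ht''.2.trans ht'.2⟩ n).2) n
  have hlim : Filter.Tendsto (fun j : ℕ => embC b * (2⁻¹ ^ j * pairSq L γ s b W₀ Z₀))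
      Filter.atTop (nhds 0) := by
    have h1 : Filter.Tendsto (fun j : ℕ => (2⁻¹ : ℝ≥0∞) ^ j) Filter.atTop (nhds 0) :=
      ENNReal.tendsto_pow_atTop_nhds_zero_of_lt_one (by simp)
    have h2 := ENNReal.Tendsto.mul_const (b := pairSq L γ s b W₀ Z₀) h1 (Or.inr hfin)
    have h3 := ENNReal.Tendsto.const_mul (a := embC b) h2 (Or.inr (embC_ne_top hb))
    simpa using h3
  have fin : ∀ z : ℂ, (∀ j : ℕ, ‖z‖ₑ ^ 2 ≤ embC b * (2⁻¹ ^ j * pairSq L γ s b W₀ Z₀)) → z = 0 := by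
    intro z hz
    have h1 := ge_of_tendsto' hlim hz
    simpa using h1
  have htt : t ∈ Icc 0 t := ⟨ht.1, le_rfl⟩
  constructor
  · refine sub_eq_zero.mp (fin _ fun j => ?_)
    obtain ⟨W, Z, mW, mZ, hN, hh⟩ := iter j
    rw [← (hh t htt n).1]
    refine (enorm_hat_sq_le (φ := phiX L) (b := b) hs0 mW t n).trans ?_
    gcongr
    exact le_self_add.trans hN
  · refine sub_eq_zero.mp (fin _ fun j => ?_)
    obtain ⟨W, Z, mW, mZ, hN, hh⟩ := iter j
    rw [← (hh t htt n).2]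
    refine (enorm_hat_sq_le (φ := phiY L γ) (b := b) hs1 mZ t n).trans ?_
    gcongr
    exact le_add_self.trans hN

/-- The step δ depends only on a bound for the norms, and these do not change under translation in
time. Agreement up to kδ therefore restarts both solutions from common data at kδ, and the local
result advances by another δ. -/
theorem IsMild.hat_unique {L : ℝ} [Fact (0 < L)] {α β γ s b T : ℝ} (hγ : |γ| ≠ 1)
    (hs : 1 / 2 ≤ s) {ψ : ℝ → ℝ} (hψ : IsCutoff ψ) (hb : 1 / 2 < b) (hb' : b < 5 / 8)
    {c d : ℤ → ℂ} {F₁ G₁ F₂ G₂ : ℤ × ℝ → ℂ} (mF₁ : Measurable F₁) (mG₁ : Measurable G₁)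
    (mF₂ : Measurable F₂) (mG₂ : Measurable G₂) (bF₁ : nsq (phiX L) 1 s b F₁ ≠ ⊤)
    (bG₁ : nsq (phiY L γ) 1 (s - 1 / 2) b G₁ ≠ ⊤) (bF₂ : nsq (phiX L) 1 s b F₂ ≠ ⊤)
    (bG₂ : nsq (phiY L γ) 1 (s - 1 / 2) b G₂ ≠ ⊤) (h₁ : IsMild L α β γ T c d F₁ G₁)
    (h₂ : IsMild L α β γ T c d F₂ G₂) {t : ℝ} (ht : t ∈ Icc 0 T) (n : ℤ) :
    hat F₁ t n = hat F₂ t n ∧ hat G₁ t n = hat G₂ t n := by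
  have hs0 : 0 ≤ s := by linarith
  have hs1 : 0 ≤ s - 1 / 2 := by linarith
  have wF₁ : IsWiener F₁ := isWiener_of_nsq hs0 hb mF₁ bF₁
  have wF₂ : IsWiener F₂ := isWiener_of_nsq hs0 hb mF₂ bF₂
  have wG₁ : IsWiener G₁ := isWiener_of_nsq hs1 hb mG₁ bG₁
  have wG₂ : IsWiener G₂ := isWiener_of_nsq hs1 hb mG₂ bG₂
  lift nsq (phiX L) 1 s b F₁ to ℝ≥0 using bF₁ with M₁ hM₁
  lift nsq (phiY L γ) 1 (s - 1 / 2) b G₁ to ℝ≥0 using bG₁ with M₂ hM₂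
  lift nsq (phiX L) 1 s b F₂ to ℝ≥0 using bF₂ with M₃ hM₃
  lift nsq (phiY L γ) 1 (s - 1 / 2) b G₂ to ℝ≥0 using bG₂ with M₄ hM₄
  -- The sum of the four squared norms serves as one common bound.
  obtain ⟨δ, hδ, hloc⟩ := exists_local_uniqueness L α β hγ hs hψ hb hb' (M₁ + M₂ + M₃ + M₄)
  have main : ∀ k : ℕ, ∀ t ∈ Icc 0 T, t ≤ k * δ → ∀ n,
      hat F₁ t n = hat F₂ t n ∧ hat G₁ t n = hat G₂ t n := by
    intro k
    induction k with
    | zero =>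
      intro t ht hk n
      have h0 : t = 0 := le_antisymm (by simpa using hk) ht.1
      subst h0
      rw [h₁.eq_u 0 ht, h₂.eq_u 0 ht, h₁.eq_v 0 ht, h₂.eq_v 0 ht]
      simp only [duhamelFormula_zero, and_self]
    | succ k ih =>
      intro t ht hk n
      rcases le_total t (k * δ) with h | h
      · exact ih t ht h n
      · have ht₀ : (k * δ : ℝ) ∈ Icc 0 T := ⟨by positivity, h.trans ht.2⟩
        have e1 : hat F₂ (k * δ) = hat F₁ (k * δ) := funext fun n => (ih _ ht₀ le_rfl n).1.symm
        have e2 : hat G₂ (k * δ) = hat G₁ (k * δ) := funext fun n => (ih _ ht₀ le_rfl n).2.symm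
        have s₁ := h₁.shift wF₁ wG₁ ht₀
        have s₂ := h₂.shift wF₂ wG₂ ht₀
        rw [e1, e2] at s₂
        have h3 := hloc (T - k * δ) _ _ _ _ _ _ (measurable_shift _ mF₁) (measurable_shift _ mG₁)
          (measurable_shift _ mF₂) (measurable_shift _ mG₂)
          (by rw [nsq_shift, ← hM₁, ENNReal.coe_le_coe]; rw [add_assoc, add_assoc]; exact le_self_add)
          (by
            rw [nsq_shift, ← hM₂, ENNReal.coe_le_coe, add_assoc]
            exact le_add_self.trans le_self_add)
          (by rw [nsq_shift, ← hM₃, ENNReal.coe_le_coe]; exact le_add_self.trans le_self_add)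
          (by rw [nsq_shift, ← hM₄, ENNReal.coe_le_coe]; exact le_add_self)
          s₁ s₂ (t - k * δ) ⟨by linarith, by linarith [ht.2]⟩
          (by push_cast at hk; linarith) n
        simpa only [hat_shift, add_sub_cancel] using h3
  obtain ⟨k, hk⟩ := exists_nat_ge (t / δ)
  exact main k t ht ((div_le_iff₀ hδ).mp hk) n

/-- The representation holds only for almost every t, where the cutoff is 1. Both sides are
continuous on [0, T], so the equality extends to every t. -/
theorem Represents.fourierCoeff_eq_hat {L : ℝ} [Fact (0 < L)] {φ : ℤ → ℝ} {s b T : ℝ}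
    (hs : 0 ≤ s) (hb : 1 / 2 < b) {ψ : ℝ → ℝ} (hψ : IsCutoff ψ) (hT : 0 < T) {w : ℝ → L2T L}
    (hw : ContinuousOn w (Icc 0 T)) {u : Bourgain L φ s b} (h : Represents ψ T w u.toL2) {t : ℝ}
    (ht : t ∈ Icc 0 T) (n : ℤ) : fourierCoeff (w t) n = hat (stf u.toL2) t n := by
  have hW := isWiener_of_nsq hs hb (measurable_stf u.toL2) u.nsq_ne_top
  have h1 : (fun t => coeffL L n (w t)) =ᵐ[volume.restrict (Icc 0 T)]
      fun t => hat (stf u.toL2) t n := by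
    filter_upwards [h, ae_restrict_of_ae (u.ae_fourierCoeff_eq_hat hs hb),
      ae_restrict_mem measurableSet_Icc] with t h2 h3 h4
    have h5 : ψ (t / T) = 1 := hψ.eq_one _
      ⟨by have := div_nonneg h4.1 hT.le; linarith, (div_le_one hT).mpr h4.2⟩
    rw [h2, h5, one_smul, coeffL_apply, h3]
  have h2 := Measure.eqOn_Icc_of_ae_eq volume hT.ne h1
    ((coeffL L n).continuous.comp_continuousOn hw)
    (hW.isSliceIntegrable.continuous_hat n).continuousOn ht
  rw [← coeffL_apply]
  exact h2

theorem IsSolution.unique {L : ℝ} [Fact (0 < L)] {α β γ s b T : ℝ} (hγ : |γ| ≠ 1)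
    (hs : 1 / 2 ≤ s) {ψ : ℝ → ℝ} (hψ : IsCutoff ψ) (hb : 1 / 2 < b) (hb' : b < 5 / 8)
    (hT : 0 < T) {u₀ v₀ : L2T L} {u v u' v' : ℝ → L2T L} (h : IsSolution α β γ T u₀ v₀ u v)
    (h' : IsSolution α β γ T u₀ v₀ u' v') {p p' : Bourgain L (phiX L) s b}
    {q q' : Bourgain L (phiY L γ) (s - 1 / 2) b} (hp : Represents ψ T u p.toL2)
    (hq : Represents ψ T v q.toL2) (hp' : Represents ψ T u' p'.toL2)
    (hq' : Represents ψ T v' q'.toL2) {t : ℝ} (ht : t ∈ Icc 0 T) : u' t = u t ∧ v' t = v t := by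
  have hs0 : 0 ≤ s := by linarith
  have hs1 : 0 ≤ s - 1 / 2 := by linarith
  have wX := fun p : Bourgain L (phiX L) s b =>
    isWiener_of_nsq hs0 hb (measurable_stf p.toL2) p.nsq_ne_top
  have wY := fun q : Bourgain L (phiY L γ) (s - 1 / 2) b =>
    isWiener_of_nsq hs1 hb (measurable_stf q.toL2) q.nsq_ne_top
  have eu := fun t ht => hp.fourierCoeff_eq_hat hs0 hb hψ hT h.continuousOn_u (t := t) ht
  have ev := fun t ht => hq.fourierCoeff_eq_hat hs1 hb hψ hT h.continuousOn_v (t := t) ht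
  have eu' := fun t ht => hp'.fourierCoeff_eq_hat hs0 hb hψ hT h'.continuousOn_u (t := t) ht
  have ev' := fun t ht => hq'.fourierCoeff_eq_hat hs1 hb hψ hT h'.continuousOn_v (t := t) ht
  have m := h.isMild (wX p) (wY q) eu ev
  have m' := h'.isMild (wX p') (wY q') eu' ev'
  have key := fun n => m'.hat_unique hγ hs hψ hb hb' (measurable_stf _) (measurable_stf _)
    (measurable_stf _) (measurable_stf _) p'.nsq_ne_top q'.nsq_ne_top p.nsq_ne_top q.nsq_ne_top
    m ht n
  exact ⟨L2T_ext fun n => by rw [eu' t ht, eu t ht, (key n).1],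
    L2T_ext fun n => by rw [ev' t ht, ev t ht, (key n).2]⟩

end SBO

end

theorem theorem2 (L : ℝ) [Fact (0 < L)] (α β γ s : ℝ) (hα : α ≠ 0) (hβ : β ≠ 0)
    (hγ : γ ≠ 0) (hγ1 : |γ| ≠ 1) (hs : 1 / 2 ≤ s) (ψ : ℝ → ℝ) (hψ : SBO.IsCutoff ψ) :
    ∃ b₀ : ℝ, 1 / 2 < b₀ ∧ ∀ b : ℝ, 1 / 2 < b → b < b₀ →
      ∀ R : ℝ, 0 < R → ∃ T : ℝ, 0 < T ∧
        ∃ (S : SBO.Hs L s × SBO.HsReal L (s - 1 / 2) →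
              SBO.XPer L s b × SBO.YPer L γ (s - 1 / 2) b)
          (Sc : SBO.Hs L s × SBO.HsReal L (s - 1 / 2) →
              C(Set.Icc (0 : ℝ) T, SBO.Hs L s) × C(Set.Icc (0 : ℝ) T, SBO.HsReal L (s - 1 / 2))),
          (∀ (u₀ : SBO.Hs L s) (v₀ : SBO.HsReal L (s - 1 / 2)), ‖u₀‖ < R → ‖v₀‖ < R →
            ∃ u v : ℝ → SBO.L2T L,
              -- `(u, v)` solves the Cauchy problem on `[0, T]`
              SBO.IsSolution α β γ T u₀.toL2 v₀.1.toL2 u v ∧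
              -- and is of the form `(ψ_T S₁, ψ_T S₂)` with `(S₁, S₂)` in the Bourgain spaces
              SBO.Represents ψ T u (S (u₀, v₀)).1.toL2 ∧
              SBO.Represents ψ T v (S (u₀, v₀)).2.1.toL2 ∧
              -- it is continuous with values in the Sobolev spaces
              (∀ t : Set.Icc (0 : ℝ) T,
                ((Sc (u₀, v₀)).1 t).toL2 = u t ∧ ((Sc (u₀, v₀)).2 t).1.toL2 = v t) ∧
              -- and it is the only solution of this form
              (∀ (p : SBO.XPer L s b) (q : SBO.YPer L γ (s - 1 / 2) b) (u' v' : ℝ → SBO.L2T L),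
                SBO.IsSolution α β γ T u₀.toL2 v₀.1.toL2 u' v' →
                SBO.Represents ψ T u' p.toL2 → SBO.Represents ψ T v' q.1.toL2 →
                ∀ t ∈ Set.Icc (0 : ℝ) T, u' t = u t ∧ v' t = v t)) ∧
          -- the solution map is smooth
          ContDiffOn ℝ ∞ S {d | ‖d.1‖ < R ∧ ‖d.2‖ < R} ∧
          ContDiffOn ℝ ∞ Sc {d | ‖d.1‖ < R ∧ ‖d.2‖ < R} := by
  -- The threshold 9/16 comes from existence for large data; uniqueness needs only b < 5/8.
  refine ⟨9 / 16, by norm_num, fun b hb hb' R hR => ?_⟩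
  obtain ⟨T, hT, S, Sc, hsol, hS, hSc⟩ :=
    SBO.exists_solution_map L α β hγ1 hs hψ hb hb' hR
  refine ⟨T, hT, S, Sc, fun u₀ v₀ hu₀ hv₀ => ?_, hS, hSc⟩
  obtain ⟨u, v, h, hp, hq, hc⟩ := hsol u₀ v₀ hu₀ hv₀
  exact ⟨u, v, h, hp, hq, hc, fun p q u' v' h' hp' hq' t ht =>
    h.unique hγ1 hs hψ hb (by linarith) hT h' hp hq hp' hq' ht⟩
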